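/- Let $n\ge 2$. There is a constant $c_3=c_3(n)>0$, depending only on $n$, with the following property. Let $m\ge n$, let $\Omega\subset\mathbb{R}^n$ be a domain, and let $\omega=\sum_I \phi_I\,dx_I$ (sum over $I=(i_1<\dots<i_n)$) be an $n$-volume form on $\mathbb{R}^m$, i.e. a smooth, closed, nowhere vanishing differential $n$-form, with constant coefficients, i.e. all $\phi_I$ are constant. Let $\|\omega\|$ denote its pointwise comass norm, $\|\omega\|(p)=\sup\{|\omega_p(v_1,\dots,v_n)| : v_i\in\mathbb{R}^m,\ |v_i|\le 1\}$. Let $f\in W^{1,n}_{loc}(\Omega,\mathbb{R}^m)$ be a finite distortion $\omega$-curve with distortion function $K_f$: that is, $f\in W^{1,1}_{loc}(\Omega,\mathbb{R}^m)$, $\star f^*\omega\in L^1_{loc}(\Omega)$, and $K_f\ge 1$ is a measurable, almost everywhere finite function such that $$(\|\omega\|\circ f)\,|Df(x)|^n\le K_f(x)\,(\star f^*\omega)(x)\qquad\text{for a.e. }x\in\Omega,$$ where $Df$ is the weak differential, $|Df|$ its operator norm, and $\star f^*\omega$ the function with $f^*\omega=(\star f^*\omega)\,dx_1\wedge\dots\wedge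 dx_n$. If $\exp(\lambda K_f)\in L^1_{loc}(\Omega)$ for some $\lambda>0$, then for every real $a<c_3\lambda$, $$\star f^*\omega\,\log^a(e+\star f^*\omega)\in L^1_{loc}(\Omega)\quad\text{and}\quad |Df|^n\log^{a-1}(e+|Df|)\in L^1_{loc}(\Omega).$$ -/

import Mathlib

open MeasureTheory
open scoped ENNReal

/-- A differential `n`-form on `ℝ^m`. -/
abbrev DiffForm (n m : ℕ) : Type :=
  EuclideanSpace ℝ (Fin m) → (EuclideanSpace ℝ (Fin m)) [⋀^Fin n]→L[ℝ] ℝ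

/-- An `n`-volume form on `ℝ^m`: a smooth, non-vanishing, closed differential `n`-form. -/
structure IsVolumeForm {n m : ℕ} (ω : DiffForm n m) : Prop where
  smooth : ContDiff ℝ ((⊤ : ℕ∞) : WithTop ℕ∞) ω
  nonvanishing : ∀ p, ω p ≠ 0
  closed : ∀ p, extDeriv ω p = 0

/-- The coefficient `φ_I` of `ω = ∑_I φ_I dx_I`, i.e. `φ_I(p) = ω_p(e_{i_1}, …, e_{i_n})`. -/
noncomputable def DiffForm.coeff {n m : ℕ} (ω : DiffForm n m) (I : Fin n → Fin m)
    (p : EuclideanSpace ℝ (Fin m)) : ℝ :=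
  ω p (fun k => EuclideanSpace.basisFun (Fin m) ℝ (I k))

/-- All the functions `φ_I`, `I = (i_1 < ⋯ < i_n)`, are constant. -/
def DiffForm.HasConstantCoefficients {n m : ℕ} (ω : DiffForm n m) : Prop :=
  ∀ I : Fin n → Fin m, StrictMono I → ∃ c : ℝ, ∀ p, ω.coeff I p = c

/-- The pointwise comass norm `‖ω‖(p) = sup {|ω_p(v_1, …, v_n)| : |v_i| ≤ 1}`. -/
noncomputable def DiffForm.comass {n m : ℕ} (ω : DiffForm n m)
    (p : EuclideanSpace ℝ (Fin m)) : ℝ :=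
  sSup {t : ℝ | ∃ v : Fin n → EuclideanSpace ℝ (Fin m), (∀ i, ‖v i‖ ≤ 1) ∧ t = |ω p v|}

/-- `Df` is a weak (distributional) differential of `f` on the open set `Ω`. -/
structure HasWeakFDerivOn {n m : ℕ} (Ω : Set (EuclideanSpace ℝ (Fin n)))
    (f : EuclideanSpace ℝ (Fin n) → EuclideanSpace ℝ (Fin m))
    (Df : EuclideanSpace ℝ (Fin n) → EuclideanSpace ℝ (Fin n) →L[ℝ] EuclideanSpace ℝ (Fin m)) :
    Prop where
  locallyIntegrable : LocallyIntegrableOn f Ω volume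
  locallyIntegrable_deriv : LocallyIntegrableOn Df Ω volume
  integral_eq : ∀ φ : EuclideanSpace ℝ (Fin n) → ℝ,
    ContDiff ℝ ((⊤ : ℕ∞) : WithTop ℕ∞) φ → HasCompactSupport φ → tsupport φ ⊆ Ω →
    ∀ v : EuclideanSpace ℝ (Fin n),
      ∫ x in Ω, (fderiv ℝ φ x v) • f x = - ∫ x in Ω, φ x • Df x v

/-- `f ∈ W^{1,p}_loc(Ω, ℝ^m)`, with weak differential `Df`. -/
structure MemSobolevLoc {n m : ℕ} (Ω : Set (EuclideanSpace ℝ (Fin n))) (p : ℝ≥0∞)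
    (f : EuclideanSpace ℝ (Fin n) → EuclideanSpace ℝ (Fin m))
    (Df : EuclideanSpace ℝ (Fin n) → EuclideanSpace ℝ (Fin n) →L[ℝ] EuclideanSpace ℝ (Fin m)) :
    Prop where
  hasWeakFDerivOn : HasWeakFDerivOn Ω f Df
  memLp : ∀ C ⊆ Ω, IsCompact C → MemLp f p (volume.restrict C)
  memLp_deriv : ∀ C ⊆ Ω, IsCompact C → MemLp Df p (volume.restrict C)

/-- `⋆f^*ω`: the function with `(⋆f^*ω) dx_1 ∧ ⋯ ∧ dx_n = f^*ω`, that is, the value of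
`(f^*ω)_x = ω_{f(x)}(Df(x) ·, …, Df(x) ·)` on the standard basis of `ℝ^n`. -/
noncomputable def starPullback {n m : ℕ} (ω : DiffForm n m)
    (f : EuclideanSpace ℝ (Fin n) → EuclideanSpace ℝ (Fin m))
    (Df : EuclideanSpace ℝ (Fin n) → EuclideanSpace ℝ (Fin n) →L[ℝ] EuclideanSpace ℝ (Fin m))
    (x : EuclideanSpace ℝ (Fin n)) : ℝ :=
  ((ω (f x)).compContinuousLinearMap (Df x)) (fun i => EuclideanSpace.basisFun (Fin n) ℝ i)

/-- `f`, with weak differential `Df`, is a finite distortion `ω`-curve on `Ω` with distortion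
function `K`. The function `K` is finite almost everywhere and only matters up to null sets, so it
is taken real-valued; `|Df(x)|` is the operator norm. -/
structure IsFiniteDistortionCurve {n m : ℕ} (Ω : Set (EuclideanSpace ℝ (Fin n)))
    (ω : DiffForm n m)
    (f : EuclideanSpace ℝ (Fin n) → EuclideanSpace ℝ (Fin m))
    (Df : EuclideanSpace ℝ (Fin n) → EuclideanSpace ℝ (Fin n) →L[ℝ] EuclideanSpace ℝ (Fin m))
    (K : EuclideanSpace ℝ (Fin n) → ℝ) : Prop where
  sobolev : MemSobolevLoc Ω 1 f Df
  locallyIntegrable_star : LocallyIntegrableOn (starPullback ω f Df) Ω volume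
  measurable_distortion : AEMeasurable K (volume.restrict Ω)
  one_le_distortion : ∀ᵐ x ∂(volume.restrict Ω), 1 ≤ K x
  distortion_inequality : ∀ᵐ x ∂(volume.restrict Ω),
    ω.comass (f x) * ‖Df x‖ ^ n ≤ K x * starPullback ω f Df x

/-! Put `J = ⋆f^*ω` and `G = ‖ω‖ |Df|^n`. Constant coefficients make `ω` a single alternating map
(`DiffForm.HasConstantCoefficients.eq_const`) whose comass is its operator norm, so almost
everywhere `0 ≤ J ≤ G ≤ K J`. The proof is a Gehring argument for the pair `(J, G)` in which the
unbounded factor `K` costs one logarithm.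

Reverse Hölder. The pullback of a constant form is exact: `n ω(Du e₁, …, Du eₙ)` is a divergence,
because symmetric second derivatives cancel against an alternating map. Integrating by parts against
a cutoff and subtracting a constant `c` from `u` bounds `∫ φ J` by `(M/r) ∫ |u - c| |Du|^(n-1)`.
Hölder and a Sobolev-Poincaré inequality with gradient exponent `q = s n < n` turn this into a bound
for the average of `J` on a ball by the `L^s` average of `G` on the double ball, `s = 1 -
1/(n(2n+1))`. Mollification carries the estimate to Sobolev maps; since `J ≥ 0`, the cutoff can then
be dropped (`exists_reverse_holder`).

Level sets. Stopping balls and a Vitali covering give `∫_{J>t} J ≤ A t^(1-s) ∫_{AG>t} G^s`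
(`setLIntegral_superlevel_le`). Integrating against `d/dt log^a(e+t)` bounds `∫ J log^a(e+J)` by
lower order terms plus a multiple of `a ∫ G log^(a-1)(e+AG)`, up to truncation. The factor `a` comes
from the derivative and supplies the smallness.

Absorption (`exists_truncated_log_bound`). Where `K ≤ (2/λ) log(e+J)`, the factor `K` in `G ≤ K J`
restores the missing logarithm and the integrand is at most `(4A/λ) J log^a(e+J)` plus a multiple of
`J`. Elsewhere `J` is at most `exp(λK/2)` and `J + exp(λK)` dominates. Hence for `a ≤ c λ` the main
term has coefficient at most `1/2` and is absorbed, after truncating at height `T` to make it finite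
(`lintegral_mul_log_rpow_ne_top`).

Localization multiplies `J` and `G` by the `n`-th power of the depth inside a ball
(`exists_lintegral_mul_log_rpow_ne_top`). All constants entering `c₃` come from the dimension, the
cutoff and `s`, never from `m`, `ω` or `f`. The bound for `|Df|^n log^(a-1)` follows from the one
for `J` by the same dichotomy on `K`. -/

/-! ### Stopping balls, Vitali covering and the level set estimate. -/

section LevelSets

open Metric Set Filter Topology Module
open scoped NNReal

variable {E : Type*} [NormedAddCommGroup E] [NormedSpace ℝ E] [FiniteDimensional ℝ E]
  [MeasurableSpace E] [BorelSpace E]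

theorem addHaar_closedBall_const_mul (μ : Measure E) [μ.IsAddHaarMeasure] (x : E)
    {c r : ℝ} (hc : 0 ≤ c) (hr : 0 ≤ r) :
    μ (closedBall x (c * r)) = ENNReal.ofReal c ^ finrank ℝ E * μ (closedBall x r) := by
  rw [Measure.addHaar_closedBall_mul μ x hc hr, Measure.addHaar_closedBall_center μ x,
    ENNReal.ofReal_pow hc]

/-- Almost every point of the superlevel set `{t < J}` has an almost maximal ball on which the
average of `J` exceeds `t`. -/
theorem ae_exists_stopping_radius [Nontrivial E] (μ : Measure E) [μ.IsAddHaarMeasure]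
    {J : E → ℝ≥0∞} (hJ : Measurable J) (hJi : ∫⁻ x, J x ∂μ ≠ ∞) {t : ℝ≥0∞} (ht0 : t ≠ 0) :
    ∃ R : ℝ, ∀ᵐ x ∂μ, t < J x → ∃ r, 0 < r ∧ r ≤ R ∧
      t * μ (closedBall x r) < ∫⁻ y in closedBall x r, J y ∂μ ∧
      ∀ ρ, 2 * r ≤ ρ → ∫⁻ y in closedBall x ρ, J y ∂μ ≤ t * μ (closedBall x ρ) := by
  -- Admissible radii are bounded uniformly in the center: `t μ(B_r)` grows without bound, while the
  -- integral of `J` over any ball is at most its finite total.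
  obtain ⟨R, hR⟩ : ∃ R : ℝ, ∀ x : E, ∀ r : ℝ, 0 < r →
      t * μ (closedBall x r) < ∫⁻ y in closedBall x r, J y ∂μ → r ≤ R := by
    have hlim : Tendsto (fun r : ℝ => t * (ENNReal.ofReal r ^ finrank ℝ E * μ (closedBall (0:E) 1)))
        atTop (𝓝 ∞) := by
      have h1 : Tendsto (fun r : ℝ => ENNReal.ofReal r ^ finrank ℝ E) atTop (𝓝 ∞) := by
        have := (ENNReal.continuous_pow (finrank ℝ E)).tendsto ∞
        rw [ENNReal.top_pow finrank_pos.ne'] at this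
        exact this.comp ENNReal.tendsto_ofReal_atTop
      have h2 := ENNReal.Tendsto.mul_const (b := μ (closedBall (0:E) 1)) h1 (Or.inl ENNReal.top_ne_zero)
      rw [ENNReal.top_mul (measure_closedBall_pos μ _ one_pos).ne'] at h2
      have h3 := ENNReal.Tendsto.const_mul (a := t) h2 (Or.inl ENNReal.top_ne_zero)
      rwa [ENNReal.mul_top ht0] at h3
    have := (hlim.eventually (lt_mem_nhds (lt_top_iff_ne_top.2 hJi))).and (eventually_ge_atTop 0)
    obtain ⟨R, hR, hR0⟩ := this.exists
    refine ⟨R, fun x r hr h => ?_⟩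
    by_contra! hlt
    have : t * μ (closedBall x R) ≤ t * μ (closedBall x r) := by gcongr
    have h4 := addHaar_closedBall_const_mul μ x hR0 zero_le_one
    rw [mul_one] at h4
    rw [h4, Measure.addHaar_closedBall_center μ x] at this
    exact absurd (hR.trans_le (this.trans (h.le.trans (setLIntegral_le_lintegral _ _)))) (lt_irrefl _)
  refine ⟨R, ?_⟩
  filter_upwards [(Besicovitch.vitaliFamily μ).ae_tendsto_lintegral_div hJ.aemeasurable hJi]
    with x hx htx
  set S : Set ℝ := {r | 0 < r ∧ t * μ (closedBall x r) < ∫⁻ y in closedBall x r, J y ∂μ} with hS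
  have hSne : S.Nonempty := by
    have h1 := hx.comp (Besicovitch.tendsto_filterAt μ x)
    have h2 := (h1.eventually (lt_mem_nhds htx)).and self_mem_nhdsWithin
    obtain ⟨r, hr, hr0⟩ := h2.exists
    refine ⟨r, hr0, ?_⟩
    have hpos := measure_closedBall_pos μ x (show 0 < r from hr0)
    exact (ENNReal.lt_div_iff_mul_lt (Or.inl hpos.ne')
      (Or.inl measure_closedBall_lt_top.ne)).1 hr
  have hSb : BddAbove S := ⟨R, fun r hr => hR x r hr.1 hr.2⟩
  have hpos : 0 < sSup S := by
    obtain ⟨r, hr⟩ := hSne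
    exact hr.1.trans_le (le_csSup hSb hr)
  -- The supremum need not be attained; a radius above half of it suffices, since any `ρ ≥ 2 * r`
  -- then exceeds the supremum.
  obtain ⟨r, hrS, hr⟩ := exists_lt_of_lt_csSup hSne (half_lt_self hpos)
  refine ⟨r, hrS.1, hR x r hrS.1 hrS.2, hrS.2, fun ρ hρ => ?_⟩
  by_contra! hcon
  have : ρ ∈ S := ⟨by linarith [hrS.1], hcon⟩
  linarith [le_csSup hSb this]

/-- On a stopping ball the assumed inequality bounds `t^s μ(B)` by an integral of `G^s` over `2B`.
The points with `A G ≤ t` contribute at most half of the left side, so only the superlevel set of `A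
G` remains. A Vitali family of such balls covers the superlevel set of `J` after enlargement, and
the stopping property controls `J` on the enlarged balls. -/
theorem setLIntegral_superlevel_le [Nontrivial E] (μ : Measure E) [μ.IsAddHaarMeasure] {s : ℝ}
    (hs : 0 < s) (C : ℝ≥0) :
    ∃ A : ℝ, 1 ≤ A ∧ ∀ (J G : E → ℝ≥0∞), Measurable J → Measurable G → ∫⁻ x, J x ∂μ ≠ ∞ →
      ∀ t : ℝ≥0∞, t ≠ 0 → t ≠ ∞ →
      (∀ x r, 0 < r → t * μ (closedBall x r) < ∫⁻ y in closedBall x r, J y ∂μ →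
        t ^ s * μ (closedBall x r) ≤ C * ∫⁻ y in closedBall x (2 * r), G y ^ s ∂μ) →
      ∫⁻ x in {x | t < J x}, J x ∂μ ≤
        ENNReal.ofReal A * t ^ (1 - s) *
          ∫⁻ x in {x | t < ENNReal.ofReal A * G x}, G x ^ s ∂μ := by
  set d := finrank ℝ E with hd
  -- The second entry pays for the 8-fold enlargement; the third gives `A^s ≥ 2 · 2^d C`, which
  -- makes the contribution of `A G ≤ t` at most one half.
  set A : ℝ := max 1 (max (8 ^ d * (2 * C)) ((2 ^ (d + 1) * C) ^ (1 / s))) with hA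
  have hA1 : 1 ≤ A := le_max_left _ _
  have hA2 : 8 ^ d * (2 * C) ≤ A := (le_max_left _ _).trans (le_max_right _ _)
  have hA3 : 2 * (C * 2 ^ d) ≤ A ^ s := by
    have : ((2 ^ (d + 1) * C : ℝ) ^ (1 / s)) ^ s ≤ A ^ s := by
      gcongr
      exact (le_max_right _ _).trans (le_max_right _ _)
    rw [← Real.rpow_mul (by positivity), one_div, inv_mul_cancel₀ hs.ne', Real.rpow_one] at this
    linarith [this, show (2:ℝ) ^ (d + 1) * C = 2 * (C * 2 ^ d) by ring]
  refine ⟨A, hA1, fun J G hJ hG hJi t ht0 htop hRH => ?_⟩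
  obtain ⟨R, hR⟩ := ae_exists_stopping_radius μ hJ hJi ht0
  set Bad : Set E := {x | t < J x ∧ ∃ r, 0 < r ∧ r ≤ R ∧
      t * μ (closedBall x r) < ∫⁻ y in closedBall x r, J y ∂μ ∧
      ∀ ρ, 2 * r ≤ ρ → ∫⁻ y in closedBall x ρ, J y ∂μ ≤ t * μ (closedBall x ρ)} with hBad
  choose! r hr0 hrR hr1 hr2 using fun x (hx : x ∈ Bad) => hx.2
  -- The covering lemma is applied to the doubled balls, because the integrals of `G^s` live there
  -- and must be over disjoint sets to be summed. Enlargement by 4 then means radius `8 * r x`.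
  obtain ⟨u, huB, hudisj, hucov⟩ := Vitali.exists_disjoint_subfamily_covering_enlargement_closedBall
    Bad id (fun x => 2 * r x) (2 * R) (fun x hx => by linarith [hrR x hx]) 4 (by norm_num)
  simp only [id] at hudisj hucov
  have hucount : u.Countable := by
    refine hudisj.countable_of_nonempty_interior fun x hx => ?_
    have : 0 < 2 * r x := by linarith [hr0 x (huB hx)]
    exact ⟨x, mem_interior_iff_mem_nhds.2 (closedBall_mem_nhds _ this)⟩
  set W : Set E := {x | t < ENNReal.ofReal A * G x} with hW
  have hWm : MeasurableSet W := measurableSet_lt measurable_const (hG.const_mul _)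
  have hts0 : t ^ s ≠ ∞ := ENNReal.rpow_ne_top_of_nonneg hs.le htop
  have key : ∀ x ∈ u, t ^ s * μ (closedBall x (r x)) ≤
      2 * C * ∫⁻ y in closedBall x (2 * r x), W.indicator (fun y => G y ^ s) y ∂μ := by
    intro x hx
    have hxB := huB hx
    have hr := hr0 x hxB
    have h1 := hRH x (r x) hr (hr1 x hxB)
    have hb : ∀ y, G y ^ s ≤ W.indicator (fun y => G y ^ s) y + (t / ENNReal.ofReal A) ^ s := by
      intro y
      by_cases hy : y ∈ W
      · simp [hy]
      · rw [indicator_of_notMem hy, zero_add]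
        gcongr
        rw [ENNReal.le_div_iff_mul_le (Or.inl (by simp; linarith)) (Or.inl (by simp)), mul_comm]
        exact not_lt.1 hy
    have h2 : ∫⁻ y in closedBall x (2 * r x), G y ^ s ∂μ ≤
        (∫⁻ y in closedBall x (2 * r x), W.indicator (fun y => G y ^ s) y ∂μ) +
          (t / ENNReal.ofReal A) ^ s * (2 ^ d * μ (closedBall x (r x))) := by
      refine (lintegral_mono hb).trans ?_
      rw [lintegral_add_right _ measurable_const, setLIntegral_const,
        addHaar_closedBall_const_mul μ x two_pos.le hr.le]
      simp [hd]
    have h3 : C * ((t / ENNReal.ofReal A) ^ s * (2 ^ d * μ (closedBall x (r x)))) ≤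
        2⁻¹ * (t ^ s * μ (closedBall x (r x))) := by
      rw [ENNReal.div_rpow_of_nonneg _ _ hs.le, ENNReal.ofReal_rpow_of_pos (by linarith)]
      have : (C : ℝ≥0∞) * 2 ^ d ≤ 2⁻¹ * ENNReal.ofReal (A ^ s) := by
        rw [← ENNReal.mul_le_mul_iff_right (a := 2) (by simp) (by simp), ← mul_assoc 2 2⁻¹,
          ENNReal.mul_inv_cancel (by simp) (by simp), one_mul]
        have := ENNReal.ofReal_le_ofReal hA3
        rw [ENNReal.ofReal_mul (by simp), ENNReal.ofReal_mul (by simp), ENNReal.ofReal_pow (by simp)] at this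
        simpa using this
      have hApos : 0 < A ^ s := Real.rpow_pos_of_pos (by linarith) _
      calc (C : ℝ≥0∞) * (t ^ s / ENNReal.ofReal (A ^ s) * (2 ^ d * μ (closedBall x (r x))))
          = (C * 2 ^ d) * (ENNReal.ofReal (A ^ s))⁻¹ * (t ^ s * μ (closedBall x (r x))) := by
            rw [div_eq_mul_inv]; ring
        _ ≤ (2⁻¹ * ENNReal.ofReal (A ^ s)) * (ENNReal.ofReal (A ^ s))⁻¹ *
            (t ^ s * μ (closedBall x (r x))) := by gcongr
        _ = _ := by
            rw [mul_assoc 2⁻¹, ENNReal.mul_inv_cancel (by simpa using hApos) (by simp), mul_one]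
    set X := t ^ s * μ (closedBall x (r x)) with hX
    have hXtop : X ≠ ∞ := ENNReal.mul_ne_top hts0 measure_closedBall_lt_top.ne
    have h4 : X ≤ C * (∫⁻ y in closedBall x (2 * r x), W.indicator (fun y => G y ^ s) y ∂μ)
        + 2⁻¹ * X := by
      refine h1.trans ((mul_le_mul_right h2 _).trans ?_)
      rw [mul_add]
      gcongr
    have h5 : 2⁻¹ * X + 2⁻¹ * X ≤
        C * (∫⁻ y in closedBall x (2 * r x), W.indicator (fun y => G y ^ s) y ∂μ) + 2⁻¹ * X := by
      rwa [← add_mul, ENNReal.inv_two_add_inv_two, one_mul]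
    have h6 := (ENNReal.add_le_add_iff_right (ENNReal.mul_ne_top (by simp) hXtop)).1 h5
    calc X = 2 * (2⁻¹ * X) := by
          rw [← mul_assoc, ENNReal.mul_inv_cancel (by simp) (by simp), one_mul]
      _ ≤ _ := by rw [mul_assoc]; gcongr
  have hsub : ∀ᵐ x ∂μ, x ∈ {x | t < J x} → x ∈ ⋃ x ∈ u, closedBall x (8 * r x) := by
    filter_upwards [hR] with x hx hxt
    have hxB : x ∈ Bad := ⟨hxt, hx hxt⟩
    obtain ⟨b, hb, hxb⟩ := hucov x hxB
    refine mem_iUnion₂.2 ⟨b, hb, ?_⟩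
    have := hxb (mem_closedBall_self (by linarith [hr0 x hxB]))
    rwa [← mul_assoc, show (4 * 2 : ℝ) = 8 by norm_num] at this
  calc ∫⁻ x in {x | t < J x}, J x ∂μ
      ≤ ∫⁻ x in ⋃ x ∈ u, closedBall x (8 * r x), J x ∂μ := by
        refine lintegral_mono' (Measure.restrict_mono_ae hsub) le_rfl
    _ ≤ ∑' x : u, ∫⁻ y in closedBall (x : E) (8 * r x), J y ∂μ := by
        rw [biUnion_eq_iUnion]
        have := hucount.to_subtype
        exact lintegral_iUnion_le _ _
    _ ≤ ∑' x : u, ENNReal.ofReal A * t ^ (1 - s) *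
          ∫⁻ y in closedBall (x : E) (2 * r x), W.indicator (fun y => G y ^ s) y ∂μ := by
        refine ENNReal.tsum_le_tsum fun x => ?_
        have hxB := huB x.2
        have hr := hr0 x hxB
        refine (hr2 x hxB _ (by linarith)).trans ?_
        rw [addHaar_closedBall_const_mul μ _ (by norm_num) hr.le]
        have ht : t = t ^ (1 - s) * t ^ s := by
          rw [← ENNReal.rpow_add _ _ ht0 htop]; simp
        calc t * (ENNReal.ofReal 8 ^ finrank ℝ E * μ (closedBall (x : E) (r x)))
            = ENNReal.ofReal 8 ^ d * t ^ (1 - s) * (t ^ s * μ (closedBall (x : E) (r x))) := by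
              nth_rewrite 1 [ht]; ring
          _ ≤ ENNReal.ofReal 8 ^ d * t ^ (1 - s) * (2 * C *
              ∫⁻ y in closedBall (x : E) (2 * r x), W.indicator (fun y => G y ^ s) y ∂μ) := by
              exact mul_le_mul_right (key x x.2) _
          _ = (ENNReal.ofReal 8 ^ d * (2 * C)) * t ^ (1 - s) *
              ∫⁻ y in closedBall (x : E) (2 * r x), W.indicator (fun y => G y ^ s) y ∂μ := by ring
          _ ≤ _ := by
              gcongr
              have := ENNReal.ofReal_le_ofReal hA2
              rw [ENNReal.ofReal_mul (by positivity), ENNReal.ofReal_mul (by simp),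
                ENNReal.ofReal_pow (by simp)] at this
              simpa using this
    _ = ENNReal.ofReal A * t ^ (1 - s) *
          ∫⁻ y in ⋃ x ∈ u, closedBall x (2 * r x), W.indicator (fun y => G y ^ s) y ∂μ := by
        rw [ENNReal.tsum_mul_left, lintegral_biUnion hucount (fun x _ => measurableSet_closedBall)
          hudisj]
    _ ≤ ENNReal.ofReal A * t ^ (1 - s) * ∫⁻ y, W.indicator (fun y => G y ^ s) y ∂μ := by
        gcongr
        exact Measure.restrict_le_self
    _ = _ := by rw [lintegral_indicator hWm]

end LevelSets

/-! ### Logarithmic weights and the pointwise absorption inequality. -/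

section LogWeights

open Set Filter Topology

theorem one_le_log_exp_add {x : ℝ} (hx : 0 ≤ x) : 1 ≤ Real.log (Real.exp 1 + x) := by
  rw [Real.le_log_iff_exp_le (by positivity)]
  linarith

theorem log_exp_add_le_log_exp_add {x y : ℝ} (hx : 0 ≤ x) (hxy : x ≤ y) :
    Real.log (Real.exp 1 + x) ≤ Real.log (Real.exp 1 + y) :=
  Real.log_le_log (by positivity) (by linarith)

theorem log_exp_add_mul_le {x c : ℝ} (hx : 0 ≤ x) (hc : 1 ≤ c) :
    Real.log (Real.exp 1 + x * c) ≤ Real.log (Real.exp 1 + x) + Real.log c := by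
  rw [← Real.log_mul (by positivity) (by positivity)]
  apply Real.log_le_log (by positivity)
  nlinarith [Real.exp_pos 1]

/-- Only `a < 1` needs work: `log(e+S)` exceeds `log(e+t)` by at most `log(S/t)`, which a small
power of `S/t` dominates. The hypothesis `0 ≤ a` keeps the exponent `1 - a` at most 1, so one factor
`Q` is enough. -/
theorem log_rpow_le_div_rpow_mul_log_rpow {t S β : ℝ} (a : ℝ) (ha : 0 ≤ a) (ht : 0 < t)
    (htS : t ≤ S) (hβ : 0 < β) (hβ1 : β ≤ 1) :
    Real.log (Real.exp 1 + t) ^ (a - 1) ≤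
      β⁻¹ * (S / t) ^ β * Real.log (Real.exp 1 + S) ^ (a - 1) := by
  have hy : 1 ≤ S / t := (one_le_div ht).2 htS
  have hy0 : 0 < S / t := by linarith
  have hyβ : 1 ≤ (S / t) ^ β := Real.one_le_rpow hy hβ.le
  have hβ' : 1 ≤ β⁻¹ := (one_le_inv₀ hβ).2 hβ1
  set Q := β⁻¹ * (S / t) ^ β with hQ
  have hQ1 : 1 ≤ Q := by nlinarith
  have hlog : 1 + Real.log (S / t) ≤ Q := by
    have h1 := Real.log_le_sub_one_of_pos (Real.rpow_pos_of_pos hy0 β)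
    rw [Real.log_rpow hy0] at h1
    have h2 : Real.log (S / t) ≤ β⁻¹ * ((S / t) ^ β - 1) := by
      rw [inv_mul_eq_div, le_div_iff₀ hβ]; linarith
    rw [hQ]; nlinarith
  have hLt := one_le_log_exp_add ht.le
  have hLS := one_le_log_exp_add (ht.le.trans htS)
  have hle := log_exp_add_le_log_exp_add ht.le htS
  have hpos : 0 < Real.log (Real.exp 1 + S) ^ (a - 1) := Real.rpow_pos_of_pos (by linarith) _
  rcases le_total 1 a with h | h
  · calc Real.log (Real.exp 1 + t) ^ (a - 1) ≤ Real.log (Real.exp 1 + S) ^ (a - 1) := by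
          apply Real.rpow_le_rpow (by linarith) hle (by linarith)
      _ ≤ _ := le_mul_of_one_le_left hpos.le hQ1
  · have h3 : Real.log (Real.exp 1 + S) ≤ Real.log (Real.exp 1 + t) * Q := by
      have h4 := log_exp_add_mul_le ht.le hy
      rw [mul_div_cancel₀ _ ht.ne'] at h4
      have h5 : 0 ≤ Real.log (S / t) := Real.log_nonneg hy
      nlinarith
    have h6 : Real.log (Real.exp 1 + S) / Q ≤ Real.log (Real.exp 1 + t) := by
      rwa [div_le_iff₀ (by linarith)]
    calc Real.log (Real.exp 1 + t) ^ (a - 1)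
        ≤ (Real.log (Real.exp 1 + S) / Q) ^ (a - 1) :=
          Real.rpow_le_rpow_of_nonpos (by positivity) h6 (by linarith)
      _ = Q ^ (1 - a) * Real.log (Real.exp 1 + S) ^ (a - 1) := by
          rw [Real.div_rpow (by linarith) (by linarith), show 1 - a = -(a - 1) by ring,
            Real.rpow_neg (by linarith)]
          field_simp
      _ ≤ Q * Real.log (Real.exp 1 + S) ^ (a - 1) := by
          gcongr
          calc Q ^ (1 - a) ≤ Q ^ (1 : ℝ) := Real.rpow_le_rpow_of_exponent_le hQ1 (by linarith)
            _ = Q := Real.rpow_one _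

/-- The derivative of `log ^ a (e + t)`. -/
noncomputable def logWeight (a t : ℝ) : ℝ :=
  a * Real.log (Real.exp 1 + t) ^ (a - 1) / (Real.exp 1 + t)

theorem measurable_logWeight (a : ℝ) : Measurable (logWeight a) := by
  unfold logWeight
  fun_prop

theorem logWeight_nonneg {a t : ℝ} (ha : 0 ≤ a) (ht : 0 ≤ t) : 0 ≤ logWeight a t := by
  have := one_le_log_exp_add ht
  unfold logWeight
  positivity

theorem hasDerivAt_log_rpow {a t : ℝ} (ht : 0 ≤ t) :
    HasDerivAt (fun t => Real.log (Real.exp 1 + t) ^ a) (logWeight a t) t := by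
  have h0 : 0 < Real.exp 1 + t := by positivity
  have h1 := ((hasDerivAt_id t).const_add (Real.exp 1)).log h0.ne'
  simp only [id] at h1
  have h2 := h1.rpow_const (p := a) (Or.inl (by linarith [one_le_log_exp_add ht]))
  convert h2 using 1
  rw [logWeight]
  ring

theorem continuousOn_logWeight (a : ℝ) : ContinuousOn (logWeight a) (Ici 0) := by
  intro t ht
  have h0 : 0 < Real.exp 1 + t := add_pos_of_pos_of_nonneg (Real.exp_pos _) ht
  have h1 : 0 < Real.log (Real.exp 1 + t) := by linarith [one_le_log_exp_add (x := t) ht]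
  refine ContinuousAt.continuousWithinAt ?_
  unfold logWeight
  refine ContinuousAt.div (continuousAt_const.mul (ContinuousAt.rpow_const ?_ (Or.inl h1.ne')))
    (by fun_prop) h0.ne'
  exact ContinuousAt.log (by fun_prop) h0.ne'

theorem lintegral_logWeight {a t₀ S : ℝ} (ha : 0 ≤ a) (ht₀ : 0 ≤ t₀) (hS : t₀ ≤ S) :
    ∫⁻ t in Ioo t₀ S, ENNReal.ofReal (logWeight a t) =
      ENNReal.ofReal (Real.log (Real.exp 1 + S) ^ a - Real.log (Real.exp 1 + t₀) ^ a) := by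
  have hInt : IntervalIntegrable (logWeight a) volume t₀ S := by
    apply ContinuousOn.intervalIntegrable
    apply (continuousOn_logWeight a).mono
    rw [uIcc_of_le hS]
    exact fun x hx => ht₀.trans hx.1
  rw [← intervalIntegral.integral_eq_sub_of_hasDerivAt (f := fun t => Real.log (Real.exp 1 + t) ^ a)
    (f' := logWeight a) (fun t ht => ?_) hInt,
    intervalIntegral.integral_of_le hS, ← setLIntegral_congr Ioo_ae_eq_Ioc.symm,
    ofReal_integral_eq_lintegral_ofReal]
  · exact (intervalIntegrable_iff_integrableOn_Ioc_of_le hS).1 hInt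
  · filter_upwards [ae_restrict_mem measurableSet_Ioc] with t ht
    exact logWeight_nonneg ha (ht₀.trans ht.1.le)
  · rw [uIcc_of_le hS] at ht
    exact hasDerivAt_log_rpow (ht₀.trans ht.1)

theorem lintegral_rpow_mul_logWeight_le {a s S : ℝ} (ha : 0 ≤ a) (hs0 : 0 < s) (hs1 : s < 1)
    (hS : 0 < S) :
    ∫⁻ t in Ioo 0 S, ENNReal.ofReal (t ^ (1 - s) * logWeight a t) ≤
      ENNReal.ofReal (a * (4 / (1 - s) ^ 2) *
        (S ^ (1 - s) * Real.log (Real.exp 1 + S) ^ (a - 1))) := by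
  -- Half of the power `t^(1-s)` pays for moving the logarithm from `t` to `S`, the other half keeps
  -- `t^(β-1)` integrable at 0. Each costs a factor `1/β`, whence `4/(1-s)^2`.
  set β := (1 - s) / 2 with hβ
  have hβ0 : 0 < β := by rw [hβ]; linarith
  have hLS := one_le_log_exp_add hS.le
  have hpt : ∀ t ∈ Ioo 0 S, t ^ (1 - s) * logWeight a t ≤
      (a * β⁻¹ * S ^ β * Real.log (Real.exp 1 + S) ^ (a - 1)) * t ^ (β - 1) := by
    intro t ht
    have h1 := log_rpow_le_div_rpow_mul_log_rpow a ha ht.1 ht.2.le hβ0 (by rw [hβ]; linarith)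
    have hL := one_le_log_exp_add ht.1.le
    have ht0 := ht.1
    calc t ^ (1 - s) * logWeight a t
        ≤ t ^ (1 - s) * (a * Real.log (Real.exp 1 + t) ^ (a - 1) / t) := by
          unfold logWeight
          gcongr
          linarith [Real.exp_pos 1]
      _ ≤ t ^ (1 - s) * (a * (β⁻¹ * (S / t) ^ β * Real.log (Real.exp 1 + S) ^ (a - 1)) / t) := by
          gcongr
      _ = _ := by
          rw [Real.div_rpow hS.le ht0.le, Real.rpow_sub_one ht0.ne',
            show 1 - s = β + β by rw [hβ]; ring, Real.rpow_add ht0]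
          have : t ^ β ≠ 0 := (Real.rpow_pos_of_pos ht0 β).ne'
          field_simp
  refine (setLIntegral_mono' measurableSet_Ioo
    fun t ht => ENNReal.ofReal_le_ofReal (hpt t ht)).trans ?_
  have hInt : IntervalIntegrable (fun t : ℝ => t ^ (β - 1)) volume 0 S :=
    intervalIntegral.intervalIntegrable_rpow' (by linarith)
  have hval : ∫⁻ t in Ioo 0 S, ENNReal.ofReal (t ^ (β - 1)) = ENNReal.ofReal (S ^ β / β) := by
    have h2 := integral_rpow (a := 0) (b := S) (r := β - 1) (Or.inl (by linarith))
    rw [sub_add_cancel, Real.zero_rpow hβ0.ne', sub_zero, intervalIntegral.integral_of_le hS.le] at h2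
    rw [← h2, setLIntegral_congr Ioo_ae_eq_Ioc, ofReal_integral_eq_lintegral_ofReal]
    · exact (intervalIntegrable_iff_integrableOn_Ioc_of_le hS.le).1 hInt
    · filter_upwards [ae_restrict_mem measurableSet_Ioc] with t ht
      exact Real.rpow_nonneg ht.1.le _
  have hc : 0 ≤ a * β⁻¹ * S ^ β * Real.log (Real.exp 1 + S) ^ (a - 1) := by positivity
  simp_rw [ENNReal.ofReal_mul hc]
  rw [lintegral_const_mul _ (by fun_prop), hval, ← ENNReal.ofReal_mul hc]
  apply ENNReal.ofReal_le_ofReal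
  apply le_of_eq
  rw [show 1 - s = β + β by rw [hβ]; ring, Real.rpow_add hS]
  field_simp
  ring

/-- Since `log(1 + B L) = o(L)`, the left side is asymptotic to `L^(b+1)`. The leading coefficient 2
depends on neither `B` nor `b`; only the additive `M` does, and this keeps the final threshold for
`a` proportional to `lam`. -/
theorem exists_mul_rpow_add_log_le {B b : ℝ} (hB : 0 ≤ B) (hb : 0 ≤ b) :
    ∃ M : ℝ, 0 ≤ M ∧ ∀ L : ℝ, 1 ≤ L →
      L * (L + Real.log (1 + B * L)) ^ b ≤ 2 * L ^ (b + 1) + M := by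
  have hlim : Tendsto (fun L : ℝ => (1 + Real.log (1 + B * L) / L) ^ b) atTop (𝓝 1) := by
    have h1 : Tendsto (fun L : ℝ => Real.log (1 + B * L) / L) atTop (𝓝 0) := by
      have hlow : ∀ᶠ L : ℝ in atTop, 0 ≤ Real.log (1 + B * L) / L := by
        filter_upwards [eventually_ge_atTop 1] with L hL
        exact div_nonneg (Real.log_nonneg (by nlinarith)) (by linarith)
      have hup : ∀ᶠ L : ℝ in atTop, Real.log (1 + B * L) / L ≤
          Real.log (1 + B) / L + Real.log L / L := by
        filter_upwards [eventually_ge_atTop 1] with L hL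
        rw [← add_div, ← Real.log_mul (by positivity) (by positivity)]
        gcongr
        nlinarith
      refine tendsto_of_tendsto_of_tendsto_of_le_of_le' tendsto_const_nhds ?_ hlow hup
      have h2 : Tendsto (fun L : ℝ => Real.log L / L) atTop (𝓝 0) :=
        Real.isLittleO_log_id_atTop.tendsto_div_nhds_zero
      simpa using (tendsto_const_nhds.div_atTop tendsto_id).add h2
    have h2 := (h1.const_add 1).rpow_const (p := b) (Or.inl (by norm_num))
    simpa using h2
  obtain ⟨L₀, hL₀⟩ := eventually_atTop.1
    ((hlim.eventually (ge_mem_nhds (show (1:ℝ) < 2 by norm_num))).and (eventually_ge_atTop 1))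
  have hL₀1 := (hL₀ L₀ le_rfl).2
  have hlogn : ∀ L : ℝ, 1 ≤ L → 0 ≤ Real.log (1 + B * L) := fun L hL =>
    Real.log_nonneg (by nlinarith)
  refine ⟨L₀ * (L₀ + Real.log (1 + B * L₀)) ^ b, ?_, fun L hL => ?_⟩
  · have := hlogn L₀ hL₀1
    positivity
  · have hl := hlogn L hL
    rcases le_total L₀ L with h | h
    · have h1 := (hL₀ L h).1
      have h2 : L + Real.log (1 + B * L) = L * (1 + Real.log (1 + B * L) / L) := by
        field_simp
      rw [h2, Real.mul_rpow (by linarith) (by positivity)]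
      have h3 : L * (L ^ b * (1 + Real.log (1 + B * L) / L) ^ b) =
          L ^ (b + 1) * (1 + Real.log (1 + B * L) / L) ^ b := by
        rw [Real.rpow_add_one (by positivity)]; ring
      have h4 : 0 ≤ L ^ (b + 1) := by positivity
      have h5 : 0 ≤ L₀ * (L₀ + Real.log (1 + B * L₀)) ^ b := by
        have := hlogn L₀ hL₀1
        positivity
      rw [h3]
      nlinarith
    · have : L * (L + Real.log (1 + B * L)) ^ b ≤ L₀ * (L₀ + Real.log (1 + B * L₀)) ^ b := by
        gcongr
      have h4 : 0 ≤ L ^ (b + 1) := by positivity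
      linarith

theorem rpow_le_const_mul_exp {N ν x : ℝ} (hN : 0 < N) (hν : 0 < ν) (hx : 0 ≤ x) :
    x ^ N ≤ (N / ν) ^ N * Real.exp (ν * x) := by
  have h1 : x ≤ N / ν * Real.exp (ν * x / N) := by
    have := Real.add_one_le_exp (ν * x / N)
    calc x = N / ν * (ν * x / N) := by field_simp
      _ ≤ _ := by gcongr; linarith
  calc x ^ N ≤ (N / ν * Real.exp (ν * x / N)) ^ N := by gcongr
    _ = _ := by
      rw [Real.mul_rpow (by positivity) (by positivity), ← Real.exp_mul]
      congr 2
      field_simp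

/-- The logarithm is at most linear in `K`, so the bracket grows polynomially and a second factor
`exp(ν K)` absorbs it. -/
theorem exists_exp_mul_rpow_le {A b ν N : ℝ} (hA : 1 ≤ A) (hb : 0 ≤ b) (hν : 0 < ν) (hN : 0 < N) :
    ∃ M : ℝ, 0 ≤ M ∧ ∀ K : ℝ, 1 ≤ K →
      Real.exp (ν * K) *
        (A * K * Real.log (Real.exp 1 + A * K * Real.exp (ν * K)) ^ b) ^ N ≤
      M * Real.exp (2 * ν * K) := by
  have he := Real.exp_pos 1
  have hlogA : 0 ≤ Real.log (Real.exp 1 + A) := by linarith [one_le_log_exp_add (x := A) (by linarith)]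
  set B := Real.log (Real.exp 1 + A) + 1 + ν with hB
  have hB0 : 0 < B := by linarith
  refine ⟨(A * B ^ b) ^ N * ((((1 + b) * N) / ν) ^ ((1 + b) * N)), by positivity, fun K hK => ?_⟩
  have hK0 : 0 < K := by linarith
  have hexp : 1 ≤ Real.exp (ν * K) := Real.one_le_exp (by positivity)
  have hlog : Real.log (Real.exp 1 + A * K * Real.exp (ν * K)) ≤ B * K := by
    have h1 : Real.exp 1 + A * K * Real.exp (ν * K) ≤
        (Real.exp 1 + A) * (K * Real.exp (ν * K)) := by
      have : 1 ≤ K * Real.exp (ν * K) := by nlinarith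
      nlinarith
    have h2 := Real.log_le_log (by positivity) h1
    rw [Real.log_mul (by positivity) (by positivity), Real.log_mul hK0.ne' (by positivity),
      Real.log_exp] at h2
    have h3 := Real.log_le_sub_one_of_pos hK0
    rw [hB]
    nlinarith
  have hlog0 : 1 ≤ Real.log (Real.exp 1 + A * K * Real.exp (ν * K)) :=
    one_le_log_exp_add (by positivity)
  calc Real.exp (ν * K) * (A * K * Real.log (Real.exp 1 + A * K * Real.exp (ν * K)) ^ b) ^ N
      ≤ Real.exp (ν * K) * (A * K * (B * K) ^ b) ^ N := by gcongr
    _ = Real.exp (ν * K) * ((A * B ^ b) ^ N * K ^ ((1 + b) * N)) := by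
        rw [Real.rpow_mul hK0.le, Real.rpow_add hK0, Real.rpow_one,
          ← Real.mul_rpow (by positivity) (by positivity), Real.mul_rpow hB0.le hK0.le]
        congr 2
        ring
    _ ≤ Real.exp (ν * K) * ((A * B ^ b) ^ N *
          ((((1 + b) * N) / ν) ^ ((1 + b) * N) * Real.exp (ν * K))) := by
        gcongr
        exact rpow_le_const_mul_exp (by positivity) hν hK0.le
    _ = _ := by
        rw [show 2 * ν * K = ν * K + ν * K by ring, Real.exp_add]
        ring

/-- The heart of the absorption: either `K` is at most `(2/lam) log(e + min J T)` and costs one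
logarithm, or `min J T` is at most `exp(lam K / 2)` and the exponential term wins. The coefficient
of the main term is free of `a`, while `M` may depend on it. -/
theorem exists_truncated_log_bound {s A a lam : ℝ} (hs0 : 0 < s) (hs1 : s < 1) (hA : 1 ≤ A)
    (hlam : 0 < lam) :
    ∃ M : ℝ, 0 ≤ M ∧ ∀ J G K T : ℝ, 0 ≤ J → J ≤ G → G ≤ K * J → 1 ≤ K → 0 < T →
      G ^ s * ((min T (A * G)) ^ (1 - s) * Real.log (Real.exp 1 + min T (A * G)) ^ (a - 1)) ≤
        4 * A / lam * (J * Real.log (Real.exp 1 + min J T) ^ a) +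
          M * (J + Real.exp (lam * K)) := by
  set ν := lam / 2 with hν
  have hν0 : 0 < ν := by positivity
  -- A nonnegative exponent dominating `a - 1`, so that the logarithmic power can be treated as
  -- increasing whatever the sign of `a - 1`.
  set b := max (a - 1) 0 with hb
  have hb0 : 0 ≤ b := le_max_right _ _
  have hs1' : 0 < 1 - s := by linarith
  obtain ⟨M₁, hM₁, h₁⟩ := exists_mul_rpow_add_log_le (B := A / ν) (b := b) (by positivity) hb0
  obtain ⟨M₂, hM₂, h₂⟩ := exists_exp_mul_rpow_le (N := 1 / (1 - s)) hA hb0 hν0 (by positivity)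
  refine ⟨2 * A / lam * M₁ + M₂ + 1, by positivity, fun J G K T hJ hJG hGK hK hT => ?_⟩
  set S := min T (A * G) with hS
  set L := Real.log (Real.exp 1 + min J T) with hL
  have hG : 0 ≤ G := hJ.trans hJG
  have hS0 : 0 ≤ S := le_min hT.le (by positivity)
  have hm0 : 0 ≤ min J T := le_min hJ hT.le
  have hL1 : 1 ≤ L := one_le_log_exp_add hm0
  have hlS1 := one_le_log_exp_add hS0
  have hSA : S ≤ A * G := min_le_right _ _
  have hexp := Real.exp_pos (lam * K)
  have hGA : G ≤ A * G := le_mul_of_one_le_left hG hA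
  -- The dichotomy between small and large distortion relative to the truncated logarithm.
  rcases le_or_gt (ν * K) L with hc | hc
  · have hK' : K ≤ L / ν := by rw [le_div_iff₀ hν0]; linarith
    have hGL : G ≤ L / ν * J := hGK.trans (by gcongr)
    have hGS : G ^ s * S ^ (1 - s) ≤ 2 * A / lam * (J * L) := by
      calc G ^ s * S ^ (1 - s) ≤ (A * G) ^ s * (A * G) ^ (1 - s) := by gcongr
        _ = A * G := by
          rw [← Real.rpow_add_of_nonneg (by positivity) hs0.le hs1'.le]; simp
        _ ≤ A * (L / ν * J) := by gcongr
        _ = _ := by rw [hν]; field_simp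
    have hlog : L * Real.log (Real.exp 1 + S) ^ (a - 1) ≤ 2 * L ^ a + M₁ := by
      rcases le_total a 1 with ha | ha
      · have hmS : min J T ≤ S := by
          rw [hS]
          refine le_min (min_le_right _ _) ((min_le_left _ _).trans (hJG.trans hGA))
        have : Real.log (Real.exp 1 + S) ^ (a - 1) ≤ L ^ (a - 1) :=
          Real.rpow_le_rpow_of_nonpos (by linarith) (log_exp_add_le_log_exp_add hm0 hmS)
            (by linarith)
        have h3 : L * L ^ (a - 1) = L ^ a := by
          rw [Real.rpow_sub_one (by positivity)]; field_simp
        have h4 : 0 ≤ L ^ a := by positivity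
        nlinarith
      · have hba : b = a - 1 := max_eq_left (by linarith)
        have h3 := h₁ L hL1
        rw [hba, sub_add_cancel] at h3
        refine le_trans ?_ h3
        have hBL : 0 ≤ A / ν * L := by positivity
        have hSm : S ≤ min J T * (1 + A / ν * L) := by
          rcases le_total J T with h | h
          · rw [min_eq_left h]
            calc S ≤ A * G := hSA
              _ ≤ A * (L / ν * J) := by gcongr
              _ = J * (A / ν * L) := by ring
              _ ≤ _ := by gcongr; linarith
          · rw [min_eq_right h]
            calc S ≤ T := min_le_left _ _
              _ ≤ _ := by nlinarith
        have h5 : Real.log (Real.exp 1 + S) ≤ L + Real.log (1 + A / ν * L) :=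
          (log_exp_add_le_log_exp_add hS0 hSm).trans (log_exp_add_mul_le hm0 (by linarith))
        gcongr
    calc G ^ s * (S ^ (1 - s) * Real.log (Real.exp 1 + S) ^ (a - 1))
        = (G ^ s * S ^ (1 - s)) * Real.log (Real.exp 1 + S) ^ (a - 1) := by ring
      _ ≤ 2 * A / lam * (J * L) * Real.log (Real.exp 1 + S) ^ (a - 1) := by gcongr
      _ = 2 * A / lam * J * (L * Real.log (Real.exp 1 + S) ^ (a - 1)) := by ring
      _ ≤ 2 * A / lam * J * (2 * L ^ a + M₁) := by gcongr
      _ = 4 * A / lam * (J * L ^ a) + (2 * A / lam * M₁) * J := by ring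
      _ ≤ _ := by
        gcongr
        · linarith
        · linarith
  · have hmexp : min J T ≤ Real.exp (ν * K) := by
      have := (Real.log_lt_iff_lt_exp (by positivity)).1 hc
      linarith [Real.exp_pos 1]
    have hK0 : 0 < K := by linarith
    have hAK : 1 ≤ A * K := by nlinarith
    have hSK : S ≤ A * K * Real.exp (ν * K) := by
      have h3 : S ≤ A * K * min J T := by
        rcases le_total J T with h | h
        · rw [min_eq_left h]
          calc S ≤ A * G := hSA
            _ ≤ A * (K * J) := by gcongr
            _ = _ := by ring
        · rw [min_eq_right h]
          calc S ≤ T := min_le_left _ _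
            _ ≤ _ := by nlinarith
      exact h3.trans (by gcongr)
    set P := Real.log (Real.exp 1 + A * K * Real.exp (ν * K)) ^ b with hP
    have hlog : Real.log (Real.exp 1 + S) ^ (a - 1) ≤ P := by
      calc Real.log (Real.exp 1 + S) ^ (a - 1) ≤ Real.log (Real.exp 1 + S) ^ b :=
            Real.rpow_le_rpow_of_exponent_le hlS1 (le_max_left _ _)
        _ ≤ P := by
            have := log_exp_add_le_log_exp_add hS0 hSK
            exact Real.rpow_le_rpow (by linarith) this hb0
    have hP0 : 0 ≤ P := by
      have : 0 ≤ Real.log (Real.exp 1 + S) ^ (a - 1) := by positivity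
      linarith
    -- Only `min J T` is controlled here, not `J`, so the factor `J^s` is kept. `Y` is chosen with
    -- `Y^(1-s)` equal to everything else, and Young's inequality separates the two.
    set Y := Real.exp (ν * K) * (A * K * P) ^ (1 / (1 - s)) with hY
    have hY0 : 0 ≤ Y := by positivity
    have hYM : Y ≤ M₂ * Real.exp (lam * K) := by
      have := h₂ K hK
      rwa [show 2 * ν * K = lam * K by rw [hν]; ring] at this
    have hY1 : Y ^ (1 - s) = Real.exp (ν * K) ^ (1 - s) * (A * K * P) := by
      rw [hY, Real.mul_rpow (by positivity) (by positivity), ← Real.rpow_mul (by positivity),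
        one_div, inv_mul_cancel₀ hs1'.ne', Real.rpow_one]
    have hyoung : J ^ s * Y ^ (1 - s) ≤ J + Y := by
      have := Real.geom_mean_le_arith_mean2_weighted hs0.le hs1'.le hJ hY0 (by ring)
      nlinarith
    calc G ^ s * (S ^ (1 - s) * Real.log (Real.exp 1 + S) ^ (a - 1))
        ≤ (A * K * J) ^ s * ((A * K * Real.exp (ν * K)) ^ (1 - s) * P) := by
          gcongr
          nlinarith [mul_nonneg hK0.le hJ]
      _ = ((A * K) ^ s * (A * K) ^ (1 - s)) * J ^ s * (Real.exp (ν * K)) ^ (1 - s) * P := by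
          rw [Real.mul_rpow (x := A * K) (by positivity) hJ,
            Real.mul_rpow (x := A * K) (by positivity) (Real.exp_pos _).le]
          ring
      _ = J ^ s * Y ^ (1 - s) := by
          rw [← Real.rpow_add (by positivity), hY1]; simp; ring
      _ ≤ J + Y := hyoung
      _ ≤ J + M₂ * Real.exp (lam * K) := by gcongr
      _ ≤ (2 * A / lam * M₁ + M₂ + 1) * (J + Real.exp (lam * K)) := by
          have h3 : 0 ≤ 2 * A / lam * M₁ * (J + Real.exp (lam * K)) := by positivity
          have h4 : 0 ≤ M₂ * J := by positivity
          linear_combination h3 + h4 + hexp.le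
      _ ≤ _ := by
          have : 0 ≤ 4 * A / lam * (J * L ^ a) := by positivity
          linarith

end LogWeights

/-! ### From the level set estimate to `L log^a` integrability. -/

section LogIntegrability

open Set Filter Topology

variable {α : Type*} [MeasurableSpace α]

/-- Layer-cake form of the logarithm: its increment from `t₀` to `min j T` is the integral of
`logWeight a`, and levels below `t₀` cost only a constant multiple of `j`. -/
theorem ofReal_mul_log_rpow_le {a j t₀ T : ℝ} (ha : 0 ≤ a) (hj : 0 ≤ j) (ht₀ : 0 ≤ t₀)
    (hT : t₀ ≤ T) :
    ENNReal.ofReal (j * Real.log (Real.exp 1 + min j T) ^ a) ≤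
      ENNReal.ofReal (Real.log (Real.exp 1 + t₀) ^ a) * ENNReal.ofReal j +
        ∫⁻ t in Ioo t₀ T, if t < j then ENNReal.ofReal j * ENNReal.ofReal (logWeight a t) else 0 := by
  have hL0 := one_le_log_exp_add ht₀
  have hm : 0 ≤ min j T := le_min hj (ht₀.trans hT)
  have hL1 := one_le_log_exp_add hm
  rcases le_total j t₀ with h | h
  · refine le_trans ?_ le_self_add
    rw [← ENNReal.ofReal_mul (by positivity)]
    apply ENNReal.ofReal_le_ofReal
    rw [mul_comm]
    have := log_exp_add_le_log_exp_add hm ((min_le_left j T).trans h)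
    gcongr
  · have hS : t₀ ≤ min j T := le_min h hT
    have h1 : ∫⁻ t in Ioo t₀ (min j T), ENNReal.ofReal j * ENNReal.ofReal (logWeight a t) ≤
        ∫⁻ t in Ioo t₀ T,
          if t < j then ENNReal.ofReal j * ENNReal.ofReal (logWeight a t) else 0 := by
      calc ∫⁻ t in Ioo t₀ (min j T), ENNReal.ofReal j * ENNReal.ofReal (logWeight a t)
          = ∫⁻ t in Ioo t₀ (min j T),
            if t < j then ENNReal.ofReal j * ENNReal.ofReal (logWeight a t) else 0 := by
            refine setLIntegral_congr_fun measurableSet_Ioo fun t ht => ?_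
            rw [if_pos (ht.2.trans_le (min_le_left _ _))]
        _ ≤ _ := lintegral_mono_set (Ioo_subset_Ioo_right (min_le_right _ _))
    refine le_trans ?_ (add_le_add_right h1 _)
    rw [lintegral_const_mul _ (measurable_logWeight a).ennreal_ofReal, lintegral_logWeight ha ht₀ hS,
      ← ENNReal.ofReal_mul (by positivity), ← ENNReal.ofReal_mul hj, ← ENNReal.ofReal_add]
    · apply ENNReal.ofReal_le_ofReal
      linarith
    · positivity
    · have := log_exp_add_le_log_exp_add ht₀ hS
      have : Real.log (Real.exp 1 + t₀) ^ a ≤ Real.log (Real.exp 1 + min j T) ^ a := by gcongr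
      exact mul_nonneg hj (by linarith)

theorem lintegral_superlevel_weight_le {a s A g t₀ T : ℝ} (ha : 0 ≤ a) (hs0 : 0 < s) (hs1 : s < 1)
    (hA : 1 ≤ A) (hg : 0 ≤ g) (ht₀ : 0 ≤ t₀) (hT : 0 < T) :
    ∫⁻ t in Ioo t₀ T, (if t < A * g then
        ENNReal.ofReal g ^ s * ENNReal.ofReal (t ^ (1 - s) * logWeight a t) else 0) ≤
      ENNReal.ofReal (a * (4 / (1 - s) ^ 2) * (g ^ s *
        ((min T (A * g)) ^ (1 - s) * Real.log (Real.exp 1 + min T (A * g)) ^ (a - 1)))) := by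
  rcases hg.eq_or_lt with rfl | hg
  · refine le_of_eq_of_le ?_ zero_le
    rw [lintegral_eq_zero_iff' (by
      refine Measurable.aemeasurable (Measurable.ite (measurableSet_lt measurable_id measurable_const)
        ?_ measurable_const)
      have := measurable_logWeight a
      fun_prop)]
    filter_upwards [ae_restrict_mem measurableSet_Ioo] with t ht
    rw [if_neg (by simp; linarith [ht.1])]
    rfl
  · have hS : 0 < min T (A * g) := lt_min hT (by positivity)
    calc ∫⁻ t in Ioo t₀ T, (if t < A * g then
          ENNReal.ofReal g ^ s * ENNReal.ofReal (t ^ (1 - s) * logWeight a t) else 0)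
        = ∫⁻ t in Ioo t₀ T, (Iio (A * g)).indicator (fun t =>
          ENNReal.ofReal g ^ s * ENNReal.ofReal (t ^ (1 - s) * logWeight a t)) t := by
          rfl
      _ = ∫⁻ t in Iio (A * g) ∩ Ioo t₀ T,
          ENNReal.ofReal g ^ s * ENNReal.ofReal (t ^ (1 - s) * logWeight a t) := by
          rw [lintegral_indicator measurableSet_Iio, Measure.restrict_restrict measurableSet_Iio]
      _ ≤ ∫⁻ t in Ioo 0 (min T (A * g)),
          ENNReal.ofReal g ^ s * ENNReal.ofReal (t ^ (1 - s) * logWeight a t) := by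
          refine lintegral_mono_set fun t ht => ⟨ht₀.trans_lt ht.2.1, lt_min ht.2.2 ht.1⟩
      _ = ENNReal.ofReal g ^ s * ∫⁻ t in Ioo 0 (min T (A * g)),
          ENNReal.ofReal (t ^ (1 - s) * logWeight a t) := by
          have := measurable_logWeight a
          rw [lintegral_const_mul _ (by fun_prop)]
      _ ≤ ENNReal.ofReal g ^ s * ENNReal.ofReal (a * (4 / (1 - s) ^ 2) *
          ((min T (A * g)) ^ (1 - s) * Real.log (Real.exp 1 + min T (A * g)) ^ (a - 1))) := by
          gcongr
          exact lintegral_rpow_mul_logWeight_le ha hs0 hs1 hS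
      _ = _ := by
          rw [ENNReal.ofReal_rpow_of_pos hg, ← ENNReal.ofReal_mul (by positivity)]
          congr 1
          ring

/-- Tonelli: after exchanging the integrals, each fixed level `t` is the hypothesis `hlev`
multiplied by the weight at `t`. -/
theorem lintegral_mul_lintegral_superlevel_le {μ : Measure α} [SFinite μ] {J G : α → ℝ}
    (hJ : Measurable J) (hG : Measurable G) {s A a t₀ T : ℝ} (ht₀ : 0 ≤ t₀)
    (hlev : ∀ t, t₀ < t → ∫⁻ x in {x | t < J x}, ENNReal.ofReal (J x) ∂μ ≤
      ENNReal.ofReal A * ENNReal.ofReal t ^ (1 - s) *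
        ∫⁻ x in {x | t < A * G x}, ENNReal.ofReal (G x) ^ s ∂μ) :
    ∫⁻ x, (∫⁻ t in Ioo t₀ T, if t < J x then
        ENNReal.ofReal (J x) * ENNReal.ofReal (logWeight a t) else 0) ∂μ ≤
      ENNReal.ofReal A * ∫⁻ x, (∫⁻ t in Ioo t₀ T, if t < A * G x then
        ENNReal.ofReal (G x) ^ s * ENNReal.ofReal (t ^ (1 - s) * logWeight a t) else 0) ∂μ := by
  have hw := measurable_logWeight a
  have hm1 : Measurable (fun z : α × ℝ => if z.2 < J z.1 then
      ENNReal.ofReal (J z.1) * ENNReal.ofReal (logWeight a z.2) else 0) :=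
    Measurable.ite (measurableSet_lt measurable_snd (hJ.comp measurable_fst)) (by fun_prop)
      measurable_const
  have hm2 : Measurable (fun z : α × ℝ => if z.2 < A * G z.1 then
      ENNReal.ofReal (G z.1) ^ s * ENNReal.ofReal (z.2 ^ (1 - s) * logWeight a z.2) else 0) :=
    Measurable.ite (measurableSet_lt measurable_snd ((hG.comp measurable_fst).const_mul A))
      (by fun_prop) measurable_const
  rw [lintegral_lintegral_swap hm1.aemeasurable,
    lintegral_lintegral_swap (f := fun x t => if t < A * G x then
      ENNReal.ofReal (G x) ^ s * ENNReal.ofReal (t ^ (1 - s) * logWeight a t) else 0)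
      hm2.aemeasurable,
    ← lintegral_const_mul _ (by
      exact Measurable.lintegral_prod_right' (f := fun z : ℝ × α => if z.1 < A * G z.2 then
        ENNReal.ofReal (G z.2) ^ s * ENNReal.ofReal (z.1 ^ (1 - s) * logWeight a z.1) else 0)
        (hm2.comp measurable_swap))]
  refine setLIntegral_mono' measurableSet_Ioo fun t ht => ?_
  have ht0 : 0 < t := ht₀.trans_lt ht.1
  calc ∫⁻ x, (if t < J x then ENNReal.ofReal (J x) * ENNReal.ofReal (logWeight a t) else 0) ∂μ
      = ∫⁻ x in {x | t < J x}, ENNReal.ofReal (J x) * ENNReal.ofReal (logWeight a t) ∂μ := by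
        rw [← lintegral_indicator (measurableSet_lt measurable_const hJ)]
        rfl
    _ = (∫⁻ x in {x | t < J x}, ENNReal.ofReal (J x) ∂μ) * ENNReal.ofReal (logWeight a t) :=
        lintegral_mul_const _ hJ.ennreal_ofReal
    _ ≤ (ENNReal.ofReal A * ENNReal.ofReal t ^ (1 - s) *
        ∫⁻ x in {x | t < A * G x}, ENNReal.ofReal (G x) ^ s ∂μ) * ENNReal.ofReal (logWeight a t) := by
        gcongr
        exact hlev t ht.1
    _ = ENNReal.ofReal A * ((∫⁻ x in {x | t < A * G x}, ENNReal.ofReal (G x) ^ s ∂μ) *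
          ENNReal.ofReal (t ^ (1 - s) * logWeight a t)) := by
        rw [ENNReal.ofReal_mul (by positivity), ENNReal.ofReal_rpow_of_pos ht0]
        ring
    _ = ENNReal.ofReal A * ∫⁻ x in {x | t < A * G x}, ENNReal.ofReal (G x) ^ s *
          ENNReal.ofReal (t ^ (1 - s) * logWeight a t) ∂μ := by
        rw [lintegral_mul_const _ (by fun_prop)]
    _ = _ := by
        rw [← lintegral_indicator (measurableSet_lt measurable_const (hG.const_mul A))]
        rfl

/-- A level set estimate of Gehring type for a pair `J ≤ G ≤ K J` with `exp (lam * K)` integrable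
improves the integrability of `J` by a power of the logarithm. -/
theorem lintegral_mul_log_rpow_ne_top {μ : Measure α} [SFinite μ] {J G K : α → ℝ}
    (hJ : Measurable J) (hG : Measurable G) {s A a lam t₀ : ℝ} (hs0 : 0 < s) (hs1 : s < 1)
    (hA : 1 ≤ A) (ha : 0 < a) (hlam : 0 < lam) (ht₀ : 0 < t₀)
    (haL : a ≤ (1 - s) ^ 2 / (32 * A ^ 2) * lam)
    (hJ0 : ∀ᵐ x ∂μ, 0 ≤ J x) (hJG : ∀ᵐ x ∂μ, J x ≤ G x) (hGK : ∀ᵐ x ∂μ, G x ≤ K x * J x)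
    (hK : ∀ᵐ x ∂μ, 1 ≤ K x) (hJi : ∫⁻ x, ENNReal.ofReal (J x) ∂μ ≠ ∞)
    (hKi : ∫⁻ x, ENNReal.ofReal (Real.exp (lam * K x)) ∂μ ≠ ∞)
    (hlev : ∀ t, t₀ < t → ∫⁻ x in {x | t < J x}, ENNReal.ofReal (J x) ∂μ ≤
      ENNReal.ofReal A * ENNReal.ofReal t ^ (1 - s) *
        ∫⁻ x in {x | t < A * G x}, ENNReal.ofReal (G x) ^ s ∂μ) :
    ∫⁻ x, ENNReal.ofReal (J x * Real.log (Real.exp 1 + J x) ^ a) ∂μ ≠ ∞ := by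
  obtain ⟨M, hM, hbound⟩ := exists_truncated_log_bound (a := a) hs0 hs1 hA hlam
  set D := a * (4 / (1 - s) ^ 2) with hD
  have hD0 : 0 ≤ D := by positivity
  -- Everything that is not absorbed: the levels below `t₀` and the error term of the pointwise
  -- bound. It does not depend on the truncation height `T`.
  set C₁ : ℝ≥0∞ := ENNReal.ofReal (Real.log (Real.exp 1 + t₀) ^ a) *
      (∫⁻ x, ENNReal.ofReal (J x) ∂μ) + ENNReal.ofReal (A * D * M) *
      ((∫⁻ x, ENNReal.ofReal (J x) ∂μ) + ∫⁻ x, ENNReal.ofReal (Real.exp (lam * K x)) ∂μ) with hC₁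
  have hC₁top : C₁ ≠ ∞ := by
    rw [hC₁]
    finiteness
  have hmeas : ∀ T, Measurable fun x =>
      ENNReal.ofReal (J x * Real.log (Real.exp 1 + min (J x) T) ^ a) := fun T => by fun_prop
  have main : ∀ T, t₀ ≤ T →
      ∫⁻ x, ENNReal.ofReal (J x * Real.log (Real.exp 1 + min (J x) T) ^ a) ∂μ ≤ 2 * C₁ := by
    intro T hT
    have hT0 : 0 < T := ht₀.trans_le hT
    set I := ∫⁻ x, ENNReal.ofReal (J x * Real.log (Real.exp 1 + min (J x) T) ^ a) ∂μ with hI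
    -- The reason for truncating: half of `I` can be subtracted from both sides only if `I` is
    -- finite beforehand.
    have hItop : I ≠ ∞ := by
      have : I ≤ ∫⁻ x, ENNReal.ofReal (Real.log (Real.exp 1 + T) ^ a) * ENNReal.ofReal (J x) ∂μ := by
        refine lintegral_mono_ae ?_
        filter_upwards [hJ0] with x hx
        have hm : 0 ≤ min (J x) T := le_min hx hT0.le
        have h1 := one_le_log_exp_add hm
        have h1' := one_le_log_exp_add hT0.le
        have h2 := log_exp_add_le_log_exp_add hm (min_le_right (J x) T)
        rw [← ENNReal.ofReal_mul (by positivity)]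
        apply ENNReal.ofReal_le_ofReal
        rw [mul_comm]
        gcongr
      rw [lintegral_const_mul _ hJ.ennreal_ofReal] at this
      exact ne_top_of_le_ne_top (ENNReal.mul_ne_top (by simp) hJi) this
    have h1 : I ≤ ENNReal.ofReal (Real.log (Real.exp 1 + t₀) ^ a) *
        (∫⁻ x, ENNReal.ofReal (J x) ∂μ) +
        ∫⁻ x, (∫⁻ t in Ioo t₀ T, if t < J x then
          ENNReal.ofReal (J x) * ENNReal.ofReal (logWeight a t) else 0) ∂μ := by
      rw [← lintegral_const_mul _ hJ.ennreal_ofReal, ← lintegral_add_left (by fun_prop)]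
      refine lintegral_mono_ae ?_
      filter_upwards [hJ0] with x hx
      exact ofReal_mul_log_rpow_le ha.le hx ht₀.le hT
    have h2 : ∫⁻ x, (∫⁻ t in Ioo t₀ T, if t < A * G x then
        ENNReal.ofReal (G x) ^ s * ENNReal.ofReal (t ^ (1 - s) * logWeight a t) else 0) ∂μ ≤
        ENNReal.ofReal (D * (4 * A / lam)) * I + ENNReal.ofReal (D * M) *
        ((∫⁻ x, ENNReal.ofReal (J x) ∂μ) + ∫⁻ x, ENNReal.ofReal (Real.exp (lam * K x)) ∂μ) := by
      rw [hI, ← lintegral_add_left hJ.ennreal_ofReal, ← lintegral_const_mul _ (hmeas T),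
        ← lintegral_const_mul' _ _ ENNReal.ofReal_ne_top,
        ← lintegral_add_left ((hmeas T).const_mul _)]
      refine lintegral_mono_ae ?_
      filter_upwards [hJ0, hJG, hGK, hK] with x h0 hJGx hGKx hKx
      refine (lintegral_superlevel_weight_le ha.le hs0 hs1 hA (h0.trans hJGx) ht₀.le hT0).trans ?_
      have hb := hbound (J x) (G x) (K x) T h0 hJGx hGKx hKx hT0
      have hL1 := one_le_log_exp_add (le_min h0 hT0.le)
      rw [← ENNReal.ofReal_add h0 (Real.exp_pos _).le, ← ENNReal.ofReal_mul (by positivity),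
        ← ENNReal.ofReal_mul (by positivity), ← ENNReal.ofReal_add (by positivity) (by positivity)]
      apply ENNReal.ofReal_le_ofReal
      calc _ ≤ D * (4 * A / lam * (J x * Real.log (Real.exp 1 + min (J x) T) ^ a) +
          M * (J x + Real.exp (lam * K x))) := by gcongr
        _ = _ := by ring
    have h3 : I ≤ C₁ + 2⁻¹ * I := by
      refine h1.trans ((add_le_add_right ((lintegral_mul_lintegral_superlevel_le hJ hG ht₀.le
        hlev).trans (mul_le_mul_right h2 _)) _).trans ?_)
      rw [mul_add, ← mul_assoc, ← mul_assoc, ← ENNReal.ofReal_mul (by linarith),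
        ← ENNReal.ofReal_mul (by linarith), hC₁, ← mul_assoc A D M, add_assoc]
      refine add_le_add_right ?_ _
      rw [add_comm]
      refine add_le_add_right ?_ _
      gcongr
      -- The 32 in the bound on `a` is chosen so that the coefficient of the absorbed term is at
      -- most one half.
      have h4 : A * (D * (4 * A / lam)) ≤ 2⁻¹ := by
        have h5 : A * (D * (4 * A / lam)) =
            a * (16 * A ^ 2 / ((1 - s) ^ 2 * lam)) := by
          rw [hD]; field_simp; ring
        have hs1' : 0 < 1 - s := by linarith
        rw [h5]
        calc a * (16 * A ^ 2 / ((1 - s) ^ 2 * lam)) ≤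
            ((1 - s) ^ 2 / (32 * A ^ 2) * lam) * (16 * A ^ 2 / ((1 - s) ^ 2 * lam)) := by gcongr
          _ = 2⁻¹ := by field_simp; norm_num
      calc ENNReal.ofReal (A * (D * (4 * A / lam))) ≤ ENNReal.ofReal 2⁻¹ :=
            ENNReal.ofReal_le_ofReal h4
        _ = 2⁻¹ := by rw [ENNReal.ofReal_inv_of_pos two_pos]; simp
    have h5 : 2⁻¹ * I + 2⁻¹ * I ≤ C₁ + 2⁻¹ * I := by
      rwa [← add_mul, ENNReal.inv_two_add_inv_two, one_mul]
    have h6 := (ENNReal.add_le_add_iff_right (ENNReal.mul_ne_top (by simp) hItop)).1 h5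
    calc I = 2 * (2⁻¹ * I) := by
          rw [← mul_assoc, ENNReal.mul_inv_cancel (by simp) (by simp), one_mul]
      _ ≤ _ := by gcongr
  -- Fatou along `T = t₀ + k`; pointwise the truncation is eventually inactive.
  have hfatou := lintegral_liminf_le (μ := μ) (u := atTop) (fun k : ℕ => hmeas (t₀ + k))
  have hlim : ∀ x, liminf (fun k : ℕ =>
      ENNReal.ofReal (J x * Real.log (Real.exp 1 + min (J x) (t₀ + k)) ^ a)) atTop =
      ENNReal.ofReal (J x * Real.log (Real.exp 1 + J x) ^ a) := by
    intro x
    refine Tendsto.liminf_eq (tendsto_const_nhds.congr' ?_)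
    obtain ⟨N, hN⟩ := exists_nat_ge (J x)
    filter_upwards [eventually_ge_atTop N] with k hk
    rw [min_eq_left]
    have : (N : ℝ) ≤ k := by exact_mod_cast hk
    linarith
  simp_rw [hlim] at hfatou
  refine ne_top_of_le_ne_top (ENNReal.mul_ne_top (a := 2) (by simp) hC₁top) (hfatou.trans ?_)
  refine liminf_le_of_frequently_le' (Frequently.of_forall fun k => main _ ?_)
  have : (0 : ℝ) ≤ k := Nat.cast_nonneg k
  linarith

end LogIntegrability

/-! ### A Sobolev-Poincaré inequality by integration along segments. -/

section Poincare

open Metric Set Filter Topology Module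

theorem rpow_lintegral_le_lintegral_rpow {α : Type*} [MeasurableSpace α] (P : Measure α)
    [IsProbabilityMeasure P] {p : ℝ} (hp : 1 ≤ p) {h : α → ℝ≥0∞} (hh : AEMeasurable h P) :
    (∫⁻ x, h x ∂P) ^ p ≤ ∫⁻ x, h x ^ p ∂P := by
  rcases hp.eq_or_lt with rfl | hp
  · simp
  · have hp0 : 0 < p := by linarith
    have h1 := ENNReal.lintegral_mul_le_Lp_mul_Lq P (Real.HolderConjugate.conjExponent hp) hh
      (aemeasurable_const (b := (1 : ℝ≥0∞)))
    simp only [Pi.mul_apply, mul_one, ENNReal.one_rpow, lintegral_const, measure_univ] at h1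
    calc (∫⁻ x, h x ∂P) ^ p ≤ ((∫⁻ x, h x ^ p ∂P) ^ (1 / p)) ^ p := by gcongr
      _ = _ := by rw [← ENNReal.rpow_mul, one_div, inv_mul_cancel₀ hp0.ne', ENNReal.rpow_one]

theorem enorm_sub_le_lintegral_fderiv {E F : Type*} [NormedAddCommGroup E] [NormedSpace ℝ E]
    [NormedAddCommGroup F] [NormedSpace ℝ F]
    [CompleteSpace F] {u : E → F} (hu : ContDiff ℝ 1 u) (x y : E) :
    ‖u y - u x‖ₑ ≤ ‖y - x‖ₑ * ∫⁻ t in Ioo (0:ℝ) 1, ‖fderiv ℝ u (x + t • (y - x))‖ₑ := by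
  have hd : ∀ t : ℝ, HasDerivAt (fun t : ℝ => u (x + t • (y - x)))
      (fderiv ℝ u (x + t • (y - x)) (y - x)) t := by
    intro t
    have h1 : HasDerivAt (fun t : ℝ => x + t • (y - x)) (y - x) t := by
      simpa using ((hasDerivAt_id t).smul_const (y - x)).const_add x
    exact ((hu.differentiable one_ne_zero) _).hasFDerivAt.comp_hasDerivAt t h1
  have hcont : Continuous fun t : ℝ => fderiv ℝ u (x + t • (y - x)) :=
    (hu.continuous_fderiv one_ne_zero).comp (by fun_prop)
  have hcont' : Continuous fun t : ℝ => fderiv ℝ u (x + t • (y - x)) (y - x) :=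
    hcont.clm_apply continuous_const
  have h2 := intervalIntegral.integral_eq_sub_of_hasDerivAt (a := 0) (b := 1) (fun t _ => hd t)
    (hcont'.intervalIntegrable _ _)
  simp only [one_smul, zero_smul, add_zero, add_sub_cancel] at h2
  rw [← h2, intervalIntegral.integral_of_le zero_le_one, ← setLIntegral_congr Ioo_ae_eq_Ioc.symm,
    ← lintegral_const_mul _ hcont.enorm.measurable]
  refine (enorm_integral_le_lintegral_enorm _).trans (lintegral_mono fun t => ?_)
  rw [mul_comm]
  exact ContinuousLinearMap.le_opENorm _ _

theorem lintegral_const_mul_lintegral_swap {α β : Type*} [MeasurableSpace α] [MeasurableSpace β]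
    {μ : Measure α} {ν : Measure β} [SFinite μ] [SFinite ν] {Φ : α → β → ℝ≥0∞}
    (hΦ : Measurable (Function.uncurry Φ)) (c : ℝ≥0∞) :
    ∫⁻ x, c * (∫⁻ t, Φ x t ∂ν) ∂μ = c * ∫⁻ t, (∫⁻ x, Φ x t ∂μ) ∂ν := by
  rw [lintegral_const_mul _ hΦ.lintegral_prod_right, lintegral_lintegral_swap hΦ.aemeasurable]

variable {E : Type*} [NormedAddCommGroup E] [NormedSpace ℝ E] [FiniteDimensional ℝ E]
  [MeasurableSpace E] [BorelSpace E]

/-- The map `y ↦ x + t (y - x)` sends the convex set `B` into itself and scales measure by `t^d`. -/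
theorem lintegral_comp_segment_le (μ : Measure E) [μ.IsAddHaarMeasure] {h : E → ℝ≥0∞}
    (hh : Measurable h) {B : Set E} (hB : MeasurableSet B) (hconv : Convex ℝ B) {x : E} (hx : x ∈ B)
    {t : ℝ} (ht0 : 0 < t) (ht1 : t ≤ 1) :
    ∫⁻ y in B, h (x + t • (y - x)) ∂μ ≤
      ENNReal.ofReal ((t ^ finrank ℝ E)⁻¹) * ∫⁻ y in B, h y ∂μ := by
  have hF : Measurable (B.indicator h) := hh.indicator hB
  calc ∫⁻ y in B, h (x + t • (y - x)) ∂μ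
      ≤ ∫⁻ y, B.indicator h (t • y + (x - t • x)) ∂μ := by
        rw [← lintegral_indicator hB]
        refine lintegral_mono fun y => ?_
        by_cases hy : y ∈ B
        · rw [indicator_of_mem hy]
          have : t • y + (x - t • x) ∈ B := by
            have := hconv hx hy (by linarith : 0 ≤ 1 - t) ht0.le (by ring)
            convert this using 1
            module
          rw [indicator_of_mem this]
          apply le_of_eq
          congr 1
          module
        · simp [hy]
    _ = ∫⁻ z, B.indicator h (z + (x - t • x)) ∂(Measure.map (fun y => t • y) μ) := by
        rw [lintegral_map (by fun_prop) (by fun_prop)]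
    _ = _ := by
        rw [Measure.map_addHaar_smul μ ht0.ne', lintegral_smul_measure,
          lintegral_add_right_eq_self (fun z => B.indicator h z), lintegral_indicator hB,
          abs_of_pos (by positivity)]
        rfl

/-- Exchanging `x` and `y` replaces `t` by `1 - t`, so `t ≥ 1/2` may be assumed and the Jacobian
factor never exceeds `2^d`: averaging over both endpoints removes the singularity at `t = 0`. -/
theorem lintegral_lintegral_comp_segment_le (μ : Measure E) [μ.IsAddHaarMeasure] {h : E → ℝ≥0∞}
    (hh : Measurable h) {B : Set E} (hB : MeasurableSet B) (hconv : Convex ℝ B)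
    {t : ℝ} (ht0 : 0 ≤ t) (ht1 : t ≤ 1) :
    ∫⁻ x in B, ∫⁻ y in B, h (x + t • (y - x)) ∂μ ∂μ ≤
      2 ^ finrank ℝ E * μ B * ∫⁻ y in B, h y ∂μ := by
  have key : ∀ τ : ℝ, 1 / 2 ≤ τ → τ ≤ 1 →
      ∫⁻ x in B, ∫⁻ y in B, h (x + τ • (y - x)) ∂μ ∂μ ≤
        2 ^ finrank ℝ E * μ B * ∫⁻ y in B, h y ∂μ := by
    intro τ hτ hτ1
    have hτ0 : 0 < τ := by linarith
    calc ∫⁻ x in B, ∫⁻ y in B, h (x + τ • (y - x)) ∂μ ∂μ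
        ≤ ∫⁻ _ in B, 2 ^ finrank ℝ E * ∫⁻ y in B, h y ∂μ ∂μ := by
          refine setLIntegral_mono' hB fun x hx =>
            (lintegral_comp_segment_le μ hh hB hconv hx hτ0 hτ1).trans ?_
          gcongr
          have : ((τ ^ finrank ℝ E)⁻¹) ≤ 2 ^ finrank ℝ E := by
            rw [← inv_pow]
            gcongr
            rw [inv_le_comm₀ hτ0 two_pos]
            linarith
          calc ENNReal.ofReal ((τ ^ finrank ℝ E)⁻¹) ≤ ENNReal.ofReal (2 ^ finrank ℝ E) :=
                ENNReal.ofReal_le_ofReal this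
            _ = _ := by rw [ENNReal.ofReal_pow two_pos.le]; simp
      _ = _ := by rw [setLIntegral_const]; ring
  rcases le_total (1 / 2) t with h1 | h1
  · exact key t h1 ht1
  · rw [lintegral_lintegral_swap (by fun_prop)]
    convert key (1 - t) (by linarith) (by linarith) using 6 with y x
    module

theorem lintegral_rpow_neg_half : ∫⁻ t in Ioo (0:ℝ) 1, ENNReal.ofReal (t ^ (-(1/2) : ℝ)) = 2 := by
  have hInt : IntervalIntegrable (fun t : ℝ => t ^ (-(1/2) : ℝ)) volume 0 1 :=
    intervalIntegral.intervalIntegrable_rpow' (by norm_num)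
  have h2 := integral_rpow (a := 0) (b := 1) (r := -(1/2)) (Or.inl (by norm_num))
  rw [intervalIntegral.integral_of_le zero_le_one] at h2
  rw [setLIntegral_congr Ioo_ae_eq_Ioc, ← ofReal_integral_eq_lintegral_ofReal, h2]
  · norm_num
  · exact (intervalIntegrable_iff_integrableOn_Ioc_of_le zero_le_one).1 hInt
  · filter_upwards [ae_restrict_mem measurableSet_Ioc] with t ht
    exact Real.rpow_nonneg ht.1.le _

/-- A subcritical Sobolev-Poincaré inequality on balls. -/
theorem exists_lintegral_sub_const_rpow_le (μ : Measure E) [μ.IsAddHaarMeasure]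
    {F : Type*} [NormedAddCommGroup F] [NormedSpace ℝ F]
    [CompleteSpace F] {u : E → F} (hu : ContDiff ℝ 1 u) (x₀ : E) {r : ℝ} (hr : 0 < r) {p q : ℝ}
    (hq : 1 ≤ q) (hqp : q ≤ p) (hpq : finrank ℝ E * (p / q - 1) = 1 / 2) :
    ∃ c : F, ∫⁻ x in ball x₀ r, ‖u x - c‖ₑ ^ p ∂μ ≤
      ENNReal.ofReal (2 * r) ^ p * 2 ^ (finrank ℝ E + 1) * μ (ball x₀ r) ^ (1 - p / q) *
        (∫⁻ x in ball x₀ r, ‖fderiv ℝ u x‖ₑ ^ q ∂μ) ^ (p / q) := by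
  set d := finrank ℝ E with hd
  set B := ball x₀ r with hB
  have hBm : MeasurableSet B := measurableSet_ball
  have hBc : Convex ℝ B := convex_ball _ _
  set V := μ B with hV
  have hV0 : V ≠ 0 := (measure_ball_pos μ x₀ hr).ne'
  have hVt : V ≠ ∞ := measure_ball_lt_top.ne
  have hq0 : 0 < q := by linarith
  have hp1 : 1 ≤ p := hq.trans hqp
  set θ := p / q - 1 with hθ
  have hθ0 : 0 ≤ θ := by rw [hθ, sub_nonneg, one_le_div hq0]; exact hqp
  set P : Measure E := V⁻¹ • μ.restrict B with hP
  have hPprob : IsProbabilityMeasure P := ⟨by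
    simp [hP, ENNReal.inv_mul_cancel hV0 hVt, ← hV]⟩
  have hPB : ∀ᵐ y ∂P, y ∈ B := Measure.ae_smul_measure (ae_restrict_mem hBm) _
  have hui : Integrable u P := by
    refine Integrable.smul_measure ?_ (ENNReal.inv_ne_top.2 hV0)
    exact (hu.continuous.locallyIntegrable.integrableOn_isCompact
      (isCompact_closedBall x₀ r)).mono_set ball_subset_closedBall
  set g : E → ℝ≥0∞ := fun x => ‖fderiv ℝ u x‖ₑ with hg
  have hgm : Measurable g := (hu.continuous_fderiv one_ne_zero).enorm.measurable
  set I := ∫⁻ x in B, g x ^ q ∂μ with hI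
  -- The constant is the mean of `u` over the ball.
  refine ⟨∫ y, u y ∂P, ?_⟩
  have step1 : ∀ x ∈ B, ‖u x - ∫ y, u y ∂P‖ₑ ≤
      ENNReal.ofReal (2 * r) * ∫⁻ t in Ioo (0:ℝ) 1, ∫⁻ y, g (x + t • (y - x)) ∂P := by
    intro x hx
    have h1 : u x - ∫ y, u y ∂P = ∫ y, (u x - u y) ∂P := by
      rw [integral_sub (integrable_const _) hui, integral_const]; simp
    rw [h1]
    refine (enorm_integral_le_lintegral_enorm _).trans ?_
    rw [← lintegral_lintegral_swap (by fun_prop), ← lintegral_const_mul _ (by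
      exact Measurable.lintegral_prod_right' (f := fun z : E × ℝ => g (x + z.2 • (z.1 - x)))
        (by fun_prop))]
    refine lintegral_mono_ae ?_
    filter_upwards [hPB] with y hy
    rw [enorm_sub_rev]
    refine (enorm_sub_le_lintegral_fderiv hu x y).trans ?_
    gcongr
    rw [← ofReal_norm]
    apply ENNReal.ofReal_le_ofReal
    rw [hB, mem_ball, dist_eq_norm] at hx hy
    calc ‖y - x‖ = ‖(y - x₀) - (x - x₀)‖ := by congr 1; abel
      _ ≤ ‖y - x₀‖ + ‖x - x₀‖ := norm_sub_le _ _
      _ ≤ 2 * r := by linarith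
  -- Split `W^(p/q) = W · W^θ`. The factor `W^θ` is estimated for fixed `x` with Jacobian `t^(-d)`,
  -- and `hpq` makes the resulting singularity exactly `t^(-1/2)`, integrable on `(0,1)`. The factor
  -- `W` is left to be integrated over `x`, where no singularity appears.
  have step2 : ∀ x ∈ B, ∀ t ∈ Ioo (0:ℝ) 1, (∫⁻ y, g (x + t • (y - x)) ∂P) ^ p ≤
      (∫⁻ y, g (x + t • (y - x)) ^ q ∂P) * (V ^ (-θ) * I ^ θ * ENNReal.ofReal (t ^ (-(1/2) : ℝ))) := by
    intro x hx t ht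
    set W := ∫⁻ y, g (x + t • (y - x)) ^ q ∂P with hW
    have h1 : (∫⁻ y, g (x + t • (y - x)) ∂P) ^ p ≤ W ^ (p / q) := by
      have := rpow_lintegral_le_lintegral_rpow P hq
        (h := fun y => g (x + t • (y - x))) (by fun_prop)
      calc (∫⁻ y, g (x + t • (y - x)) ∂P) ^ p = ((∫⁻ y, g (x + t • (y - x)) ∂P) ^ q) ^ (p / q) := by
            rw [← ENNReal.rpow_mul, mul_div_cancel₀ _ hq0.ne']
        _ ≤ _ := by gcongr
    have h2 : W ≤ V⁻¹ * (ENNReal.ofReal ((t ^ d)⁻¹) * I) := by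
      rw [hW, hP, lintegral_smul_measure, smul_eq_mul]
      gcongr
      exact lintegral_comp_segment_le μ (h := fun y => g y ^ q) (by fun_prop) hBm hBc hx ht.1 ht.2.le
    have h3 : (V⁻¹ * (ENNReal.ofReal ((t ^ d)⁻¹) * I)) ^ θ =
        V ^ (-θ) * I ^ θ * ENNReal.ofReal (t ^ (-(1/2) : ℝ)) := by
      rw [ENNReal.mul_rpow_of_nonneg _ _ hθ0, ENNReal.mul_rpow_of_nonneg _ _ hθ0,
        ENNReal.inv_rpow, ENNReal.rpow_neg, ENNReal.ofReal_rpow_of_pos (by have := ht.1; positivity)]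
      have : ((t ^ d)⁻¹) ^ θ = t ^ (-(1/2) : ℝ) := by
        rw [← hpq, ← Real.rpow_natCast, ← Real.rpow_neg ht.1.le, ← Real.rpow_mul ht.1.le]
        congr 1
        ring
      rw [this]
      ring
    calc (∫⁻ y, g (x + t • (y - x)) ∂P) ^ p ≤ W ^ (p / q) := h1
      _ = W * W ^ θ := by
          rw [show p / q = 1 + θ by rw [hθ]; ring, ENNReal.rpow_add_of_nonneg _ _ zero_le_one hθ0,
            ENNReal.rpow_one]
      _ ≤ W * (V⁻¹ * (ENNReal.ofReal ((t ^ d)⁻¹) * I)) ^ θ := by gcongr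
      _ = _ := by rw [h3]
  have step3 : ∀ t ∈ Ioo (0:ℝ) 1,
      ∫⁻ x in B, (∫⁻ y, g (x + t • (y - x)) ^ q ∂P) ∂μ ≤ 2 ^ d * I := by
    intro t ht
    calc ∫⁻ x in B, (∫⁻ y, g (x + t • (y - x)) ^ q ∂P) ∂μ
        = V⁻¹ * ∫⁻ x in B, ∫⁻ y in B, g (x + t • (y - x)) ^ q ∂μ ∂μ := by
          rw [← lintegral_const_mul' _ _ (ENNReal.inv_ne_top.2 hV0)]
          refine lintegral_congr fun x => ?_
          rw [hP, lintegral_smul_measure, smul_eq_mul]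
      _ ≤ V⁻¹ * (2 ^ d * V * I) := by
          gcongr
          exact lintegral_lintegral_comp_segment_le μ (h := fun y => g y ^ q) (by fun_prop)
            hBm hBc ht.1.le ht.2.le
      _ = (V⁻¹ * V) * (2 ^ d * I) := by ring
      _ = _ := by rw [ENNReal.inv_mul_cancel hV0 hVt, one_mul]
  have hprob1 : IsProbabilityMeasure (volume.restrict (Ioo (0:ℝ) 1)) := ⟨by simp⟩
  have hmeas3 : Measurable fun z : (E × ℝ) × E => g (z.1.1 + z.1.2 • (z.2 - z.1.1)) := by fun_prop
  have hmeasH : Measurable fun z : E × ℝ => ∫⁻ y, g (z.1 + z.2 • (y - z.1)) ∂P :=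
    hmeas3.lintegral_prod_right'
  have hmeasW : Measurable fun z : E × ℝ => ∫⁻ y, g (z.1 + z.2 • (y - z.1)) ^ q ∂P :=
    (hmeas3.pow_const q).lintegral_prod_right'
  set c₀ := V ^ (-θ) * I ^ θ with hc₀
  have step4 : ∀ t ∈ Ioo (0:ℝ) 1, ∫⁻ x in B, (∫⁻ y, g (x + t • (y - x)) ^ q ∂P) *
      (c₀ * ENNReal.ofReal (t ^ (-(1/2) : ℝ))) ∂μ ≤
      (2 ^ d * I) * c₀ * ENNReal.ofReal (t ^ (-(1/2) : ℝ)) := by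
    intro t ht
    have hm : Measurable fun x : E => ∫⁻ y, g (x + t • (y - x)) ^ q ∂P :=
      Measurable.lintegral_prod_right' (f := fun z : E × E => g (z.1 + t • (z.2 - z.1)) ^ q)
        (by fun_prop)
    rw [lintegral_mul_const _ hm, mul_assoc (2 ^ d * I)]
    exact mul_le_mul_left (step3 t ht) _
  calc ∫⁻ x in B, ‖u x - ∫ y, u y ∂P‖ₑ ^ p ∂μ
      ≤ ∫⁻ x in B, ENNReal.ofReal (2 * r) ^ p * (∫⁻ t in Ioo (0:ℝ) 1,
          (∫⁻ y, g (x + t • (y - x)) ^ q ∂P) * (c₀ * ENNReal.ofReal (t ^ (-(1/2) : ℝ)))) ∂μ := by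
        refine setLIntegral_mono' hBm fun x hx => ?_
        calc ‖u x - ∫ y, u y ∂P‖ₑ ^ p ≤ (ENNReal.ofReal (2 * r) *
              ∫⁻ t in Ioo (0:ℝ) 1, ∫⁻ y, g (x + t • (y - x)) ∂P) ^ p := by
              gcongr
              exact step1 x hx
          _ = ENNReal.ofReal (2 * r) ^ p *
              (∫⁻ t in Ioo (0:ℝ) 1, ∫⁻ y, g (x + t • (y - x)) ∂P) ^ p :=
              ENNReal.mul_rpow_of_nonneg _ _ (by linarith)
          _ ≤ _ := by
              gcongr
              refine (rpow_lintegral_le_lintegral_rpow _ hp1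
                (hmeasH.comp measurable_prodMk_left).aemeasurable).trans ?_
              exact setLIntegral_mono' measurableSet_Ioo fun t ht => step2 x hx t ht
    _ = ENNReal.ofReal (2 * r) ^ p * ∫⁻ t in Ioo (0:ℝ) 1, ∫⁻ x in B,
          (∫⁻ y, g (x + t • (y - x)) ^ q ∂P) * (c₀ * ENNReal.ofReal (t ^ (-(1/2) : ℝ))) ∂μ := by
        exact lintegral_const_mul_lintegral_swap
          (Φ := fun x t => (∫⁻ y, g (x + t • (y - x)) ^ q ∂P) *
            (c₀ * ENNReal.ofReal (t ^ (-(1/2) : ℝ)))) (hmeasW.mul (by fun_prop)) _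
    _ ≤ ENNReal.ofReal (2 * r) ^ p * ∫⁻ t in Ioo (0:ℝ) 1,
          (2 ^ d * I) * c₀ * ENNReal.ofReal (t ^ (-(1/2) : ℝ)) := by
        exact mul_le_mul_right (setLIntegral_mono' measurableSet_Ioo step4) _
    _ = ENNReal.ofReal (2 * r) ^ p * ((2 ^ d * I) * c₀ * 2) := by
        rw [lintegral_const_mul _ (by fun_prop), lintegral_rpow_neg_half]
    _ = _ := by
        rw [hc₀, show p / q = 1 + θ by rw [hθ]; ring,
          ENNReal.rpow_add_of_nonneg _ _ zero_le_one hθ0, ENNReal.rpow_one,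
          show (1 : ℝ) - (1 + θ) = -θ by ring]
        ring

end Poincare

/-! ### Exactness of pulled back constant forms and the Caccioppoli estimate. -/

section Caccioppoli

open Metric Set Filter Topology Module

variable {ι : Type*} [Fintype ι] [DecidableEq ι]
  {F : Type*} [NormedAddCommGroup F] [NormedSpace ℝ F]

/-- Swapping the slots `i` and `j` changes the sign of `ω`, while `H` is symmetric; the double sum
therefore equals its own negative. -/
theorem sum_sum_update_update_eq_zero (ω : F [⋀^ι]→L[ℝ] ℝ) (D : ι → F) (u : F) (H : ι → ι → F)
    (hH : ∀ i j, H i j = H j i) :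
    ∑ i, ∑ j ∈ Finset.univ.erase i,
      ω (Function.update (Function.update D i u) j (H i j)) = 0 := by
  set Φ : ι → ι → ℝ := fun i j =>
    if i = j then 0 else ω (Function.update (Function.update D i u) j (H i j)) with hΦ
  have hsum : ∑ i, ∑ j ∈ Finset.univ.erase i,
      ω (Function.update (Function.update D i u) j (H i j)) = ∑ i, ∑ j, Φ i j := by
    refine Finset.sum_congr rfl fun i _ => ?_
    rw [← Finset.add_sum_erase _ _ (Finset.mem_univ i)]
    simp only [hΦ, if_true, zero_add]
    refine Finset.sum_congr rfl fun j hj => ?_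
    rw [if_neg (Finset.ne_of_mem_erase hj).symm]
  have hanti : ∀ i j, Φ i j = -Φ j i := by
    intro i j
    by_cases hij : i = j
    · simp [hΦ, hij]
    · simp only [hΦ, if_neg hij, if_neg (Ne.symm hij)]
      have h1 := ω.toAlternatingMap.map_swap
        (Function.update (Function.update D j u) i (H j i)) hij
      have h2 : (Function.update (Function.update D j u) i (H j i)) ∘ Equiv.swap i j =
          Function.update (Function.update D i u) j (H i j) := by
        funext k
        rcases eq_or_ne k i with rfl | hki
        · simp [hij, Ne.symm hij]
        · rcases eq_or_ne k j with rfl | hkj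
          · simp [hH]
          · simp [Equiv.swap_apply_of_ne_of_ne hki hkj, hki, hkj]
      rw [h2] at h1
      exact h1
  rw [hsum]
  have h3 : ∑ i, ∑ j, Φ i j = -∑ i, ∑ j, Φ i j := by
    calc ∑ i, ∑ j, Φ i j = ∑ j, ∑ i, Φ i j := Finset.sum_comm
      _ = ∑ j, ∑ i, -Φ j i := Finset.sum_congr rfl fun j _ =>
        Finset.sum_congr rfl fun i _ => hanti i j
      _ = _ := by simp
  linarith

variable {E : Type*} [NormedAddCommGroup E] [NormedSpace ℝ E]

theorem hasFDerivAt_alternating_update (ω : F [⋀^ι]→L[ℝ] ℝ) (e : ι → E) {u : E → F}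
    (hu : ContDiff ℝ 2 u) (i : ι) (x : E) :
    HasFDerivAt (fun x => ω (Function.update (fun k => fderiv ℝ u x (e k)) i (u x)))
      ((ω.1.linearDeriv (Function.update (fun k => fderiv ℝ u x (e k)) i (u x))).comp
        (ContinuousLinearMap.pi (Function.update
          (fun k => (fderiv ℝ (fderiv ℝ u) x).flip (e k)) i (fderiv ℝ u x)))) x := by
  refine (ω.hasFDerivAt _).comp x ?_
  rw [hasFDerivAt_pi']
  intro k
  have hpi : (ContinuousLinearMap.proj k).comp (ContinuousLinearMap.pi (Function.update
      (fun k => (fderiv ℝ (fderiv ℝ u) x).flip (e k)) i (fderiv ℝ u x))) =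
      Function.update (fun k => (fderiv ℝ (fderiv ℝ u) x).flip (e k)) i (fderiv ℝ u x) k := by
    ext; rfl
  rw [hpi]
  rcases eq_or_ne k i with rfl | hki
  · simpa using ((hu.differentiable two_ne_zero) x).hasFDerivAt
  · simp only [Function.update_of_ne hki]
    have h1 : HasFDerivAt (fderiv ℝ u) (fderiv ℝ (fderiv ℝ u) x) x :=
      ((hu.fderiv_right (m := 1) (by norm_num)).differentiable one_ne_zero x).hasFDerivAt
    have h2 := h1.clm_apply (hasFDerivAt_const (e k) x)
    convert h2 using 1
    ext v
    simp

/-- Coordinate form of the exactness of `u^*ω` for constant `ω`. Differentiating slot `i` gives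
`ω(Du e)` once for each index; the second-derivative terms cancel by symmetry. -/
theorem sum_fderiv_alternating_update (ω : F [⋀^ι]→L[ℝ] ℝ) (e : ι → E) {u : E → F}
    (hu : ContDiff ℝ 2 u) (x : E) :
    ∑ i, fderiv ℝ (fun x => ω (Function.update (fun k => fderiv ℝ u x (e k)) i (u x))) x (e i) =
      Fintype.card ι * ω (fun k => fderiv ℝ u x (e k)) := by
  set D : ι → F := fun k => fderiv ℝ u x (e k) with hD
  set H : ι → ι → F := fun i j => fderiv ℝ (fderiv ℝ u) x (e i) (e j) with hH
  have hsymm : ∀ i j, H i j = H j i := fun i j =>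
    (hu.contDiffAt.isSymmSndFDerivAt (by simp)) (e i) (e j)
  have hterm : ∀ i, fderiv ℝ (fun x => ω (Function.update (fun k => fderiv ℝ u x (e k)) i (u x)))
      x (e i) = ω D + ∑ j ∈ Finset.univ.erase i,
        ω (Function.update (Function.update D i (u x)) j (H i j)) := by
    intro i
    rw [(hasFDerivAt_alternating_update ω e hu i x).fderiv]
    have : ∀ v, (ω.1.linearDeriv (Function.update (fun k => fderiv ℝ u x (e k)) i (u x))) v =
        ∑ j, ω (Function.update (Function.update (fun k => fderiv ℝ u x (e k)) i (u x)) j (v j)) :=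
      fun v => ContinuousMultilinearMap.linearDeriv_apply _ _ _
    rw [ContinuousLinearMap.comp_apply, this, ← Finset.add_sum_erase _ _ (Finset.mem_univ i)]
    congr 1
    · congr 1
      rw [Function.update_idem]
      simp [hD]
    · refine Finset.sum_congr rfl fun j hj => ?_
      have hji := Finset.ne_of_mem_erase hj
      simp [Function.update_of_ne hji, hH, hD]
  rw [Finset.sum_congr rfl fun i _ => hterm i, Finset.sum_add_distrib,
    sum_sum_update_update_eq_zero ω D (u x) H hsymm]
  simp

theorem norm_alternating_update_le (ω : F [⋀^ι]→L[ℝ] ℝ) {e : ι → E} (he : ∀ i, ‖e i‖ ≤ 1)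
    (A : E →L[ℝ] F) (i : ι) (w : F) :
    ‖ω (Function.update (fun k => A (e k)) i w)‖ ≤
      ‖ω‖ * (‖w‖ * ‖A‖ ^ (Fintype.card ι - 1)) := by
  refine (ω.le_opNorm _).trans ?_
  gcongr
  rw [← Finset.mul_prod_erase _ _ (Finset.mem_univ i), Function.update_self]
  gcongr
  calc ∏ k ∈ Finset.univ.erase i, ‖Function.update (fun k => A (e k)) i w k‖
      ≤ ∏ k ∈ Finset.univ.erase i, ‖A‖ := by
        refine Finset.prod_le_prod (fun _ _ => norm_nonneg _) fun k hk => ?_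
        rw [Function.update_of_ne (Finset.ne_of_mem_erase hk)]
        exact A.unit_le_opNorm _ (he k)
    _ = _ := by simp [Finset.card_erase_of_mem]

variable [FiniteDimensional ℝ E] [MeasurableSpace E] [BorelSpace E]

theorem card_mul_integral_mul_alternating (μ : Measure E) [μ.IsAddHaarMeasure]
    (ω : F [⋀^ι]→L[ℝ] ℝ) (e : ι → E) {u : E → F} (hu : ContDiff ℝ 2 u) {φ : E → ℝ}
    (hφ : ContDiff ℝ 1 φ) (hc : HasCompactSupport φ) :
    Fintype.card ι * ∫ x, φ x * ω (fun k => fderiv ℝ u x (e k)) ∂μ =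
      -∑ i, ∫ x, fderiv ℝ φ x (e i) *
        ω (Function.update (fun k => fderiv ℝ u x (e k)) i (u x)) ∂μ := by
  have hDu : ContDiff ℝ 1 (fderiv ℝ u) := hu.fderiv_right (by norm_num)
  have hg : ∀ i, ContDiff ℝ 1 (fun x =>
      ω (Function.update (fun k => fderiv ℝ u x (e k)) i (u x))) := by
    intro i
    refine ω.contDiff.comp (contDiff_pi.2 fun k => ?_)
    rcases eq_or_ne k i with rfl | hki
    · simpa using hu.of_le (by norm_num)
    · simpa only [Function.update_of_ne hki] using hDu.clm_apply contDiff_const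
  have hibp : ∀ i, ∫ x, φ x * fderiv ℝ (fun x =>
      ω (Function.update (fun k => fderiv ℝ u x (e k)) i (u x))) x (e i) ∂μ =
      -∫ x, fderiv ℝ φ x (e i) *
        ω (Function.update (fun k => fderiv ℝ u x (e k)) i (u x)) ∂μ := by
    intro i
    have hd := (hg i).continuous_fderiv one_ne_zero
    have hdφ := hφ.continuous_fderiv one_ne_zero
    apply integral_mul_fderiv_eq_neg_fderiv_mul_of_integrable
    · refine Continuous.integrable_of_hasCompactSupport
        ((hdφ.clm_apply continuous_const).mul (hg i).continuous) ?_
      exact ((hc.fderiv ℝ).comp_left (g := fun L : E →L[ℝ] ℝ => L (e i)) rfl).mul_right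
    · exact Continuous.integrable_of_hasCompactSupport
        (hφ.continuous.mul (hd.clm_apply continuous_const)) hc.mul_right
    · exact Continuous.integrable_of_hasCompactSupport
        (hφ.continuous.mul (hg i).continuous) hc.mul_right
    · exact fun x _ => hφ.differentiable one_ne_zero x
    · exact fun x _ => (hg i).differentiable one_ne_zero x
  rw [← Finset.sum_neg_distrib, ← Finset.sum_congr rfl fun i _ => hibp i, ← integral_finsetSum,
    ← integral_const_mul]
  · refine integral_congr_ae (Eventually.of_forall fun x => ?_)
    simp only
    rw [← Finset.mul_sum, sum_fderiv_alternating_update ω e hu x]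
    ring
  · intro i _
    have hd := (hg i).continuous_fderiv one_ne_zero
    exact Continuous.integrable_of_hasCompactSupport
      (hφ.continuous.mul (hd.clm_apply continuous_const)) hc.mul_right

/-- The divergence identity is applied to `u - c`, which has the same derivative as `u`; integration
by parts then places one derivative on the cutoff and leaves one undifferentiated factor `u - c`.
The number of summands cancels the factor `Fintype.card ι`. -/
theorem enorm_integral_mul_alternating_le [Nonempty ι] (μ : Measure E) [μ.IsAddHaarMeasure]
    (ω : F [⋀^ι]→L[ℝ] ℝ) {e : ι → E} (he : ∀ i, ‖e i‖ ≤ 1) {u : E → F} (hu : ContDiff ℝ 2 u)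
    {φ : E → ℝ} (hφ : ContDiff ℝ 1 φ) {B : Set E} (hc : HasCompactSupport φ)
    (hφB : tsupport φ ⊆ B) {M : ℝ} (hM : ∀ x, ‖fderiv ℝ φ x‖ ≤ M) (c : F) :
    ‖∫ x, φ x * ω (fun k => fderiv ℝ u x (e k)) ∂μ‖ₑ ≤
      ENNReal.ofReal (M * ‖ω‖) *
        ∫⁻ x in B, ‖u x - c‖ₑ * ‖fderiv ℝ u x‖ₑ ^ (Fintype.card ι - 1) ∂μ := by
  have hM0 : 0 ≤ M := (norm_nonneg _).trans (hM 0)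
  have hv : ContDiff ℝ 2 (fun x => u x - c) := hu.sub contDiff_const
  have h1 := card_mul_integral_mul_alternating μ ω e hv hφ hc
  have hfd : ∀ x, fderiv ℝ (fun x => u x - c) x = fderiv ℝ u x := fun x => by
    rw [fderiv_sub_const]
  simp only [hfd] at h1
  have hcard : (Fintype.card ι : ℝ) ≠ 0 := by simp
  set R := ENNReal.ofReal (M * ‖ω‖) *
        ∫⁻ x in B, ‖u x - c‖ₑ * ‖fderiv ℝ u x‖ₑ ^ (Fintype.card ι - 1) ∂μ with hR
  have hterm : ∀ i, ‖∫ x, fderiv ℝ φ x (e i) *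
      ω (Function.update (fun k => fderiv ℝ u x (e k)) i (u x - c)) ∂μ‖ₑ ≤ R := by
    intro i
    refine (enorm_integral_le_lintegral_enorm _).trans ?_
    have hzero : ∀ x, x ∉ B → ‖fderiv ℝ φ x (e i) *
        ω (Function.update (fun k => fderiv ℝ u x (e k)) i (u x - c))‖ₑ = 0 := by
      intro x hx
      have : fderiv ℝ φ x = 0 := by
        by_contra h
        exact hx (hφB (support_fderiv_subset ℝ h))
      simp [this]
    rw [← setLIntegral_eq_of_support_subset (s := B) (by
      intro x hx; by_contra h; exact hx (hzero x h)), hR,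
      ← lintegral_const_mul' _ _ ENNReal.ofReal_ne_top]
    refine lintegral_mono fun x => ?_
    rw [enorm_mul, ← ofReal_norm, ← ofReal_norm, ← ofReal_norm, ← ofReal_norm,
      ← ENNReal.ofReal_mul (by positivity), ← ENNReal.ofReal_pow (by positivity),
      ← ENNReal.ofReal_mul (by positivity), ← ENNReal.ofReal_mul (by positivity)]
    apply ENNReal.ofReal_le_ofReal
    rw [mul_assoc]
    gcongr
    · exact ((fderiv ℝ φ x).unit_le_opNorm _ (he i)).trans (hM x)
    · exact norm_alternating_update_le ω he _ i _
  have h2 : (Fintype.card ι : ℝ≥0∞) * ‖∫ x, φ x * ω (fun k => fderiv ℝ u x (e k)) ∂μ‖ₑ ≤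
      Fintype.card ι * R := by
    calc (Fintype.card ι : ℝ≥0∞) * ‖∫ x, φ x * ω (fun k => fderiv ℝ u x (e k)) ∂μ‖ₑ
        = ‖(Fintype.card ι : ℝ) * ∫ x, φ x * ω (fun k => fderiv ℝ u x (e k)) ∂μ‖ₑ := by
          rw [enorm_mul]; simp
      _ = ‖∑ i, ∫ x, fderiv ℝ φ x (e i) *
        ω (Function.update (fun k => fderiv ℝ u x (e k)) i (u x - c)) ∂μ‖ₑ := by
          rw [h1, enorm_neg]
      _ ≤ ∑ i : ι, R := (enorm_sum_le _ _).trans (Finset.sum_le_sum fun i _ => hterm i)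
      _ = _ := by simp
  exact (ENNReal.mul_le_mul_iff_right (by simp) (by simp)).1 h2

end Caccioppoli

/-! ### The reverse Hölder estimate for smooth maps. -/

section SmoothReverseHolder

open Metric Set Filter Topology Module

variable {E : Type*} [NormedAddCommGroup E] [NormedSpace ℝ E] [FiniteDimensional ℝ E]

variable (E) in
-- Translates and dilates of one fixed bump, so that `M` is the same for all balls.
theorem exists_cutoff : ∃ M : ℝ, 0 ≤ M ∧ ∀ (x₀ : E) (r : ℝ), 0 < r → ∃ φ : E → ℝ,
    ContDiff ℝ 1 φ ∧ HasCompactSupport φ ∧ tsupport φ ⊆ ball x₀ (2 * r) ∧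
    (∀ x, 0 ≤ φ x) ∧ (∀ x, φ x ≤ 1) ∧ (∀ x ∈ closedBall x₀ r, φ x = 1) ∧
    ∀ x, ‖fderiv ℝ φ x‖ ≤ M / r := by
  let η : ContDiffBump (0 : E) := ⟨1, 3 / 2, by norm_num, by norm_num⟩
  have hη : ContDiff ℝ 1 η := η.contDiff
  obtain ⟨M, hM⟩ := (hη.continuous_fderiv one_ne_zero).bounded_above_of_compact_support
    (η.hasCompactSupport.fderiv ℝ)
  refine ⟨M, (norm_nonneg _).trans (hM 0), fun x₀ r hr => ?_⟩
  have hsupp : ∀ x, (η (r⁻¹ • (x - x₀)) : ℝ) ≠ 0 → x ∈ closedBall x₀ (3 / 2 * r) := by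
    intro x hx
    have h1 : r⁻¹ • (x - x₀) ∈ ball (0 : E) (3 / 2) := by
      rw [← η.support_eq]; exact hx
    rw [mem_ball_zero_iff, norm_smul, norm_inv, Real.norm_of_nonneg hr.le, inv_mul_lt_iff₀ hr] at h1
    rw [mem_closedBall, dist_eq_norm]
    linarith
  have hts : tsupport (fun x => η (r⁻¹ • (x - x₀))) ⊆ closedBall x₀ (3 / 2 * r) :=
    closure_minimal hsupp isClosed_closedBall
  refine ⟨fun x => η (r⁻¹ • (x - x₀)), hη.comp (by fun_prop), ?_, ?_, fun x => η.nonneg,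
    fun x => η.le_one, fun x hx => ?_, fun x => ?_⟩
  · exact (isCompact_closedBall _ _).of_isClosed_subset (isClosed_tsupport _) hts
  · exact hts.trans (closedBall_subset_ball (by linarith))
  · apply η.one_of_mem_closedBall
    rw [mem_closedBall, dist_eq_norm] at hx
    rw [mem_closedBall_zero_iff, norm_smul, norm_inv, Real.norm_of_nonneg hr.le,
      inv_mul_le_iff₀ hr]
    change ‖x - x₀‖ ≤ r * 1
    linarith
  · have h1 : HasFDerivAt (fun x => r⁻¹ • (x - x₀)) (r⁻¹ • ContinuousLinearMap.id ℝ E) x :=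
      ((hasFDerivAt_id x).sub_const x₀).const_smul r⁻¹
    have h2 := (hη.differentiable one_ne_zero (r⁻¹ • (x - x₀))).hasFDerivAt.comp x h1
    have h3 : fderiv ℝ (fun x => η (r⁻¹ • (x - x₀))) x =
        r⁻¹ • fderiv ℝ η (r⁻¹ • (x - x₀)) := by
      refine h2.fderiv.trans ?_
      ext v
      simp
    rw [h3, norm_smul, norm_inv, Real.norm_of_nonneg hr.le, inv_mul_eq_div]
    gcongr
    exact hM _

variable [MeasurableSpace E] [BorelSpace E] {ι : Type*} [Fintype ι]
  {F : Type*} [NormedAddCommGroup F] [NormedSpace ℝ F]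

/-- Hölder with the conjugate exponents `p` and `q / N`, followed by the Sobolev-Poincaré inequality
for the first factor; the second factor is already an integral of `|Du|^q`. -/
theorem lintegral_enorm_sub_mul_pow_le [CompleteSpace F] (μ : Measure E) [μ.IsAddHaarMeasure]
    {u : E → F} (hu : ContDiff ℝ 1 u) {x₀ : E} {r : ℝ} (hr : 0 < r) {N : ℕ} (hN : 0 < N)
    {p q : ℝ} (hq : 1 ≤ q)
    (hqp : q < p) (hpq : finrank ℝ E * (p / q - 1) = 1 / 2) (hconj : p⁻¹ + N / q = 1) :
    ∃ c : F, ∫⁻ x in ball x₀ r, ‖u x - c‖ₑ * ‖fderiv ℝ u x‖ₑ ^ N ∂μ ≤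
      ENNReal.ofReal (2 * r) * (2 ^ (finrank ℝ E + 1)) ^ p⁻¹ *
        μ (ball x₀ r) ^ (p⁻¹ - q⁻¹) *
        (∫⁻ x in ball x₀ r, ‖fderiv ℝ u x‖ₑ ^ q ∂μ) ^ ((N + 1) / q) := by
  obtain ⟨c, hc⟩ := exists_lintegral_sub_const_rpow_le μ hu x₀ hr hq hqp.le hpq
  refine ⟨c, ?_⟩
  have hq0 : 0 < q := by linarith
  have hp0 : 0 < p := by linarith
  have hN0 : (0 : ℝ) < N := by exact_mod_cast hN
  have hholder : p.HolderConjugate (q / N) := by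
    rw [Real.holderConjugate_iff]
    exact ⟨by linarith, by rw [inv_div]; exact hconj⟩
  have hgm : Measurable fun x => ‖fderiv ℝ u x‖ₑ :=
    (hu.continuous_fderiv one_ne_zero).enorm.measurable
  have hum : Measurable fun x => ‖u x - c‖ₑ :=
    (hu.continuous.sub continuous_const).enorm.measurable
  set I := ∫⁻ x in ball x₀ r, ‖fderiv ℝ u x‖ₑ ^ q ∂μ with hI
  have h1 := ENNReal.lintegral_mul_le_Lp_mul_Lq (μ.restrict (ball x₀ r)) hholder
    hum.aemeasurable (hgm.pow_const N).aemeasurable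
  have h2 : ∀ x, (‖fderiv ℝ u x‖ₑ ^ N) ^ (q / N) = ‖fderiv ℝ u x‖ₑ ^ q := by
    intro x
    rw [← ENNReal.rpow_natCast, ← ENNReal.rpow_mul, mul_div_cancel₀ _ hN0.ne']
  simp only [Pi.mul_apply, h2, ← hI] at h1
  refine h1.trans ?_
  calc (∫⁻ x in ball x₀ r, ‖u x - c‖ₑ ^ p ∂μ) ^ (1 / p) * I ^ (1 / (q / N))
      ≤ (ENNReal.ofReal (2 * r) ^ p * 2 ^ (finrank ℝ E + 1) * μ (ball x₀ r) ^ (1 - p / q) *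
        I ^ (p / q)) ^ (1 / p) * I ^ (1 / (q / N)) := by gcongr
    _ = ENNReal.ofReal (2 * r) * (2 ^ (finrank ℝ E + 1)) ^ p⁻¹ *
        μ (ball x₀ r) ^ (p⁻¹ - q⁻¹) * (I ^ q⁻¹ * I ^ (N / q)) := by
        have hp' : (0 : ℝ) ≤ 1 / p := by positivity
        rw [ENNReal.mul_rpow_of_nonneg _ _ hp', ENNReal.mul_rpow_of_nonneg _ _ hp',
          ENNReal.mul_rpow_of_nonneg _ _ hp', ← ENNReal.rpow_mul, ← ENNReal.rpow_mul,
          ← ENNReal.rpow_mul, mul_one_div_cancel hp0.ne', ENNReal.rpow_one,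
          show (1 - p / q) * (1 / p) = p⁻¹ - q⁻¹ by field_simp,
          show p / q * (1 / p) = q⁻¹ by field_simp, one_div_div, one_div]
        ring
    _ = _ := by
        rw [← ENNReal.rpow_add_of_nonneg _ _ (by positivity) (by positivity)]
        congr 2
        field_simp
        ring

theorem enorm_integral_mul_alternating_le_rpow [CompleteSpace F] [DecidableEq ι]
    (μ : Measure E) [μ.IsAddHaarMeasure]
    (ω : F [⋀^ι]→L[ℝ] ℝ) {e : ι → E} (he : ∀ i, ‖e i‖ ≤ 1) {u : E → F} (hu : ContDiff ℝ 2 u)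
    {x₀ : E} {r M : ℝ} (hr : 0 < r) (hM0 : 0 ≤ M) {φ : E → ℝ}
    (hφ : ContDiff ℝ 1 φ) (hc : HasCompactSupport φ) (hφB : tsupport φ ⊆ ball x₀ (2 * r))
    (hM : ∀ x, ‖fderiv ℝ φ x‖ ≤ M / r) {N : ℕ} (hN : 0 < N) (hcard : Fintype.card ι = N + 1)
    {p q : ℝ} (hq : 1 ≤ q)
    (hqp : q < p) (hpq : finrank ℝ E * (p / q - 1) = 1 / 2) (hconj : p⁻¹ + N / q = 1) :
    ‖∫ x, φ x * ω (fun k => fderiv ℝ u x (e k)) ∂μ‖ₑ ≤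
      ENNReal.ofReal (4 * M * ‖ω‖) * (2 ^ (finrank ℝ E + 1)) ^ p⁻¹ *
        μ (ball x₀ (2 * r)) ^ (p⁻¹ - q⁻¹) *
        (∫⁻ x in ball x₀ (2 * r), ‖fderiv ℝ u x‖ₑ ^ q ∂μ) ^ ((N + 1) / q) := by
  have hne : Nonempty ι := Fintype.card_pos_iff.1 (by omega)
  obtain ⟨c, hc'⟩ := lintegral_enorm_sub_mul_pow_le μ (hu.of_le (by norm_num)) (x₀ := x₀)
    (show 0 < 2 * r by linarith) hN hq hqp hpq hconj
  refine (enorm_integral_mul_alternating_le μ ω he hu hφ hc hφB hM c).trans ?_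
  rw [hcard, Nat.add_sub_cancel]
  refine (mul_le_mul_right hc' _).trans (le_of_eq ?_)
  -- Scale invariance: the `1 / r` of the cutoff gradient cancels the radius produced by the
  -- Poincaré inequality on the ball of radius `2 * r`.
  rw [show 4 * M * ‖ω‖ = (M / r * ‖ω‖) * (2 * (2 * r)) by field_simp; ring,
    ENNReal.ofReal_mul (p := M / r * ‖ω‖) (by positivity)]
  ring

end SmoothReverseHolder

/-! ### Mollifiers in `L^p`. -/

section Mollification

open Metric Set Filter Topology Module ContinuousLinearMap
open scoped Convolution

variable {E : Type*} [NormedAddCommGroup E] [NormedSpace ℝ E] [FiniteDimensional ℝ E]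
  [MeasurableSpace E] [BorelSpace E] {μ : Measure E} [μ.IsAddHaarMeasure]
  {X : Type*} [NormedAddCommGroup X] [NormedSpace ℝ X]

/-- Jensen for the probability measure whose density is the mollifier, then Tonelli and translation
invariance. -/
theorem lintegral_enorm_normed_convolution_rpow_le (φ : ContDiffBump (0 : E)) {g : E → X}
    (hg : AEStronglyMeasurable g μ) {p : ℝ} (hp : 1 ≤ p) :
    ∫⁻ x, ‖(φ.normed μ ⋆[lsmul ℝ ℝ, μ] g) x‖ₑ ^ p ∂μ ≤ ∫⁻ x, ‖g x‖ₑ ^ p ∂μ := by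
  wlog hgs : StronglyMeasurable g generalizing g
  · have h1 : ∫⁻ x, ‖g x‖ₑ ^ p ∂μ = ∫⁻ x, ‖hg.mk g x‖ₑ ^ p ∂μ :=
      lintegral_congr_ae (hg.ae_eq_mk.mono fun x hx => congrArg (fun y => ‖y‖ₑ ^ p) hx)
    rw [convolution_congr (lsmul ℝ ℝ) EventuallyEq.rfl hg.ae_eq_mk, h1]
    exact this hg.stronglyMeasurable_mk.aestronglyMeasurable hg.stronglyMeasurable_mk
  have hρm : Measurable fun t => ‖φ.normed μ t‖ₑ := φ.continuous_normed.enorm.measurable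
  set P : Measure E := μ.withDensity fun t => ‖φ.normed μ t‖ₑ with hP
  have hprob : IsProbabilityMeasure P := ⟨by
    rw [hP, withDensity_apply _ MeasurableSet.univ, setLIntegral_univ,
      ← ofReal_integral_norm_eq_lintegral_enorm φ.integrable_normed]
    simp_rw [Real.norm_of_nonneg (φ.nonneg_normed _)]
    rw [φ.integral_normed, ENNReal.ofReal_one]⟩
  have hgm : Measurable fun x => ‖g x‖ₑ := hgs.enorm
  have hgx : ∀ x, Measurable fun t => ‖g (x - t)‖ₑ := fun x => hgm.comp (by fun_prop)
  calc ∫⁻ x, ‖(φ.normed μ ⋆[lsmul ℝ ℝ, μ] g) x‖ₑ ^ p ∂μ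
      ≤ ∫⁻ x, (∫⁻ t, ‖g (x - t)‖ₑ ^ p ∂P) ∂μ := by
        refine lintegral_mono fun x => ?_
        refine le_trans ?_ (rpow_lintegral_le_lintegral_rpow P hp (hgx x).aemeasurable)
        gcongr
        rw [hP, lintegral_withDensity_eq_lintegral_mul _ hρm (hgx x)]
        refine (enorm_integral_le_lintegral_enorm _).trans (lintegral_mono fun t => ?_)
        simp [enorm_smul]
    _ = ∫⁻ t, (∫⁻ x, ‖g (x - t)‖ₑ ^ p ∂μ) ∂P := by
        rw [lintegral_lintegral_swap]
        exact ((hgm.comp (measurable_fst.sub measurable_snd)).pow_const p).aemeasurable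
    _ = _ := by
        simp_rw [lintegral_sub_right_eq_self (fun x => ‖g x‖ₑ ^ p)]
        simp

theorem eLpNorm_normed_convolution_le (φ : ContDiffBump (0 : E)) {g : E → X}
    (hg : AEStronglyMeasurable g μ) {p : ℝ≥0∞} (hp : 1 ≤ p) (hptop : p ≠ ∞) :
    eLpNorm (φ.normed μ ⋆[lsmul ℝ ℝ, μ] g) p μ ≤ eLpNorm g p μ := by
  have hp0 : p ≠ 0 := (zero_lt_one.trans_le hp).ne'
  have hp1 : 1 ≤ p.toReal := by
    rw [← ENNReal.toReal_one]; exact ENNReal.toReal_mono hptop hp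
  rw [eLpNorm_eq_lintegral_rpow_enorm_toReal hp0 hptop,
    eLpNorm_eq_lintegral_rpow_enorm_toReal hp0 hptop]
  exact ENNReal.rpow_le_rpow (lintegral_enorm_normed_convolution_rpow_le φ hg hp1) (by positivity)

variable [CompleteSpace X]

theorem tendsto_eLpNorm_normed_convolution_sub_of_continuous {κ : Type*} {l : Filter κ}
    {φ : κ → ContDiffBump (0 : E)} (hφ : Tendsto (fun k => (φ k).rOut) l (𝓝 0)) {g : E → X}
    (hg : Continuous g) (hc : HasCompactSupport g) {p : ℝ≥0∞} :
    Tendsto (fun k => eLpNorm ((φ k).normed μ ⋆[lsmul ℝ ℝ, μ] g - g) p μ) l (𝓝 0) := by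
  set S : Set E := cthickening 1 (tsupport g) with hS
  have hScomp : IsCompact S := hc.isCompact.cthickening
  have : IsFiniteMeasure (μ.restrict S) := ⟨by simpa using hScomp.measure_lt_top⟩
  set m := (μ.restrict S) univ ^ p.toReal⁻¹ with hm
  have hmtop : m ≠ ∞ := ENNReal.rpow_ne_top_of_nonneg (by positivity) (measure_ne_top _ _)
  rw [ENNReal.tendsto_nhds_zero]
  intro ε hε
  obtain ⟨δ, hδ0, hδ⟩ : ∃ δ : ℝ, 0 < δ ∧ m * ENNReal.ofReal δ ≤ ε := by
    have h1 : Tendsto (fun δ : ℝ => m * ENNReal.ofReal δ) (𝓝[>] 0) (𝓝 0) := by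
      have h2 : Tendsto (fun δ : ℝ => ENNReal.ofReal δ) (𝓝[>] 0) (𝓝 0) := by
        have := (ENNReal.continuous_ofReal.tendsto 0).mono_left
          (nhdsWithin_le_nhds (s := Ioi (0:ℝ)))
        simpa using this
      simpa using ENNReal.Tendsto.const_mul h2 (Or.inr hmtop)
    have h3 := ((ENNReal.tendsto_nhds_zero.1 h1) ε hε).and self_mem_nhdsWithin
    obtain ⟨δ, hδ, hδ0⟩ := h3.exists
    exact ⟨δ, hδ0, hδ⟩
  obtain ⟨η, hη0, hη⟩ := Metric.uniformContinuous_iff.1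
    (hc.uniformContinuous_of_continuous hg) δ hδ0
  filter_upwards [hφ.eventually (gt_mem_nhds (show (0:ℝ) < min η 1 from lt_min hη0 one_pos))]
    with k hk
  have hk1 : (φ k).rOut < η := hk.trans_le (min_le_left _ _)
  have hk2 : (φ k).rOut < 1 := hk.trans_le (min_le_right _ _)
  have hbound : ∀ x, ‖((φ k).normed μ ⋆[lsmul ℝ ℝ, μ] g - g) x‖ ≤ δ := by
    intro x
    rw [Pi.sub_apply, ← dist_eq_norm]
    exact ContDiffBump.dist_normed_convolution_le hg.aestronglyMeasurable fun y hy =>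
      (hη ((mem_ball.1 hy).trans hk1)).le
  have hsupp : Function.support ((φ k).normed μ ⋆[lsmul ℝ ℝ, μ] g - g) ⊆ S := by
    intro x hx
    by_contra hxS
    apply hx
    have hzero : ∀ y ∈ ball x (φ k).rOut, g y = 0 := by
      intro y hy
      by_contra hgy
      apply hxS
      refine mem_cthickening_of_dist_le x y 1 _ (subset_tsupport g hgy) ?_
      rw [dist_comm]
      exact ((mem_ball.1 hy).trans hk2).le
    have hx0 := hzero x (mem_ball_self (φ k).rOut_pos)
    rw [Pi.sub_apply, ContDiffBump.normed_convolution_eq_right (fun y hy => by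
      rw [hzero y hy, hx0]), sub_self]
  rw [← eLpNorm_restrict_eq_of_support_subset hsupp]
  exact (eLpNorm_le_of_ae_bound (Eventually.of_forall hbound)).trans hδ

/-- Density of continuous compactly supported functions, for which uniform continuity gives
convergence; the contraction property of mollification transfers it to `g`. -/
theorem tendsto_eLpNorm_normed_convolution_sub {κ : Type*} {l : Filter κ}
    {φ : κ → ContDiffBump (0 : E)} (hφ : Tendsto (fun k => (φ k).rOut) l (𝓝 0)) {g : E → X}
    {p : ℝ≥0∞} (hp : 1 ≤ p) (hptop : p ≠ ∞) (hg : MemLp g p μ) :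
    Tendsto (fun k => eLpNorm ((φ k).normed μ ⋆[lsmul ℝ ℝ, μ] g - g) p μ) l (𝓝 0) := by
  rw [ENNReal.tendsto_nhds_zero]
  intro ε hε
  have hε3 : ε / 3 ≠ 0 := (ENNReal.div_pos hε.ne' (by simp)).ne'
  obtain ⟨h, hc, hgh, hcont, hmem⟩ := hg.exists_hasCompactSupport_eLpNorm_sub_le hptop hε3
  have hlim := tendsto_eLpNorm_normed_convolution_sub_of_continuous (μ := μ) hφ hcont hc (p := p)
  filter_upwards [(ENNReal.tendsto_nhds_zero.1 hlim) (ε / 3) (pos_iff_ne_zero.2 hε3)] with k hk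
  set ρ := (φ k).normed μ with hρ
  have hρc : Continuous ρ := (φ k).continuous_normed
  have hρs : HasCompactSupport ρ := (φ k).hasCompactSupport_normed
  have hgl : LocallyIntegrable g μ := hg.locallyIntegrable hp
  have hhl : LocallyIntegrable h μ := hmem.locallyIntegrable hp
  have hex : ∀ w : E → X, LocallyIntegrable w μ → ConvolutionExists ρ w (lsmul ℝ ℝ) μ :=
    fun w hw => hρs.convolutionExists_left _ hρc hw
  have hdecomp : ρ ⋆[lsmul ℝ ℝ, μ] g - g =
      ρ ⋆[lsmul ℝ ℝ, μ] (g - h) + (ρ ⋆[lsmul ℝ ℝ, μ] h - h) - (g - h) := by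
    have h1 := (hex (g - h) (hgl.sub hhl)).distrib_add (hex h hhl)
    rw [sub_add_cancel] at h1
    rw [h1]
    abel
  have hm1 : AEStronglyMeasurable (ρ ⋆[lsmul ℝ ℝ, μ] (g - h)) μ :=
    (hρs.continuous_convolution_left _ hρc (hgl.sub hhl)).aestronglyMeasurable
  have hm2 : AEStronglyMeasurable (ρ ⋆[lsmul ℝ ℝ, μ] h - h) μ :=
    ((hρs.continuous_convolution_left _ hρc hhl).sub hcont).aestronglyMeasurable
  have hm3 : AEStronglyMeasurable (g - h) μ := hg.1.sub hmem.1
  calc eLpNorm (ρ ⋆[lsmul ℝ ℝ, μ] g - g) p μ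
      ≤ eLpNorm (ρ ⋆[lsmul ℝ ℝ, μ] (g - h)) p μ + eLpNorm (ρ ⋆[lsmul ℝ ℝ, μ] h - h) p μ +
        eLpNorm (g - h) p μ := by
        rw [hdecomp]
        refine (eLpNorm_sub_le (hm1.add hm2) hm3 hp).trans ?_
        gcongr
        exact eLpNorm_add_le hm1 hm2 hp
    _ ≤ ε / 3 + ε / 3 + ε / 3 := by
        gcongr
        exact (eLpNorm_normed_convolution_le (φ k) hm3 hp hptop).trans hgh
    _ = ε := ENNReal.add_thirds ε

theorem tendsto_eLpNorm_restrict_sub_of_eq_normed_convolution {κ : Type*} {l : Filter κ}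
    {φ : κ → ContDiffBump (0 : E)} (hφ : Tendsto (fun k => (φ k).rOut) l (𝓝 0)) {g : E → X}
    {p : ℝ≥0∞} (hp : 1 ≤ p) (hptop : p ≠ ∞) {S B : Set E} (hS : MeasurableSet S)
    (hB : MeasurableSet B) (hBS : B ⊆ S) (hg : MemLp g p (μ.restrict S)) {w : κ → E → X}
    (hw : ∀ k, ∀ x ∈ B, w k x = ((φ k).normed μ ⋆[lsmul ℝ ℝ, μ] S.indicator g) x) :
    Tendsto (fun k => eLpNorm (w k - g) p (μ.restrict B)) l (𝓝 0) := by
  have hg' : MemLp (S.indicator g) p μ := by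
    rw [memLp_indicator_iff_restrict hS]
    exact hg
  have hlim := tendsto_eLpNorm_normed_convolution_sub (μ := μ) hφ hp hptop hg'
  refine tendsto_of_tendsto_of_tendsto_of_le_of_le tendsto_const_nhds hlim (fun _ => zero_le)
    fun k => ?_
  refine le_trans (le_of_eq (eLpNorm_congr_ae ?_)) (eLpNorm_restrict_le _ _ _ B)
  filter_upwards [ae_restrict_mem hB] with x hx
  rw [Pi.sub_apply, Pi.sub_apply, hw k x hx, indicator_of_mem (hBS hx)]

theorem eLpNorm_le_eLpNorm_sub_add {α Y : Type*} [MeasurableSpace α] {ν : Measure α}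
    [NormedAddCommGroup Y] {a b : α → Y} (ha : AEStronglyMeasurable a ν)
    (hb : AEStronglyMeasurable b ν) {p : ℝ≥0∞} (hp : 1 ≤ p) :
    eLpNorm a p ν ≤ eLpNorm (a - b) p ν + eLpNorm b p ν := by
  calc eLpNorm a p ν = eLpNorm ((a - b) + b) p ν := by rw [sub_add_cancel]
    _ ≤ _ := eLpNorm_add_le (ha.sub hb) hb hp

theorem tendsto_eLpNorm_sub_of_exponent_le {α Y κ : Type*} [MeasurableSpace α] {ν : Measure α}
    [IsFiniteMeasure ν] [NormedAddCommGroup Y] {l : Filter κ} {a : κ → α → Y} {b : α → Y}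
    (ha : ∀ k, AEStronglyMeasurable (a k) ν) (hb : AEStronglyMeasurable b ν) {p q : ℝ≥0∞}
    (hq : q ≠ 0) (hp : p ≠ ∞) (hpq : q ≤ p)
    (hlim : Tendsto (fun k => eLpNorm (a k - b) p ν) l (𝓝 0)) :
    Tendsto (fun k => eLpNorm (a k - b) q ν) l (𝓝 0) := by
  have hctop : ν univ ^ (1 / q.toReal - 1 / p.toReal) ≠ ∞ := by
    refine ENNReal.rpow_ne_top_of_nonneg ?_ (measure_ne_top _ _)
    have h1 := ENNReal.toReal_mono hp hpq
    have h2 : 0 < q.toReal := ENNReal.toReal_pos hq (ne_top_of_le_ne_top hp hpq)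
    rw [sub_nonneg]
    gcongr
  have h1 := ENNReal.Tendsto.mul_const hlim (Or.inr hctop)
  rw [zero_mul] at h1
  exact tendsto_of_tendsto_of_tendsto_of_le_of_le tendsto_const_nhds h1 (fun _ => zero_le)
    fun k => eLpNorm_le_eLpNorm_mul_rpow_measure_univ hpq ((ha k).sub hb)

end Mollification

/-! ### Mollification of weak derivatives and continuity of the pullback. -/

section WeakDerivativeMollification

open Metric Set Filter Topology Module ContinuousLinearMap
open scoped Convolution

theorem locallyIntegrable_indicator_of_isCompact {E X : Type*} [NormedAddCommGroup E]
    [MeasurableSpace E] [BorelSpace E] {μ : Measure E} [NormedAddCommGroup X] {Ω S : Set E}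
    {g : E → X} (hg : LocallyIntegrableOn g Ω μ) (hS : IsCompact S) (hSΩ : S ⊆ Ω) :
    LocallyIntegrable (S.indicator g) μ :=
  ((integrable_indicator_iff hS.measurableSet).2
    (hg.integrableOn_compact_subset hSΩ hS)).locallyIntegrable

section ConvolutionApply

variable {E X : Type*} [NormedAddCommGroup E] [NormedSpace ℝ E] [FiniteDimensional ℝ E]
  [MeasurableSpace E] [BorelSpace E] {μ : Measure E} [μ.IsAddHaarMeasure]
  [NormedAddCommGroup X] [NormedSpace ℝ X]

theorem fderiv_convolution_lsmul_apply {ρ : E → ℝ} (hρ : ContDiff ℝ 1 ρ) (hρs : HasCompactSupport ρ)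
    {g : E → X} (hg : LocallyIntegrable g μ) (x v : E) :
    fderiv ℝ (ρ ⋆[lsmul ℝ ℝ, μ] g) x v = ∫ t, (fderiv ℝ ρ (x - t) v) • g t ∂μ := by
  have hex : ConvolutionExistsAt (fderiv ℝ ρ) g x ((lsmul ℝ ℝ : ℝ →L[ℝ] X →L[ℝ] X).precompL E) μ :=
    (hρs.fderiv ℝ).convolutionExists_left _ (hρ.continuous_fderiv one_ne_zero) hg x
  rw [(hρs.hasFDerivAt_convolution_left (lsmul ℝ ℝ) hρ hg x).fderiv, convolution_eq_swap,
    ContinuousLinearMap.integral_apply hex.integrable_swap]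
  rfl

theorem convolution_lsmul_clm_apply {ρ : E → ℝ} (hρ : Continuous ρ) (hρs : HasCompactSupport ρ)
    {G : E → E →L[ℝ] X} (hG : LocallyIntegrable G μ) (x v : E) :
    (ρ ⋆[lsmul ℝ ℝ, μ] G) x v = ∫ t, ρ (x - t) • G t v ∂μ := by
  have hex : ConvolutionExistsAt ρ G x (lsmul ℝ ℝ) μ := hρs.convolutionExists_left _ hρ hG x
  rw [convolution_eq_swap, ContinuousLinearMap.integral_apply hex.integrable_swap]
  rfl

/-- The weak identity is tested with `t ↦ ρ(x - t)`, whose support lies in `S` by `hx`; there the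
cut-off functions agree with `f` and `Df`. -/
theorem fderiv_normed_convolution_of_weak {Ω : Set E} {f : E → X} {Df : E → E →L[ℝ] X}
    (hf : LocallyIntegrableOn f Ω μ) (hDf : LocallyIntegrableOn Df Ω μ)
    (hweak : ∀ φ : E → ℝ, ContDiff ℝ ((⊤ : ℕ∞) : WithTop ℕ∞) φ → HasCompactSupport φ →
      tsupport φ ⊆ Ω → ∀ v : E,
      ∫ x in Ω, (fderiv ℝ φ x v) • f x ∂μ = - ∫ x in Ω, φ x • Df x v ∂μ)
    {S : Set E} (hS : IsCompact S) (hSΩ : S ⊆ Ω) (φ : ContDiffBump (0 : E))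
    {x : E} (hx : closedBall x φ.rOut ⊆ S) :
    fderiv ℝ (φ.normed μ ⋆[lsmul ℝ ℝ, μ] S.indicator f) x =
      (φ.normed μ ⋆[lsmul ℝ ℝ, μ] S.indicator Df) x := by
  set ρ := φ.normed μ with hρ
  have hρd : ContDiff ℝ 1 ρ := φ.contDiff_normed
  have hρs : HasCompactSupport ρ := φ.hasCompactSupport_normed
  have hfS := locallyIntegrable_indicator_of_isCompact hf hS hSΩ
  have hDfS := locallyIntegrable_indicator_of_isCompact hDf hS hSΩ
  have hout : ∀ t, t ∉ S → x - t ∉ tsupport ρ := by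
    intro t ht hmem
    rw [hρ, φ.tsupport_normed_eq, mem_closedBall_zero_iff] at hmem
    refine ht (hx ?_)
    rw [mem_closedBall, dist_comm, dist_eq_norm]
    exact hmem
  refine ContinuousLinearMap.ext fun v => ?_
  rw [fderiv_convolution_lsmul_apply hρd hρs hfS, convolution_lsmul_clm_apply hρd.continuous hρs hDfS]
  have hψd : ∀ t, fderiv ℝ (fun t => ρ (x - t)) t v = -(fderiv ℝ ρ (x - t) v) := by
    intro t
    have h1 : HasFDerivAt (fun t => x - t) (-ContinuousLinearMap.id ℝ _) t :=
      (hasFDerivAt_id t).const_sub x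
    have h2 := ((hρd.differentiable one_ne_zero) (x - t)).hasFDerivAt.comp t h1
    have h3 := congrArg (fun L => L v) h2.fderiv
    refine h3.trans ?_
    simp
  have hts : tsupport (fun t => ρ (x - t)) ⊆ S := by
    refine (closure_minimal (t := closedBall x φ.rOut) (fun t ht => ?_) isClosed_closedBall).trans hx
    have h1 : x - t ∈ tsupport ρ := subset_tsupport ρ ht
    rw [hρ, φ.tsupport_normed_eq, mem_closedBall_zero_iff] at h1
    rw [mem_closedBall, dist_comm, dist_eq_norm]
    exact h1
  have key := hweak (fun t => ρ (x - t))
    ((φ.contDiff_normed (n := ⊤)).comp (contDiff_const.sub contDiff_id))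
    (hS.of_isClosed_subset (isClosed_tsupport _) hts) (hts.trans hSΩ) v
  simp only [hψd, neg_smul, integral_neg, neg_inj] at key
  calc ∫ t, (fderiv ℝ ρ (x - t) v) • S.indicator f t ∂μ
      = ∫ t in Ω, (fderiv ℝ ρ (x - t) v) • f t ∂μ := by
        rw [← setIntegral_eq_integral_of_forall_compl_eq_zero (s := Ω) (fun t ht => by
          rw [indicator_of_notMem (fun h => ht (hSΩ h)), smul_zero])]
        refine integral_congr_ae (Eventually.of_forall fun t => ?_)
        by_cases ht : t ∈ S
        · simp [ht]
        · have : fderiv ℝ ρ (x - t) = 0 := by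
            by_contra h
            exact hout t ht (support_fderiv_subset ℝ h)
          simp [this]
    _ = ∫ t in Ω, ρ (x - t) • Df t v ∂μ := key
    _ = ∫ t, ρ (x - t) • (S.indicator Df t) v ∂μ := by
        rw [← setIntegral_eq_integral_of_forall_compl_eq_zero (s := Ω)
          (f := fun t => ρ (x - t) • (S.indicator Df t) v) (fun t ht => by
            rw [indicator_of_notMem (fun h => ht (hSΩ h))]; simp)]
        refine integral_congr_ae (Eventually.of_forall fun t => ?_)
        by_cases ht : t ∈ S
        · simp [ht]
        · have : ρ (x - t) = 0 := by
            by_contra h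
            exact hout t ht (subset_tsupport ρ h)
          simp [this]

end ConvolutionApply

variable {α : Type*} [MeasurableSpace α] {ι : Type*} [Fintype ι]
  {E F : Type*} [NormedAddCommGroup E] [NormedSpace ℝ E] [NormedAddCommGroup F] [NormedSpace ℝ F]

theorem enorm_alternating_sub_le (ω : F [⋀^ι]→L[ℝ] ℝ) {e : ι → E} (he : ∀ i, ‖e i‖ ≤ 1)
    (A A' : E →L[ℝ] F) :
    ‖ω (fun k => A' (e k)) - ω (fun k => A (e k))‖ₑ ≤
      ENNReal.ofReal (‖ω‖ * Fintype.card ι) *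
        (‖A' - A‖ₑ * (‖A' - A‖ₑ + ‖A‖ₑ) ^ (Fintype.card ι - 1)) := by
  have hb : ∀ L : E →L[ℝ] F, ‖fun k => L (e k)‖ ≤ ‖L‖ := fun L =>
    (pi_norm_le_iff_of_nonneg (norm_nonneg _)).2 fun k => L.unit_le_opNorm _ (he k)
  have h1 := ω.norm_image_sub_le (fun k => A' (e k)) (fun k => A (e k))
  have h2 : ‖(fun k => A' (e k)) - fun k => A (e k)‖ ≤ ‖A' - A‖ := hb (A' - A)
  have h3 : max ‖fun k => A' (e k)‖ ‖fun k => A (e k)‖ ≤ ‖A' - A‖ + ‖A‖ := by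
    refine max_le ((hb A').trans ?_) ((hb A).trans (le_add_of_nonneg_left (norm_nonneg _)))
    calc ‖A'‖ = ‖(A' - A) + A‖ := by rw [sub_add_cancel]
      _ ≤ _ := norm_add_le _ _
  have h0 : 0 ≤ max ‖fun k => A' (e k)‖ ‖fun k => A (e k)‖ := le_max_of_le_left (norm_nonneg _)
  rw [← ofReal_norm, ← ofReal_norm, ← ofReal_norm,
    ← ENNReal.ofReal_add (norm_nonneg _) (norm_nonneg _), ← ENNReal.ofReal_pow (by positivity),
    ← ENNReal.ofReal_mul (by positivity), ← ENNReal.ofReal_mul (by positivity)]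
  apply ENNReal.ofReal_le_ofReal
  refine h1.trans ?_
  calc ‖ω‖ * (Fintype.card ι) * max ‖fun k => A' (e k)‖ ‖fun k => A (e k)‖ ^ (Fintype.card ι - 1) *
        ‖(fun k => A' (e k)) - fun k => A (e k)‖
      ≤ ‖ω‖ * (Fintype.card ι) * (‖A' - A‖ + ‖A‖) ^ (Fintype.card ι - 1) * ‖A' - A‖ := by gcongr
    _ = _ := by ring

/-- A form homogeneous of degree `d` is continuous from `L^d` to `L^1`: the difference is linear in
`A' - A` and of degree `d - 1` in the rest, so Hölder with `d` and `d/(d-1)` applies. -/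
theorem tendsto_lintegral_alternating_sub {ν : Measure α} {κ : Type*} {l : Filter κ}
    (ω : F [⋀^ι]→L[ℝ] ℝ) {e : ι → E} (he : ∀ i, ‖e i‖ ≤ 1) (hcard : 2 ≤ Fintype.card ι)
    {A : α → E →L[ℝ] F} {A' : κ → α → E →L[ℝ] F} (hA : MemLp A (Fintype.card ι) ν)
    (hA' : ∀ k, AEStronglyMeasurable (A' k) ν)
    (hlim : Tendsto (fun k => eLpNorm (A' k - A) (Fintype.card ι) ν) l (𝓝 0)) :
    Tendsto (fun k => ∫⁻ x, ‖ω (fun i => A' k x (e i)) - ω (fun i => A x (e i))‖ₑ ∂ν) l (𝓝 0) := by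
  set d := Fintype.card ι with hd
  have hd1 : (1 : ℝ) < d := by exact_mod_cast hcard
  have hd0 : (0 : ℝ) < d := by linarith
  have hnorm : ∀ h : α → E →L[ℝ] F, eLpNorm h d ν = (∫⁻ x, ‖h x‖ₑ ^ (d : ℝ) ∂ν) ^ (1 / (d : ℝ)) := by
    intro h
    rw [eLpNorm_eq_lintegral_rpow_enorm_toReal (by simp; omega) (by simp)]
    simp
  have hholder := Real.HolderConjugate.conjExponent hd1
  have hexp : ((d - 1 : ℕ) : ℝ) * Real.conjExponent d = d := by
    rw [Real.conjExponent, Nat.cast_sub (by omega), Nat.cast_one]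
    have : (d : ℝ) - 1 ≠ 0 := by linarith
    field_simp
  have hbound : ∀ k, ∫⁻ x, ‖ω (fun i => A' k x (e i)) - ω (fun i => A x (e i))‖ₑ ∂ν ≤
      ENNReal.ofReal (‖ω‖ * d) * (eLpNorm (A' k - A) d ν *
        (eLpNorm (A' k - A) d ν + eLpNorm A d ν) ^ (d - 1)) := by
    intro k
    have hm1 : AEMeasurable (fun x => ‖A' k x - A x‖ₑ) ν := ((hA' k).sub hA.1).enorm
    have hm2 : AEMeasurable (fun x => ‖A x‖ₑ) ν := hA.1.enorm
    refine (lintegral_mono fun x => enorm_alternating_sub_le ω he (A x) (A' k x)).trans ?_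
    rw [lintegral_const_mul' _ _ ENNReal.ofReal_ne_top, ← hd]
    gcongr
    have h1 := ENNReal.lintegral_mul_le_Lp_mul_Lq ν hholder hm1 ((hm1.add hm2).pow_const (d - 1))
    simp only [Pi.mul_apply, Pi.add_apply] at h1
    refine h1.trans ?_
    have h2 : ∀ x, ((‖A' k x - A x‖ₑ + ‖A x‖ₑ) ^ (d - 1)) ^ (Real.conjExponent (d : ℝ)) =
        (‖A' k x - A x‖ₑ + ‖A x‖ₑ) ^ (d : ℝ) := by
      intro x
      rw [← ENNReal.rpow_natCast, ← ENNReal.rpow_mul, hexp]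
    simp only [h2]
    rw [hnorm (A' k - A)]
    simp only [Pi.sub_apply]
    refine mul_le_mul_right ?_ _
    have h3 := ENNReal.lintegral_Lp_add_le hm1 hm2 hd1.le
    simp only [Pi.add_apply] at h3
    rw [hnorm A]
    calc (∫⁻ x, (‖A' k x - A x‖ₑ + ‖A x‖ₑ) ^ (d : ℝ) ∂ν) ^ (1 / Real.conjExponent (d : ℝ))
        = ((∫⁻ x, (‖A' k x - A x‖ₑ + ‖A x‖ₑ) ^ (d : ℝ) ∂ν) ^ (1 / (d : ℝ))) ^ (d - 1) := by
          rw [← ENNReal.rpow_natCast, ← ENNReal.rpow_mul]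
          congr 1
          have hc0 := hholder.symm.pos.ne'
          field_simp
          linarith [hexp]
      _ ≤ _ := by gcongr
  have hlim2 : Tendsto (fun k => ENNReal.ofReal (‖ω‖ * d) * (eLpNorm (A' k - A) d ν *
        (eLpNorm (A' k - A) d ν + eLpNorm A d ν) ^ (d - 1))) l (𝓝 0) := by
    have h1 := (hlim.add_const (eLpNorm A d ν))
    rw [zero_add] at h1
    have h2 := ((ENNReal.continuous_pow (d - 1)).tendsto _).comp h1
    have h3 := ENNReal.Tendsto.mul hlim (Or.inr (ENNReal.pow_ne_top hA.2.ne)) h2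
      (Or.inr ENNReal.zero_ne_top)
    rw [zero_mul] at h3
    have h4 := ENNReal.Tendsto.const_mul (a := ENNReal.ofReal (‖ω‖ * d)) h3
      (Or.inr ENNReal.ofReal_ne_top)
    rwa [mul_zero] at h4
  exact tendsto_of_tendsto_of_tendsto_of_le_of_le tendsto_const_nhds hlim2 (fun _ => zero_le)
    hbound

end WeakDerivativeMollification

/-! ### Passage from smooth maps to Sobolev maps. -/

section SobolevReverseHolder

open Metric Set Filter Topology Module ContinuousLinearMap
open scoped Convolution

section AlternatingApply

variable {E F ι : Type*} [NormedAddCommGroup E] [NormedSpace ℝ E] [NormedAddCommGroup F]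
  [NormedSpace ℝ F]

theorem continuous_alternating_apply (ω : F [⋀^ι]→L[ℝ] ℝ) (e : ι → E) :
    Continuous fun A : E →L[ℝ] F => ω (fun i => A (e i)) :=
  ω.cont.comp (by fun_prop)

variable [Fintype ι]

theorem norm_alternating_apply_le (ω : F [⋀^ι]→L[ℝ] ℝ) {e : ι → E} (he : ∀ i, ‖e i‖ ≤ 1)
    (A : E →L[ℝ] F) : ‖ω (fun i => A (e i))‖ ≤ ‖ω‖ * ‖A‖ ^ Fintype.card ι :=
  ω.le_opNorm_mul_pow_card_of_le
    ((pi_norm_le_iff_of_nonneg (norm_nonneg _)).2 fun k => A.unit_le_opNorm _ (he k))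

theorem integrable_alternating_apply {α : Type*} [MeasurableSpace α] {ν : Measure α}
    (ω : F [⋀^ι]→L[ℝ] ℝ) {e : ι → E} (he : ∀ i, ‖e i‖ ≤ 1) {A : α → E →L[ℝ] F}
    (hcard : Fintype.card ι ≠ 0) (hA : MemLp A (Fintype.card ι) ν) :
    Integrable (fun x => ω (fun i => A x (e i))) ν :=
  ((hA.integrable_norm_pow hcard).const_mul ‖ω‖).mono'
    ((continuous_alternating_apply ω e).comp_aestronglyMeasurable hA.1)
    (Eventually.of_forall fun x => norm_alternating_apply_le ω he (A x))

end AlternatingApply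

variable {E F ι : Type*} [NormedAddCommGroup E] [NormedSpace ℝ E] [FiniteDimensional ℝ E]
  [MeasurableSpace E] [BorelSpace E] {μ : Measure E} [μ.IsAddHaarMeasure]
  [NormedAddCommGroup F] [NormedSpace ℝ F] [CompleteSpace F] [Fintype ι]

/-- Smooth maps approximating a Sobolev map near a closed ball, with derivatives converging in
`L^p`. -/
theorem exists_contDiff_tendsto_eLpNorm_fderiv_sub {Ω : Set E} (hΩ : IsOpen Ω)
    {f : E → F} {Df : E → E →L[ℝ] F}
    (hf : LocallyIntegrableOn f Ω μ) (hDf : LocallyIntegrableOn Df Ω μ)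
    (hweak : ∀ φ : E → ℝ, ContDiff ℝ ((⊤ : ℕ∞) : WithTop ℕ∞) φ → HasCompactSupport φ →
      tsupport φ ⊆ Ω → ∀ v : E,
      ∫ x in Ω, (fderiv ℝ φ x v) • f x ∂μ = - ∫ x in Ω, φ x • Df x v ∂μ)
    {p : ℝ≥0∞} (hp : 1 ≤ p) (hptop : p ≠ ∞)
    (hLp : ∀ C ⊆ Ω, IsCompact C → MemLp Df p (μ.restrict C)) {x₀ : E} {r : ℝ} (hr : 0 < r)
    (hball : closedBall x₀ r ⊆ Ω) :
    ∃ u : ℕ → E → F, (∀ k, ContDiff ℝ 2 (u k)) ∧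
      Tendsto (fun k => eLpNorm (fderiv ℝ (u k) - Df) p (μ.restrict (ball x₀ r))) atTop (𝓝 0) := by
  -- A collar of width `ε` inside `Ω`; mollifiers of radius at most `ε` see only values of `f` in
  -- the larger ball `S`.
  obtain ⟨ε, hε, hεΩ⟩ := (isCompact_closedBall x₀ r).exists_cthickening_subset_open hΩ hball
  rw [cthickening_closedBall hε.le hr.le] at hεΩ
  set S := closedBall x₀ (ε + r) with hS
  have hScomp : IsCompact S := isCompact_closedBall _ _
  let φ : ℕ → ContDiffBump (0 : E) := fun k =>
    ⟨ε / (k + 1) / 2, ε / (k + 1), by positivity, half_lt_self (by positivity)⟩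
  have hφ : Tendsto (fun k => (φ k).rOut) atTop (𝓝 0) := by
    have := (tendsto_one_div_add_atTop_nhds_zero_nat (𝕜 := ℝ)).const_mul ε
    simp_rw [mul_one_div, mul_zero] at this
    exact this
  have hφε : ∀ k, (φ k).rOut ≤ ε := fun k => by
    have h1 : (1 : ℝ) ≤ k + 1 := by have : (0 : ℝ) ≤ k := Nat.cast_nonneg k; linarith
    exact div_le_self hε.le h1
  have hfS := locallyIntegrable_indicator_of_isCompact hf hScomp hεΩ
  refine ⟨fun k => (φ k).normed μ ⋆[lsmul ℝ ℝ, μ] S.indicator f, fun k => ?_, ?_⟩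
  · exact (φ k).hasCompactSupport_normed.contDiff_convolution_left (n := 2) (lsmul ℝ ℝ)
      (φ k).contDiff_normed hfS
  · refine tendsto_eLpNorm_restrict_sub_of_eq_normed_convolution hφ hp hptop
      hScomp.measurableSet measurableSet_ball
      (ball_subset_closedBall.trans (closedBall_subset_closedBall (by linarith)))
      (hLp S hεΩ hScomp) fun k x hx => ?_
    have hxk : closedBall x (φ k).rOut ⊆ S := by
      refine closedBall_subset_closedBall' ?_
      have := mem_ball.1 hx
      linarith [hφε k]
    exact fderiv_normed_convolution_of_weak hf hDf hweak hScomp hεΩ (φ k) hxk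

/-- Both sides of the smooth estimate pass to the limit: the left because the pullbacks converge in
`L^1`, the right because convergence in `L^n` on a ball implies convergence in `L^q` for `q ≤ n`. -/
theorem enorm_integral_mul_alternating_le_of_weak [DecidableEq ι] {Ω : Set E} (hΩ : IsOpen Ω)
    {f : E → F} {Df : E → E →L[ℝ] F}
    (hf : LocallyIntegrableOn f Ω μ) (hDf : LocallyIntegrableOn Df Ω μ)
    (hweak : ∀ φ : E → ℝ, ContDiff ℝ ((⊤ : ℕ∞) : WithTop ℕ∞) φ → HasCompactSupport φ →
      tsupport φ ⊆ Ω → ∀ v : E,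
      ∫ x in Ω, (fderiv ℝ φ x v) • f x ∂μ = - ∫ x in Ω, φ x • Df x v ∂μ)
    (hLp : ∀ C ⊆ Ω, IsCompact C → MemLp Df (Fintype.card ι) (μ.restrict C))
    (ω : F [⋀^ι]→L[ℝ] ℝ) {e : ι → E} (he : ∀ i, ‖e i‖ ≤ 1)
    {x₀ : E} {r M : ℝ} (hr : 0 < r) (hball : closedBall x₀ (2 * r) ⊆ Ω) (hM0 : 0 ≤ M) {φ : E → ℝ}
    (hφ : ContDiff ℝ 1 φ) (hc : HasCompactSupport φ) (hφB : tsupport φ ⊆ ball x₀ (2 * r))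
    (hφ1 : ∀ x, ‖φ x‖ ≤ 1)
    (hM : ∀ x, ‖fderiv ℝ φ x‖ ≤ M / r) {N : ℕ} (hN : 0 < N) (hcard : Fintype.card ι = N + 1)
    {p q : ℝ} (hq : 1 ≤ q) (hqN : q ≤ N + 1)
    (hqp : q < p) (hpq : finrank ℝ E * (p / q - 1) = 1 / 2) (hconj : p⁻¹ + N / q = 1) :
    ‖∫ x in ball x₀ (2 * r), φ x * ω (fun k => Df x (e k)) ∂μ‖ₑ ≤
      ENNReal.ofReal (4 * M * ‖ω‖) * (2 ^ (finrank ℝ E + 1)) ^ p⁻¹ *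
        μ (ball x₀ (2 * r)) ^ (p⁻¹ - q⁻¹) *
        (∫⁻ x in ball x₀ (2 * r), ‖Df x‖ₑ ^ q ∂μ) ^ ((N + 1) / q) := by
  set B := ball x₀ (2 * r) with hB
  have hq0 : 0 < q := by linarith
  have hcard0 : Fintype.card ι ≠ 0 := by omega
  have hcard1 : (1 : ℝ≥0∞) ≤ Fintype.card ι := by
    rw [hcard]; push_cast; exact le_add_self
  obtain ⟨u, hu, hlim⟩ := exists_contDiff_tendsto_eLpNorm_fderiv_sub hΩ hf hDf hweak hcard1
    (by simp) hLp (show 0 < 2 * r by linarith) hball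
  rw [← hB] at hlim
  have hV0 : μ B ≠ 0 := (measure_ball_pos μ x₀ (by linarith)).ne'
  have hVt : μ B ≠ ∞ := measure_ball_lt_top.ne
  have hfin : IsFiniteMeasure (μ.restrict B) := ⟨by simpa using hVt.lt_top⟩
  have hA : MemLp Df (Fintype.card ι) (μ.restrict B) :=
    (hLp _ hball (isCompact_closedBall _ _)).mono_measure
      (Measure.restrict_mono ball_subset_closedBall le_rfl)
  have hAk : ∀ k, AEStronglyMeasurable (fderiv ℝ (u k)) (μ.restrict B) := fun k =>
    ((hu k).continuous_fderiv two_ne_zero).aestronglyMeasurable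
  set K := ENNReal.ofReal (4 * M * ‖ω‖) * (2 ^ (finrank ℝ E + 1)) ^ p⁻¹ * μ B ^ (p⁻¹ - q⁻¹) with hK
  have hKtop : K ≠ ∞ := by
    have hp0 : 0 < p := by linarith
    refine ENNReal.mul_ne_top (ENNReal.mul_ne_top ENNReal.ofReal_ne_top ?_)
      (ENNReal.rpow_ne_top_of_ne_zero hV0 hVt)
    exact ENNReal.rpow_ne_top_of_nonneg (by positivity) (by simp)
  have hsmooth : ∀ k, ‖∫ x in B, φ x * ω (fun i => fderiv ℝ (u k) x (e i)) ∂μ‖ₑ ≤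
      K * (∫⁻ x in B, ‖fderiv ℝ (u k) x‖ₑ ^ q ∂μ) ^ ((N + 1) / q) := by
    intro k
    rw [setIntegral_eq_integral_of_forall_compl_eq_zero]
    · exact enorm_integral_mul_alternating_le_rpow μ ω he (hu k) hr hM0 hφ hc hφB hM hN hcard hq
        hqp hpq hconj
    · intro x hx
      have : φ x = 0 := by
        by_contra h
        exact hx (hφB (subset_tsupport φ h))
      simp [this]
  have hnorm : ∀ h : E → E →L[ℝ] F, (∫⁻ x in B, ‖h x‖ₑ ^ q ∂μ) ^ ((N + 1) / q) =
      eLpNorm h (ENNReal.ofReal q) (μ.restrict B) ^ (N + 1) := by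
    intro h
    rw [eLpNorm_eq_lintegral_rpow_enorm_toReal (by simpa using hq0) ENNReal.ofReal_ne_top,
      ENNReal.toReal_ofReal hq0.le, ← ENNReal.rpow_natCast, ← ENNReal.rpow_mul]
    congr 1
    push_cast
    field_simp
  have hq1 : (1 : ℝ≥0∞) ≤ ENNReal.ofReal q := by
    rw [← ENNReal.ofReal_one]; exact ENNReal.ofReal_le_ofReal hq
  have hqc : ENNReal.ofReal q ≤ Fintype.card ι := by
    rw [hcard, ← ENNReal.ofReal_natCast]
    apply ENNReal.ofReal_le_ofReal
    exact_mod_cast hqN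
  have hlimq : Tendsto (fun k => eLpNorm (fderiv ℝ (u k) - Df) (ENNReal.ofReal q) (μ.restrict B))
      atTop (𝓝 0) :=
    tendsto_eLpNorm_sub_of_exponent_le hAk hA.1 (zero_lt_one.trans_le hq1).ne' (by simp) hqc hlim
  have hbound : ∀ k, ‖∫ x in B, φ x * ω (fun i => fderiv ℝ (u k) x (e i)) ∂μ‖ₑ ≤
      K * (eLpNorm (fderiv ℝ (u k) - Df) (ENNReal.ofReal q) (μ.restrict B) +
        eLpNorm Df (ENNReal.ofReal q) (μ.restrict B)) ^ (N + 1) := by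
    intro k
    refine (hsmooth k).trans ?_
    rw [hnorm]
    gcongr
    exact eLpNorm_le_eLpNorm_sub_add (hAk k) hA.1 hq1
  have hright : Tendsto (fun k => K * (eLpNorm (fderiv ℝ (u k) - Df) (ENNReal.ofReal q)
      (μ.restrict B) + eLpNorm Df (ENNReal.ofReal q) (μ.restrict B)) ^ (N + 1)) atTop
      (𝓝 (K * eLpNorm Df (ENNReal.ofReal q) (μ.restrict B) ^ (N + 1))) := by
    have h1 := hlimq.add_const (eLpNorm Df (ENNReal.ofReal q) (μ.restrict B))
    rw [zero_add] at h1
    exact ENNReal.Tendsto.const_mul (((ENNReal.continuous_pow (N + 1)).tendsto _).comp h1)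
      (Or.inr hKtop)
  have hφm : AEStronglyMeasurable φ (μ.restrict B) := hφ.continuous.aestronglyMeasurable
  have hleft : Tendsto (fun k => ∫ x in B, φ x * ω (fun i => fderiv ℝ (u k) x (e i)) ∂μ) atTop
      (𝓝 (∫ x in B, φ x * ω (fun i => Df x (e i)) ∂μ)) := by
    refine tendsto_integral_of_L1 (fun x => φ x * ω (fun i => Df x (e i)))
      (hφm.mul (integrable_alternating_apply ω he hcard0 hA).1)
      (Eventually.of_forall fun k => ?_) ?_
    · have hcont : Continuous fun x => φ x * ω (fun i => fderiv ℝ (u k) x (e i)) :=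
        hφ.continuous.mul ((continuous_alternating_apply ω e).comp
          ((hu k).continuous_fderiv two_ne_zero))
      exact (hcont.locallyIntegrable.integrableOn_isCompact
        (isCompact_closedBall x₀ (2 * r))).mono_set ball_subset_closedBall
    · refine tendsto_of_tendsto_of_tendsto_of_le_of_le tendsto_const_nhds
        (tendsto_lintegral_alternating_sub ω he (by omega) hA hAk hlim) (fun _ => zero_le)
        fun k => lintegral_mono fun x => ?_
      simp only [← mul_sub, enorm_mul]
      refine mul_le_of_le_one_left zero_le ?_
      rw [← ofReal_norm, ← ENNReal.ofReal_one]
      exact ENNReal.ofReal_le_ofReal (hφ1 x)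
  rw [hnorm]
  exact le_of_tendsto_of_tendsto' ((continuous_enorm.tendsto _).comp hleft) hright hbound

end SobolevReverseHolder

/-! ### The reverse Hölder inequality with constants independent of the target. -/

section ReverseHolder

open Metric Set Filter Topology Module

universe v

variable {E : Type*} [NormedAddCommGroup E] [NormedSpace ℝ E] [FiniteDimensional ℝ E]
  [MeasurableSpace E] [BorelSpace E] (μ : Measure E) [μ.IsAddHaarMeasure]

/-- Reverse Hölder inequality for the pullback of a constant form whose pullback is nonnegative. -/
theorem exists_reverse_holder {n : ℕ} (hn : 2 ≤ n) (hE : finrank ℝ E = n) {s : ℝ}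
    (hs : s = 1 - 1 / (n * (2 * n + 1))) :
    ∃ C : NNReal, ∀ (F : Type v) [NormedAddCommGroup F] [NormedSpace ℝ F] [CompleteSpace F]
      (Ω : Set E) (f : E → F) (Df : E → E →L[ℝ] F) (ω : F [⋀^Fin n]→L[ℝ] ℝ) (e : Fin n → E),
      IsOpen Ω → LocallyIntegrableOn f Ω μ → LocallyIntegrableOn Df Ω μ →
      (∀ φ : E → ℝ, ContDiff ℝ ((⊤ : ℕ∞) : WithTop ℕ∞) φ → HasCompactSupport φ →
        tsupport φ ⊆ Ω → ∀ v : E,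
        ∫ x in Ω, (fderiv ℝ φ x v) • f x ∂μ = - ∫ x in Ω, φ x • Df x v ∂μ) →
      (∀ C ⊆ Ω, IsCompact C → MemLp Df n (μ.restrict C)) → (∀ i, ‖e i‖ ≤ 1) →
      (∀ᵐ x ∂μ.restrict Ω, 0 ≤ ω (fun i => Df x (e i))) →
      ∀ (x₀ : E) (r : ℝ), 0 < r → closedBall x₀ (2 * r) ⊆ Ω →
        (∫⁻ x in closedBall x₀ r, ENNReal.ofReal (ω (fun i => Df x (e i))) ∂μ) ^ s ≤
          C * μ (closedBall x₀ r) ^ (s - 1) *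
            ∫⁻ x in closedBall x₀ (2 * r), ENNReal.ofReal (‖ω‖ * ‖Df x‖ ^ n) ^ s ∂μ := by
  obtain ⟨N, rfl⟩ : ∃ N, n = N + 1 := ⟨n - 1, by omega⟩
  obtain ⟨M, hM0, hcut⟩ := exists_cutoff E
  have hN : 0 < N := by omega
  have hN0 : (1 : ℝ) ≤ N := by exact_mod_cast hN
  push_cast at hs
  -- With `n = N + 1`, the two requirements `n (p/q - 1) = 1/2` (integrable singularity in Poincaré)
  -- and `1/p + (n-1)/q = 1` (Hölder) give `q = n - 1/(2n+1)`; this is where the value of `s = q/n`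
  -- comes from.
  set q : ℝ := s * (N + 1) with hq
  have hqv : q = N + 1 - 1 / (2 * N + 3) := by
    rw [hq, hs]; field_simp; ring
  have hd : 1 / (2 * (N : ℝ) + 3) ≤ 1 / 5 := by gcongr; linarith
  have hd0 : 0 < 1 / (2 * (N : ℝ) + 3) := by positivity
  have hq1 : 1 ≤ q := by rw [hqv]; linarith
  have hqN : q ≤ N + 1 := by rw [hqv]; linarith
  have hs0 : 0 < s := by
    by_contra h
    have : q ≤ 0 := by rw [hq]; exact mul_nonpos_of_nonpos_of_nonneg (not_lt.1 h) (by positivity)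
    linarith
  have hs1 : s ≤ 1 := by
    rw [hs]
    have : 0 ≤ 1 / (((N : ℝ) + 1) * (2 * (N + 1) + 1)) := by positivity
    linarith
  set p : ℝ := q / (1 - 1 / (2 * N + 3)) with hp
  have hd1 : 0 < 1 - 1 / (2 * (N : ℝ) + 3) := by linarith
  have hqp : q < p := by
    rw [hp, lt_div_iff₀ hd1]
    nlinarith
  have hpq : (finrank ℝ E : ℝ) * (p / q - 1) = 1 / 2 := by
    have h3 : q ≠ 0 := by linarith
    have h4 : 1 - 1 / (2 * (N : ℝ) + 3) = 2 * (N + 1) / (2 * N + 3) := by field_simp; ring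
    rw [hE, hp, h4]
    push_cast
    field_simp
    ring
  have hconj : p⁻¹ + N / q = 1 := by
    have h3 : q ≠ 0 := by linarith
    rw [hp, inv_div, ← add_div, div_eq_one_iff_eq h3, hqv]
    ring
  set D : ℝ≥0∞ := (ENNReal.ofReal (4 * M) * (2 ^ (finrank ℝ E + 1)) ^ p⁻¹) ^ s with hD
  have hDtop : D ≠ ∞ := by
    have hp0 : 0 < p := by linarith
    refine ENNReal.rpow_ne_top_of_nonneg hs0.le (ENNReal.mul_ne_top ENNReal.ofReal_ne_top ?_)
    exact ENNReal.rpow_ne_top_of_nonneg (by positivity) (by simp)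
  -- The constant is fixed before the target space, the map and the form are introduced.
  refine ⟨D.toNNReal, ?_⟩
  intro F _ _ _ Ω f Df ω e hΩ hf hDf hweak hLp he hJ x₀ r hr hball
  rw [ENNReal.coe_toNNReal hDtop]
  obtain ⟨φ, hφ, hc, hφB, hφ0, hφ1, hφr, hφM⟩ := hcut x₀ r hr
  have hest := enorm_integral_mul_alternating_le_of_weak (ι := Fin (N + 1)) (μ := μ) hΩ hf hDf hweak
    (by simpa only [Fintype.card_fin] using hLp) ω he hr hball hM0 hφ hc hφB
    (fun x => by rw [Real.norm_of_nonneg (hφ0 x)]; exact hφ1 x) hφM hN (by simp) hq1 hqN hqp hpq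
    hconj
  set B := ball x₀ (2 * r) with hB
  have hBΩ : B ⊆ Ω := ball_subset_closedBall.trans hball
  have hAB : closedBall x₀ r ⊆ B := closedBall_subset_ball (by linarith)
  have hJB : ∀ᵐ x ∂μ.restrict B, 0 ≤ ω (fun i => Df x (e i)) :=
    ae_restrict_of_ae_restrict_of_subset hBΩ hJ
  have hA : MemLp Df (Fintype.card (Fin (N + 1))) (μ.restrict B) := by
    rw [Fintype.card_fin]
    exact (hLp _ hball (isCompact_closedBall _ _)).mono_measure
      (Measure.restrict_mono ball_subset_closedBall le_rfl)
  have hInt : Integrable (fun x => φ x * ω (fun i => Df x (e i))) (μ.restrict B) := by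
    refine (integrable_alternating_apply ω he (by simp) hA).bdd_mul (c := 1)
      hφ.continuous.aestronglyMeasurable (Eventually.of_forall fun x => ?_)
    rw [Real.norm_of_nonneg (hφ0 x)]
    exact hφ1 x
  -- Nonnegativity of the pullback is essential here: the cutoff equals 1 on the small ball and the
  -- rest of the integral can only add.
  have hstart : ∫⁻ x in closedBall x₀ r, ENNReal.ofReal (ω (fun i => Df x (e i))) ∂μ ≤
      ‖∫ x in B, φ x * ω (fun k => Df x (e k)) ∂μ‖ₑ := by
    have hnn : ∀ᵐ x ∂μ.restrict B, 0 ≤ φ x * ω (fun i => Df x (e i)) := by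
      filter_upwards [hJB] with x hx using mul_nonneg (hφ0 x) hx
    rw [Real.enorm_of_nonneg (integral_nonneg_of_ae hnn),
      ofReal_integral_eq_lintegral_ofReal hInt hnn]
    calc ∫⁻ x in closedBall x₀ r, ENNReal.ofReal (ω (fun i => Df x (e i))) ∂μ
        = ∫⁻ x in closedBall x₀ r, ENNReal.ofReal (φ x * ω (fun i => Df x (e i))) ∂μ := by
          refine setLIntegral_congr_fun isClosed_closedBall.measurableSet fun x hx => ?_
          simp only [hφr x hx, one_mul]
      _ ≤ _ := lintegral_mono_set hAB
  have hV0 : μ (closedBall x₀ r) ≠ 0 := (measure_closedBall_pos μ x₀ hr).ne'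
  have hsplit : ENNReal.ofReal (4 * M * ‖ω‖) = ENNReal.ofReal (4 * M) * ENNReal.ofReal ‖ω‖ :=
    ENNReal.ofReal_mul (by positivity)
  have hexp : (p⁻¹ - q⁻¹) * s = s - 1 := by
    have h3 : q ≠ 0 := by linarith
    have h4 : p⁻¹ = 1 - N / q := by linarith
    rw [h4]
    field_simp
    rw [hq]
    ring
  have hexp' : ((N : ℝ) + 1) / q * s = 1 := by
    have h3 : q ≠ 0 := by linarith
    field_simp
    rw [hq]; ring
  calc (∫⁻ x in closedBall x₀ r, ENNReal.ofReal (ω (fun i => Df x (e i))) ∂μ) ^ s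
      ≤ (ENNReal.ofReal (4 * M * ‖ω‖) * (2 ^ (finrank ℝ E + 1)) ^ p⁻¹ *
        μ B ^ (p⁻¹ - q⁻¹) * (∫⁻ x in B, ‖Df x‖ₑ ^ q ∂μ) ^ (((N : ℝ) + 1) / q)) ^ s := by
        exact ENNReal.rpow_le_rpow (hstart.trans hest) hs0.le
    _ = D * μ B ^ (s - 1) * (ENNReal.ofReal ‖ω‖ ^ s * ∫⁻ x in B, ‖Df x‖ₑ ^ q ∂μ) := by
        rw [ENNReal.mul_rpow_of_nonneg _ _ hs0.le, ENNReal.mul_rpow_of_nonneg _ _ hs0.le,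
          ← ENNReal.rpow_mul, ← ENNReal.rpow_mul, hexp, hexp', ENNReal.rpow_one, hsplit, hD]
        simp only [ENNReal.mul_rpow_of_nonneg _ _ hs0.le]
        ring
    _ ≤ D * μ (closedBall x₀ r) ^ (s - 1) *
        (ENNReal.ofReal ‖ω‖ ^ s * ∫⁻ x in closedBall x₀ (2 * r), ‖Df x‖ₑ ^ q ∂μ) := by
        have h1 : μ B ^ (s - 1) ≤ μ (closedBall x₀ r) ^ (s - 1) := by
          have h2 : s - 1 = -(1 - s) := by ring
          rw [h2, ENNReal.rpow_neg, ENNReal.rpow_neg]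
          exact ENNReal.inv_le_inv.2 (ENNReal.rpow_le_rpow (measure_mono hAB) (by linarith))
        have h2 : ∫⁻ x in B, ‖Df x‖ₑ ^ q ∂μ ≤ ∫⁻ x in closedBall x₀ (2 * r), ‖Df x‖ₑ ^ q ∂μ :=
          lintegral_mono_set ball_subset_closedBall
        exact mul_le_mul' (mul_le_mul_right h1 _) (mul_le_mul_right h2 _)
    _ = _ := by
        rw [← lintegral_const_mul' _ _ (ENNReal.rpow_ne_top_of_nonneg hs0.le ENNReal.ofReal_ne_top)]
        congr 2
        ext x
        rw [ENNReal.ofReal_mul (norm_nonneg _), ENNReal.mul_rpow_of_nonneg _ _ hs0.le,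
          ENNReal.ofReal_pow (norm_nonneg _), ofReal_norm (Df x), ← ENNReal.rpow_natCast (‖Df x‖ₑ),
          ← ENNReal.rpow_mul]
        congr 2
        rw [hq]
        push_cast
        ring

end ReverseHolder

/-! ### Localization by a depth weight. -/

section Localization

open Metric Set Filter Topology Module
open scoped NNReal

section Depth

variable {E : Type*} [SeminormedAddCommGroup E]

/-- The distance from a point of the ball of center `z` and radius `R` to the bounding sphere,
extended by zero. -/
noncomputable def ballDepth (z : E) (R : ℝ) (x : E) : ℝ := max 0 (R - dist x z)

theorem ballDepth_nonneg (z : E) (R : ℝ) (x : E) : 0 ≤ ballDepth z R x := le_max_left _ _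

theorem ballDepth_eq_zero {z : E} {R : ℝ} {x : E} (hx : x ∉ ball z R) : ballDepth z R x = 0 :=
  max_eq_left (by rw [mem_ball, not_lt] at hx; linarith)

theorem ballDepth_le_add (z : E) (R : ℝ) (x y : E) :
    ballDepth z R y ≤ ballDepth z R x + dist y x := by
  refine max_le (add_nonneg (ballDepth_nonneg z R x) dist_nonneg) ?_
  have h1 : R - dist x z ≤ ballDepth z R x := le_max_right _ _
  linarith [dist_triangle x y z, dist_comm x y]

theorem continuous_ballDepth (z : E) (R : ℝ) : Continuous (ballDepth z R) := by
  unfold ballDepth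
  fun_prop

theorem ballDepth_le {z : E} {R : ℝ} (hR : 0 ≤ R) (x : E) : ballDepth z R x ≤ R :=
  max_le hR (by linarith [dist_nonneg (x := x) (y := z)])

end Depth

variable {E : Type*} [NormedAddCommGroup E] [NormedSpace ℝ E] [FiniteDimensional ℝ E]
  [MeasurableSpace E] [BorelSpace E] {μ : Measure E} [μ.IsAddHaarMeasure]

/-- At depth below `4 * r` the weight is at most `(5 r)^d` on the ball, a multiple of its measure,
so the weighted average cannot exceed a fixed multiple of `∫ j`. For levels above that threshold
every ball with a large average lies deep inside. -/
theorem weighted_average_depth_ge [Nontrivial E] {j : E → ℝ≥0∞} {z : E} {R : ℝ} {t : ℝ≥0∞}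
    (ht : 5 ^ finrank ℝ E * ∫⁻ x in ball z R, j x ∂μ ≤ t * μ (closedBall 0 1)) {x : E} {r : ℝ}
    (hr : 0 < r) (hav : t * μ (closedBall x r) <
      ∫⁻ y in closedBall x r, ENNReal.ofReal (ballDepth z R y) ^ finrank ℝ E * j y ∂μ) :
    4 * r ≤ ballDepth z R x := by
  by_contra! h4
  refine absurd hav (not_lt.2 ?_)
  set d := finrank ℝ E
  have hd : d ≠ 0 := (finrank_pos (R := ℝ) (M := E)).ne'
  have htop : ENNReal.ofReal (5 * r) ^ d ≠ ∞ := ENNReal.pow_ne_top ENNReal.ofReal_ne_top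
  calc ∫⁻ y in closedBall x r, ENNReal.ofReal (ballDepth z R y) ^ d * j y ∂μ
      ≤ ∫⁻ y in closedBall x r, (ball z R).indicator
          (fun y => ENNReal.ofReal (5 * r) ^ d * j y) y ∂μ := by
        refine setLIntegral_mono' isClosed_closedBall.measurableSet fun y hy => ?_
        by_cases hyz : y ∈ ball z R
        · rw [indicator_of_mem hyz]
          gcongr
          have := ballDepth_le_add z R x y
          linarith [mem_closedBall.1 hy]
        · rw [indicator_of_notMem hyz, ballDepth_eq_zero hyz]
          simp [hd]
    _ ≤ ∫⁻ y, (ball z R).indicator (fun y => ENNReal.ofReal (5 * r) ^ d * j y) y ∂μ :=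
        setLIntegral_le_lintegral _ _
    _ = ENNReal.ofReal (5 * r) ^ d * ∫⁻ y in ball z R, j y ∂μ := by
        rw [lintegral_indicator measurableSet_ball, lintegral_const_mul' _ _ htop]
    _ = ENNReal.ofReal r ^ d * (5 ^ d * ∫⁻ y in ball z R, j y ∂μ) := by
        rw [ENNReal.ofReal_mul (by norm_num), mul_pow, ENNReal.ofReal_ofNat]
        ring
    _ ≤ ENNReal.ofReal r ^ d * (t * μ (closedBall 0 1)) := by gcongr
    _ = t * μ (closedBall x r) := by
        rw [Measure.addHaar_closedBall' μ x hr.le, ENNReal.ofReal_pow hr.le]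
        ring

/-- On a deep ball the depth is nearly constant: with `D` its value at the center, it is at most
`3D/2` on the ball and at least `D/2` on the double ball. The weight therefore costs only the ratio
`3^d`. -/
theorem weighted_reverse_holder [Nontrivial E] {s : ℝ} (hs0 : 0 < s) (hs1 : s ≤ 1) {C : ℝ≥0} {j g : E → ℝ≥0∞}
    {z : E} {R : ℝ} (hRH : ∀ x r, 0 < r → closedBall x (2 * r) ⊆ ball z R →
      (∫⁻ y in closedBall x r, j y ∂μ) ^ s ≤
        C * μ (closedBall x r) ^ (s - 1) * ∫⁻ y in closedBall x (2 * r), g y ^ s ∂μ)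
    {t : ℝ≥0∞}
    (ht : 5 ^ finrank ℝ E * ∫⁻ x in ball z R, j x ∂μ ≤ t * μ (closedBall 0 1)) {x : E} {r : ℝ}
    (hr : 0 < r) (hav : t * μ (closedBall x r) <
      ∫⁻ y in closedBall x r, ENNReal.ofReal (ballDepth z R y) ^ finrank ℝ E * j y ∂μ) :
    t ^ s * μ (closedBall x r) ≤ (C * 3 ^ finrank ℝ E : ℝ≥0) *
      ∫⁻ y in closedBall x (2 * r),
        (ENNReal.ofReal (ballDepth z R y) ^ finrank ℝ E * g y) ^ s ∂μ := by
  have h4 := weighted_average_depth_ge ht hr hav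
  set d := finrank ℝ E
  set D := ballDepth z R x with hD
  have hsub : closedBall x (2 * r) ⊆ ball z R := by
    intro y hy
    by_contra hyz
    have h1 := ballDepth_le_add z R y x
    rw [ballDepth_eq_zero hyz, dist_comm] at h1
    linarith [mem_closedBall.1 hy]
  have hup : ∫⁻ y in closedBall x r, ENNReal.ofReal (ballDepth z R y) ^ d * j y ∂μ ≤
      ENNReal.ofReal (3 * (D / 2)) ^ d * ∫⁻ y in closedBall x r, j y ∂μ := by
    rw [← lintegral_const_mul' _ _ (ENNReal.pow_ne_top ENNReal.ofReal_ne_top)]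
    refine setLIntegral_mono' isClosed_closedBall.measurableSet fun y hy => ?_
    gcongr
    have := ballDepth_le_add z R x y
    linarith [mem_closedBall.1 hy]
  have hlow : (ENNReal.ofReal (D / 2) ^ d) ^ s * ∫⁻ y in closedBall x (2 * r), g y ^ s ∂μ ≤
      ∫⁻ y in closedBall x (2 * r), (ENNReal.ofReal (ballDepth z R y) ^ d * g y) ^ s ∂μ := by
    rw [← lintegral_const_mul' _ _ (ENNReal.rpow_ne_top_of_nonneg hs0.le
      (ENNReal.pow_ne_top ENNReal.ofReal_ne_top))]
    refine setLIntegral_mono' isClosed_closedBall.measurableSet fun y hy => ?_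
    rw [← ENNReal.mul_rpow_of_nonneg _ _ hs0.le]
    gcongr
    have := ballDepth_le_add z R y x
    rw [dist_comm] at this
    linarith [mem_closedBall.1 hy]
  set V := μ (closedBall x r) with hV
  have hV0 : V ≠ 0 := (measure_closedBall_pos μ x hr).ne'
  have hVt : V ≠ ∞ := measure_closedBall_lt_top.ne
  have h3 : ((3 : ℝ≥0∞) ^ d) ^ s ≤ 3 ^ d := by
    conv_rhs => rw [← ENNReal.rpow_one (3 ^ d)]
    exact ENNReal.rpow_le_rpow_of_exponent_le (one_le_pow₀ (by norm_num)) hs1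
  calc t ^ s * V = (t * V) ^ s * V ^ (1 - s) := by
        rw [ENNReal.mul_rpow_of_nonneg _ _ hs0.le, mul_assoc, ← ENNReal.rpow_add _ _ hV0 hVt,
          add_sub_cancel, ENNReal.rpow_one]
    _ ≤ (ENNReal.ofReal (3 * (D / 2)) ^ d * ∫⁻ y in closedBall x r, j y ∂μ) ^ s * V ^ (1 - s) :=
        mul_le_mul_left (ENNReal.rpow_le_rpow (hav.le.trans hup) hs0.le) _
    _ = (3 ^ d) ^ s * (ENNReal.ofReal (D / 2) ^ d) ^ s * V ^ (1 - s) *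
          (∫⁻ y in closedBall x r, j y ∂μ) ^ s := by
        rw [ENNReal.ofReal_mul (by norm_num), mul_pow, ENNReal.ofReal_ofNat,
          ENNReal.mul_rpow_of_nonneg _ _ hs0.le, ENNReal.mul_rpow_of_nonneg _ _ hs0.le]
        ring
    _ ≤ (3 ^ d) ^ s * (ENNReal.ofReal (D / 2) ^ d) ^ s * V ^ (1 - s) *
          (C * V ^ (s - 1) * ∫⁻ y in closedBall x (2 * r), g y ^ s ∂μ) :=
        mul_le_mul_right (hRH x r hr hsub) _
    _ = C * (3 ^ d) ^ s * (V ^ (1 - s) * V ^ (s - 1)) * ((ENNReal.ofReal (D / 2) ^ d) ^ s *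
          ∫⁻ y in closedBall x (2 * r), g y ^ s ∂μ) := by ring
    _ ≤ C * 3 ^ d * 1 * ∫⁻ y in closedBall x (2 * r),
          (ENNReal.ofReal (ballDepth z R y) ^ d * g y) ^ s ∂μ := by
        rw [← ENNReal.rpow_add _ _ hV0 hVt]
        have : 1 - s + (s - 1) = 0 := by ring
        rw [this, ENNReal.rpow_zero]
        exact mul_le_mul' (mul_le_mul_left (mul_le_mul_right h3 _) _) hlow
    _ = _ := by
        push_cast
        rw [mul_one]

/-- Integrability of `J log^a(e + J)` near the center of a ball on which `J` satisfies a reverse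
Hölder inequality with exponentially integrable distortion. -/
theorem exists_lintegral_mul_log_rpow_ne_top [Nontrivial E] (μ : Measure E) [μ.IsAddHaarMeasure]
    {s : ℝ} (hs0 : 0 < s) (hs1 : s < 1) (C : ℝ≥0) :
    ∃ c : ℝ, 0 < c ∧ ∀ (J G K : E → ℝ) (z : E) (R lam a : ℝ), Measurable J → Measurable G →
      0 < R → 0 < lam → 0 < a → a ≤ c * lam →
      (∀ᵐ x ∂μ.restrict (ball z R), 0 ≤ J x ∧ J x ≤ G x ∧ G x ≤ K x * J x ∧ 1 ≤ K x) →
      ∫⁻ x in ball z R, ENNReal.ofReal (J x) ∂μ ≠ ∞ →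
      ∫⁻ x in ball z R, ENNReal.ofReal (Real.exp (lam * K x)) ∂μ ≠ ∞ →
      (∀ x r, 0 < r → closedBall x (2 * r) ⊆ ball z R →
        (∫⁻ y in closedBall x r, ENNReal.ofReal (J y) ∂μ) ^ s ≤
          C * μ (closedBall x r) ^ (s - 1) *
            ∫⁻ y in closedBall x (2 * r), ENNReal.ofReal (G y) ^ s ∂μ) →
      ∫⁻ x in ball z (R / 2), ENNReal.ofReal (J x * Real.log (Real.exp 1 + J x) ^ a) ∂μ ≠ ∞ := by
  set d := finrank ℝ E with hd
  have hd0 : d ≠ 0 := (finrank_pos (R := ℝ) (M := E)).ne'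
  obtain ⟨A, hA, hlevel⟩ := setLIntegral_superlevel_le μ hs0 (C * 3 ^ d)
  have hs1' : 0 < 1 - s := by linarith
  refine ⟨(1 - s) ^ 2 / (32 * A ^ 2), by positivity, ?_⟩
  intro J G K z R lam a hJ hG hR hlam ha haL hae hJi hKi hRH
  set W : E → ℝ := fun x => ballDepth z R x ^ d with hW
  have hW0 : ∀ x, 0 ≤ W x := fun x => pow_nonneg (ballDepth_nonneg z R x) _
  have hWm : Measurable W := ((continuous_ballDepth z R).pow d).measurable
  have hWout : ∀ x, x ∉ ball z R → W x = 0 := fun x hx => by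
    simp only [hW]
    rw [ballDepth_eq_zero hx, zero_pow hd0]
  have hofReal : ∀ (h : E → ℝ) x, ENNReal.ofReal (W x * h x) =
      ENNReal.ofReal (ballDepth z R x) ^ d * ENNReal.ofReal (h x) := fun h x => by
    rw [ENNReal.ofReal_mul (hW0 x), ENNReal.ofReal_pow (ballDepth_nonneg z R x)]
  set I := ∫⁻ x in ball z R, ENNReal.ofReal (J x) ∂μ with hI
  have hB0 : μ (closedBall (0 : E) 1) ≠ 0 := (measure_closedBall_pos μ 0 one_pos).ne'
  have hBt : μ (closedBall (0 : E) 1) ≠ ∞ := measure_closedBall_lt_top.ne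
  -- The level above which `weighted_average_depth_ge` applies to every ball.
  set τ : ℝ≥0∞ := 5 ^ d * I / μ (closedBall (0 : E) 1) with hτ
  have hτtop : τ ≠ ∞ := ENNReal.div_ne_top (ENNReal.mul_ne_top (by simp) hJi) hB0
  have hWJi : ∫⁻ x, ENNReal.ofReal (W x * J x) ∂μ ≠ ∞ := by
    refine ne_top_of_le_ne_top (b := ENNReal.ofReal (R ^ d) * I)
      (ENNReal.mul_ne_top ENNReal.ofReal_ne_top hJi) ?_
    rw [hI, ← lintegral_const_mul' _ _ ENNReal.ofReal_ne_top,
      ← lintegral_indicator measurableSet_ball]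
    refine lintegral_mono fun x => ?_
    by_cases hx : x ∈ ball z R
    · rw [indicator_of_mem hx, ENNReal.ofReal_mul (hW0 x)]
      gcongr
      exact pow_le_pow_left₀ (ballDepth_nonneg z R x) (ballDepth_le hR.le x) _
    · simp [hWout x hx]
  have hmain : ∫⁻ x in ball z R,
      ENNReal.ofReal (W x * J x * Real.log (Real.exp 1 + W x * J x) ^ a) ∂μ ≠ ∞ := by
    refine lintegral_mul_log_rpow_ne_top (J := fun x => W x * J x) (G := fun x => W x * G x) (K := K)
      (hWm.mul hJ) (hWm.mul hG) hs0 hs1 hA ha hlam (t₀ := τ.toReal + 1) (by positivity) haL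
      ?_ ?_ ?_ ?_ (ne_top_of_le_ne_top hWJi (setLIntegral_le_lintegral _ _)) hKi ?_
    · filter_upwards [hae] with x hx using mul_nonneg (hW0 x) hx.1
    · filter_upwards [hae] with x hx using mul_le_mul_of_nonneg_left hx.2.1 (hW0 x)
    · filter_upwards [hae] with x hx
      have := mul_le_mul_of_nonneg_left hx.2.2.1 (hW0 x)
      linarith
    · filter_upwards [hae] with x hx using hx.2.2.2
    · intro t ht
      have ht0 : 0 < t := lt_of_le_of_lt (by positivity) ht
      have hτt : τ ≤ ENNReal.ofReal t := by
        rw [← ENNReal.ofReal_toReal hτtop]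
        exact ENNReal.ofReal_le_ofReal (by linarith)
      have hlv := hlevel (fun x => ENNReal.ofReal (W x * J x)) (fun x => ENNReal.ofReal (W x * G x))
        (hWm.mul hJ).ennreal_ofReal (hWm.mul hG).ennreal_ofReal hWJi (ENNReal.ofReal t)
        (by simpa using ht0) ENNReal.ofReal_ne_top (by
          intro x r hr hav
          simp only [hofReal] at hav ⊢
          refine weighted_reverse_holder hs0 hs1.le hRH ?_ hr hav
          rw [hτ, ENNReal.div_le_iff hB0 hBt] at hτt
          exact hτt)
      have hset1 : {x | ENNReal.ofReal t < ENNReal.ofReal (W x * J x)} = {x | t < W x * J x} := by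
        ext x
        exact ENNReal.ofReal_lt_ofReal_iff_of_nonneg ht0.le
      have hset2 : {x | ENNReal.ofReal t < ENNReal.ofReal A * ENNReal.ofReal (W x * G x)} =
          {x | t < A * (W x * G x)} := by
        ext x
        rw [mem_ofPred_eq, ← ENNReal.ofReal_mul (by linarith)]
        exact ENNReal.ofReal_lt_ofReal_iff_of_nonneg ht0.le
      rw [hset1, hset2] at hlv
      -- The level set estimate is global, but the weight vanishes outside the ball, so both
      -- measures may be restricted to it, where the pointwise hypotheses hold.
      have hsub : {x | t < A * (W x * G x)} ⊆ ball z R := by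
        intro x hx
        by_contra hxz
        rw [mem_ofPred_eq, hWout x hxz] at hx
        simp at hx
        linarith
      have hSm : MeasurableSet {x | t < A * (W x * G x)} :=
        measurableSet_lt measurable_const ((hWm.mul hG).const_mul A)
      rw [Measure.restrict_restrict hSm, inter_eq_left.2 hsub]
      refine le_trans ?_ hlv
      exact lintegral_mono' (Measure.restrict_mono_measure Measure.restrict_le_self _) le_rfl
  -- On the half ball the weight is at least `(R/2)^d`, so `c` undoes it; the maximum with 1 makes
  -- `log c` nonnegative.
  set c : ℝ := max 1 ((2 / R) ^ d) with hc
  have hc1 : 1 ≤ c := le_max_left _ _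
  have hlc : 0 ≤ Real.log c := Real.log_nonneg hc1
  set Q : ℝ := c * (1 + Real.log c) ^ a with hQ
  have hQ0 : 0 ≤ Q := by positivity
  refine ne_top_of_le_ne_top (ENNReal.mul_ne_top (ENNReal.ofReal_ne_top (r := Q)) hmain) ?_
  rw [← lintegral_const_mul' _ _ ENNReal.ofReal_ne_top]
  have hsubR : ball z (R / 2) ⊆ ball z R := ball_subset_ball (by linarith)
  refine le_trans (lintegral_mono_ae (g := fun x => ENNReal.ofReal Q *
    ENNReal.ofReal (W x * J x * Real.log (Real.exp 1 + W x * J x) ^ a)) ?_) (lintegral_mono_set hsubR)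
  filter_upwards [ae_restrict_of_ae_restrict_of_subset hsubR hae,
    ae_restrict_mem measurableSet_ball] with x hx hxz
  rw [← ENNReal.ofReal_mul hQ0]
  apply ENNReal.ofReal_le_ofReal
  have hdep : R / 2 ≤ ballDepth z R x := by
    refine le_trans ?_ (le_max_right _ _)
    linarith [mem_ball.1 hxz]
  have hJc : J x ≤ W x * J x * c := by
    have h1 : (R / 2) ^ d ≤ W x := pow_le_pow_left₀ (by positivity) hdep _
    have h2 : 1 ≤ W x * c := by
      calc (1 : ℝ) = (R / 2) ^ d * (2 / R) ^ d := by
            rw [← mul_pow]; field_simp; simp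
        _ ≤ W x * c := mul_le_mul h1 (le_max_right _ _) (by positivity) (hW0 x)
    nlinarith [hx.1]
  have hy0 : 0 ≤ W x * J x := mul_nonneg (hW0 x) hx.1
  set y := W x * J x with hy
  have hl1 := one_le_log_exp_add hy0
  have hlog : Real.log (Real.exp 1 + J x) ≤ (1 + Real.log c) * Real.log (Real.exp 1 + y) := by
    have h1 := log_exp_add_le_log_exp_add hx.1 hJc
    have h2 := log_exp_add_mul_le hy0 hc1
    nlinarith
  have hJl := one_le_log_exp_add hx.1
  calc J x * Real.log (Real.exp 1 + J x) ^ a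
      ≤ (y * c) * ((1 + Real.log c) * Real.log (Real.exp 1 + y)) ^ a := by
        gcongr
    _ = Q * (y * Real.log (Real.exp 1 + y) ^ a) := by
        rw [Real.mul_rpow (by positivity) (by positivity), hQ]
        ring

end Localization

/-! ### Comparing logarithms of `J`, `G` and `|Df|`. -/

section LogComparison

/-- The truncated bound with `A = 1` and `T = max G 1`, for which both truncations are inactive; the
1 keeps `T` positive when `G = 0`. -/
theorem exists_mul_log_rpow_sub_one_le {lam : ℝ} (a : ℝ) (hlam : 0 < lam) :
    ∃ M : ℝ, 0 ≤ M ∧ ∀ J G K : ℝ, 0 ≤ J → J ≤ G → G ≤ K * J → 1 ≤ K →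
      G * Real.log (Real.exp 1 + G) ^ (a - 1) ≤
        4 / lam * (J * Real.log (Real.exp 1 + J) ^ a) + M * (J + Real.exp (lam * K)) := by
  obtain ⟨M, hM, h⟩ := exists_truncated_log_bound (s := 1 / 2) (A := 1) (a := a) (by norm_num)
    (by norm_num) le_rfl hlam
  refine ⟨M, hM, fun J G K hJ hJG hGK hK => ?_⟩
  have hG := hJ.trans hJG
  have := h J G K (max G 1) hJ hJG hGK hK (by positivity)
  rw [one_mul, min_eq_right (le_max_left _ _), min_eq_left (hJG.trans (le_max_left _ _)),
    ← mul_assoc, ← Real.rpow_add_of_nonneg hG (by norm_num) (by norm_num), add_sub_cancel,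
    Real.rpow_one, mul_one] at this
  exact this

theorem log_exp_add_pow_le {n : ℕ} (hn : n ≠ 0) {w y : ℝ} (hw : 0 ≤ w) (hy : 0 ≤ y) :
    Real.log (Real.exp 1 + w * y ^ n) ≤
      (Real.log (max 1 w) + n) * Real.log (Real.exp 1 + y) := by
  have hc : 1 ≤ max 1 w := le_max_left _ _
  have h1 := one_le_log_exp_add hy
  have he : 1 ≤ Real.exp 1 := Real.one_le_exp (by norm_num)
  have h2 : Real.exp 1 + w * y ^ n ≤ max 1 w * (Real.exp 1 + y) ^ n := by
    have h3 : Real.exp 1 ^ n + y ^ n ≤ (Real.exp 1 + y) ^ n :=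
      pow_add_pow_le (by positivity) hy hn
    have h4 : Real.exp 1 ≤ Real.exp 1 ^ n := le_self_pow₀ he hn
    have h5 : w * y ^ n ≤ max 1 w * y ^ n := by gcongr; exact le_max_right _ _
    nlinarith
  calc Real.log (Real.exp 1 + w * y ^ n) ≤ Real.log (max 1 w * (Real.exp 1 + y) ^ n) :=
        Real.log_le_log (by positivity) h2
    _ = Real.log (max 1 w) + n * Real.log (Real.exp 1 + y) := by
        rw [Real.log_mul (by positivity) (by positivity), Real.log_pow]
    _ ≤ _ := by nlinarith [Real.log_nonneg hc]

theorem log_exp_add_le_log_exp_add_pow {n : ℕ} (hn : n ≠ 0) {w y : ℝ} (hw : 0 < w) (hy : 0 ≤ y) :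
    Real.log (Real.exp 1 + y) ≤
      (Real.log (max 2 w⁻¹) + 1) * Real.log (Real.exp 1 + w * y ^ n) := by
  have hc : 2 ≤ max 2 w⁻¹ := le_max_left _ _
  have hcw : 1 ≤ max 2 w⁻¹ * w := by
    rw [← inv_mul_cancel₀ hw.ne']
    gcongr
    exact le_max_right _ _
  have hx : 0 ≤ w * y ^ n := by positivity
  have h1 := one_le_log_exp_add hx
  have he : 1 ≤ Real.exp 1 := Real.one_le_exp (by norm_num)
  have hy1 : y ≤ 1 + y ^ n := by
    rcases le_total y 1 with h | h
    · linarith [pow_nonneg hy n]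
    · linarith [le_self_pow₀ h hn]
  have h2 : Real.exp 1 + y ≤ max 2 w⁻¹ * (Real.exp 1 + w * y ^ n) := by
    nlinarith [pow_nonneg hy n]
  calc Real.log (Real.exp 1 + y) ≤ Real.log (max 2 w⁻¹ * (Real.exp 1 + w * y ^ n)) :=
        Real.log_le_log (by positivity) h2
    _ = Real.log (max 2 w⁻¹) + Real.log (Real.exp 1 + w * y ^ n) := by
        rw [Real.log_mul (by positivity) (by positivity)]
    _ ≤ _ := by nlinarith [Real.log_nonneg (show 1 ≤ max 2 w⁻¹ by linarith)]

/-- The logarithms of `e + y` and `e + w y^n` are comparable in both directions; the sign of `b`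
decides which direction is needed. -/
theorem exists_pow_mul_log_rpow_le {n : ℕ} (hn : n ≠ 0) {w : ℝ} (hw : 0 < w) (b : ℝ) :
    ∃ Q : ℝ, 0 ≤ Q ∧ ∀ y : ℝ, 0 ≤ y → y ^ n * Real.log (Real.exp 1 + y) ^ b ≤
      Q * (w * y ^ n * Real.log (Real.exp 1 + w * y ^ n) ^ b) := by
  suffices h : ∃ L : ℝ, 0 < L ∧ ∀ y : ℝ, 0 ≤ y → Real.log (Real.exp 1 + y) ^ b ≤
      L * Real.log (Real.exp 1 + w * y ^ n) ^ b by
    obtain ⟨L, hL, h⟩ := h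
    refine ⟨L / w, by positivity, fun y hy => ?_⟩
    calc y ^ n * Real.log (Real.exp 1 + y) ^ b
        ≤ y ^ n * (L * Real.log (Real.exp 1 + w * y ^ n) ^ b) :=
          mul_le_mul_of_nonneg_left (h y hy) (by positivity)
      _ = _ := by field_simp
  rcases le_total 0 b with hb | hb
  · set L := Real.log (max 2 w⁻¹) + 1 with hL
    have hL0 : 0 < L := by
      have := Real.log_nonneg (show 1 ≤ max 2 w⁻¹ by linarith [le_max_left 2 w⁻¹])
      linarith
    refine ⟨L ^ b, by positivity, fun y hy => ?_⟩
    have h1 := one_le_log_exp_add hy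
    have h2 := one_le_log_exp_add (show 0 ≤ w * y ^ n by positivity)
    rw [← Real.mul_rpow hL0.le (by positivity)]
    exact Real.rpow_le_rpow (by positivity) (log_exp_add_le_log_exp_add_pow hn hw hy) hb
  · set L := Real.log (max 1 w) + n with hL
    have hL0 : 0 < L := by
      have := Real.log_nonneg (le_max_left 1 w)
      have : (0 : ℝ) < n := by exact_mod_cast Nat.pos_of_ne_zero hn
      linarith
    refine ⟨L⁻¹ ^ b, by positivity, fun y hy => ?_⟩
    have h1 := one_le_log_exp_add hy
    have h2 := one_le_log_exp_add (show 0 ≤ w * y ^ n by positivity)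
    rw [← Real.mul_rpow (by positivity) (by positivity)]
    refine Real.rpow_le_rpow_of_nonpos (by positivity) ?_ hb
    rw [inv_mul_le_iff₀ hL0]
    exact log_exp_add_pow_le hn hw.le hy

end LogComparison

/-! ### Local higher integrability on open sets. -/

section HigherIntegrability

open Metric Set Filter Topology Module
open scoped NNReal

variable {E : Type*} [NormedAddCommGroup E] [NormedSpace ℝ E] [FiniteDimensional ℝ E]
  [MeasurableSpace E] [BorelSpace E]

theorem aemeasurable_mul_log_rpow {α : Type*} [MeasurableSpace α] {ν : Measure α} {g h : α → ℝ}
    (hg : AEMeasurable g ν) (hh : AEMeasurable h ν) (a : ℝ) :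
    AEMeasurable (fun x => g x * Real.log (Real.exp 1 + h x) ^ a) ν :=
  hg.mul ((Real.measurable_log.comp_aemeasurable (hh.const_add _)).pow_const a)

/-- Local higher integrability of a function satisfying a reverse Hölder inequality with
exponentially integrable distortion. -/
theorem exists_locallyIntegrableOn_log [Nontrivial E] (μ : Measure E) [μ.IsAddHaarMeasure]
    {s : ℝ} (hs0 : 0 < s) (hs1 : s < 1) (C : ℝ≥0) {n : ℕ} (hn : n ≠ 0) :
    ∃ c : ℝ, 0 < c ∧ ∀ (Ω : Set E) (J D K : E → ℝ) (w lam a : ℝ), IsOpen Ω → 0 < w → 0 < lam →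
      a < c * lam → LocallyIntegrableOn J Ω μ → LocallyIntegrableOn D Ω μ →
      LocallyIntegrableOn (fun x => Real.exp (lam * K x)) Ω μ → (∀ x, 0 ≤ D x) →
      (∀ᵐ x ∂μ.restrict Ω, 0 ≤ J x ∧ J x ≤ w * D x ^ n ∧ w * D x ^ n ≤ K x * J x ∧ 1 ≤ K x) →
      (∀ x r, 0 < r → closedBall x (2 * r) ⊆ Ω →
        (∫⁻ y in closedBall x r, ENNReal.ofReal (J y) ∂μ) ^ s ≤
          C * μ (closedBall x r) ^ (s - 1) *
            ∫⁻ y in closedBall x (2 * r), ENNReal.ofReal (w * D y ^ n) ^ s ∂μ) →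
      LocallyIntegrableOn (fun x => J x * Real.log (Real.exp 1 + J x) ^ a) Ω μ ∧
      LocallyIntegrableOn (fun x => D x ^ n * Real.log (Real.exp 1 + D x) ^ (a - 1)) Ω μ := by
  obtain ⟨c, hc, hmain⟩ := exists_lintegral_mul_log_rpow_ne_top μ hs0 hs1 C
  refine ⟨c, hc, ?_⟩
  intro Ω J D K w lam a hΩ hw hlam ha hJ hD hK hD0 hae hRH
  suffices h : ∀ z ∈ Ω, ∃ U ∈ 𝓝[Ω] z,
      IntegrableOn (fun x => J x * Real.log (Real.exp 1 + J x) ^ a) U μ ∧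
      IntegrableOn (fun x => D x ^ n * Real.log (Real.exp 1 + D x) ^ (a - 1)) U μ by
    refine ⟨fun z hz => ?_, fun z hz => ?_⟩
    · obtain ⟨U, hU, h1, _⟩ := h z hz
      exact ⟨U, hU, h1⟩
    · obtain ⟨U, hU, _, h2⟩ := h z hz
      exact ⟨U, hU, h2⟩
  intro z hz
  obtain ⟨R, hR, hRΩ⟩ := nhds_basis_closedBall.mem_iff.1 (hΩ.mem_nhds hz)
  have hBΩ : ball z R ⊆ Ω := ball_subset_closedBall.trans hRΩ
  have hJB : IntegrableOn J (ball z R) μ :=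
    (hJ.integrableOn_compact_subset hRΩ (isCompact_closedBall _ _)).mono_set ball_subset_closedBall
  have hDB : IntegrableOn D (ball z R) μ :=
    (hD.integrableOn_compact_subset hRΩ (isCompact_closedBall _ _)).mono_set ball_subset_closedBall
  have hKB : IntegrableOn (fun x => Real.exp (lam * K x)) (ball z R) μ :=
    (hK.integrableOn_compact_subset hRΩ (isCompact_closedBall _ _)).mono_set ball_subset_closedBall
  have haeB := ae_restrict_of_ae_restrict_of_subset hBΩ hae
  have hJm : AEMeasurable J (μ.restrict (ball z R)) := hJB.aemeasurable
  have hGm : AEMeasurable (fun x => w * D x ^ n) (μ.restrict (ball z R)) :=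
    (hDB.aemeasurable.pow_const n).const_mul w
  -- The ball estimate requires measurable functions on the whole space, so representatives are used
  -- and every hypothesis is transferred almost everywhere.
  set J' := hJm.mk J with hJ'
  set G' := hGm.mk _ with hG'
  have hJeq : J =ᵐ[μ.restrict (ball z R)] J' := hJm.ae_eq_mk
  have hGeq : (fun x => w * D x ^ n) =ᵐ[μ.restrict (ball z R)] G' := hGm.ae_eq_mk
  -- The absorption argument needs a positive exponent. Raising `a` to `a'` is harmless because the
  -- logarithm is at least 1, so the bound for `a'` implies the one for `a`.
  set a' := max a (c * lam / 2) with ha'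
  have hcl : 0 < c * lam := by positivity
  have ha'0 : 0 < a' := lt_of_lt_of_le (by positivity) (le_max_right _ _)
  have ha'c : a' ≤ c * lam := max_le ha.le (by linarith)
  have hfin := hmain J' G' K z R lam a' hJm.measurable_mk hGm.measurable_mk hR hlam ha'0 ha'c
    (by
      filter_upwards [haeB, hJeq, hGeq] with x hx h1 h2
      rw [← h1, ← h2]
      exact hx)
    (by
      have e : ∫⁻ y in ball z R, ENNReal.ofReal (J' y) ∂μ =
          ∫⁻ y in ball z R, ENNReal.ofReal (J y) ∂μ :=
        lintegral_congr_ae (hJeq.mono fun y hy => congrArg ENNReal.ofReal hy.symm)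
      rw [e]
      exact hJB.lintegral_lt_top.ne)
    hKB.lintegral_lt_top.ne
    (by
      intro x r hr hsub
      have hsub' : closedBall x r ⊆ ball z R :=
        (closedBall_subset_closedBall (by linarith)).trans hsub
      have e1 : ∫⁻ y in closedBall x r, ENNReal.ofReal (J' y) ∂μ =
          ∫⁻ y in closedBall x r, ENNReal.ofReal (J y) ∂μ :=
        lintegral_congr_ae ((ae_restrict_of_ae_restrict_of_subset hsub' hJeq).mono
          fun y hy => congrArg ENNReal.ofReal hy.symm)
      have e2 : ∫⁻ y in closedBall x (2 * r), ENNReal.ofReal (G' y) ^ s ∂μ =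
          ∫⁻ y in closedBall x (2 * r), ENNReal.ofReal (w * D y ^ n) ^ s ∂μ :=
        lintegral_congr_ae ((ae_restrict_of_ae_restrict_of_subset hsub hGeq).mono
          fun y hy => congrArg (ENNReal.ofReal · ^ s) hy.symm)
      rw [e1, e2]
      exact hRH x r hr (hsub.trans hBΩ))
  have hsubR : ball z (R / 2) ⊆ ball z R := ball_subset_ball (by linarith)
  have haeH := ae_restrict_of_ae_restrict_of_subset hsubR haeB
  have hJmH : AEMeasurable J (μ.restrict (ball z (R / 2))) :=
    hJm.mono_measure (Measure.restrict_mono hsubR le_rfl)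
  have hDmH : AEMeasurable D (μ.restrict (ball z (R / 2))) :=
    hDB.aemeasurable.mono_measure (Measure.restrict_mono hsubR le_rfl)
  have hInt : IntegrableOn (fun x => J x * Real.log (Real.exp 1 + J x) ^ a') (ball z (R / 2)) μ := by
    rw [IntegrableOn, ← lintegral_ofReal_ne_top_iff_integrable
      (aemeasurable_mul_log_rpow hJmH hJmH a').aestronglyMeasurable]
    · convert hfin using 1
      refine lintegral_congr_ae ((ae_restrict_of_ae_restrict_of_subset hsubR hJeq).mono
        fun y hy => ?_)
      simp only [hy]
    · filter_upwards [haeH] with x hx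
      have := one_le_log_exp_add hx.1
      exact mul_nonneg hx.1 (by positivity)
  have hInt_a : IntegrableOn (fun x => J x * Real.log (Real.exp 1 + J x) ^ a) (ball z (R / 2)) μ := by
    refine Integrable.mono' hInt (aemeasurable_mul_log_rpow hJmH hJmH a).aestronglyMeasurable ?_
    filter_upwards [haeH] with x hx
    have h1 := one_le_log_exp_add hx.1
    rw [Real.norm_of_nonneg (mul_nonneg hx.1 (by positivity))]
    exact mul_le_mul_of_nonneg_left (Real.rpow_le_rpow_of_exponent_le h1 (le_max_left _ _)) hx.1
  refine ⟨ball z (R / 2), mem_nhdsWithin_of_mem_nhds (ball_mem_nhds z (by positivity)), hInt_a, ?_⟩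
  obtain ⟨M, hM, hMle⟩ := exists_mul_log_rpow_sub_one_le a hlam
  obtain ⟨Q, hQ, hQle⟩ := exists_pow_mul_log_rpow_le hn hw (a - 1)
  have hdom : IntegrableOn (fun x => Q * (4 / lam * (J x * Real.log (Real.exp 1 + J x) ^ a) +
      M * (J x + Real.exp (lam * K x)))) (ball z (R / 2)) μ :=
    ((hInt_a.const_mul _).add (((hJB.mono_set hsubR).add (hKB.mono_set hsubR)).const_mul M)).const_mul Q
  refine Integrable.mono' hdom
    (aemeasurable_mul_log_rpow (hDmH.pow_const n) hDmH (a - 1)).aestronglyMeasurable ?_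
  filter_upwards [haeH] with x hx
  have h1 := one_le_log_exp_add (hD0 x)
  rw [Real.norm_of_nonneg (mul_nonneg (pow_nonneg (hD0 x) _) (by positivity))]
  exact (hQle _ (hD0 x)).trans
    (mul_le_mul_of_nonneg_left (hMle _ _ _ hx.1 hx.2.1 hx.2.2.1 hx.2.2.2) hQ)

end HigherIntegrability

/-! ### Constant coefficients and the comass norm. -/

section ConstantForms

variable {n m : ℕ}

/-- An alternating map is determined by injective tuples of basis vectors; sorting such a tuple
gives an increasing one and changes the value only by a sign independent of the point. -/
theorem DiffForm.HasConstantCoefficients.eq_const {ω : DiffForm n m}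
    (hω : ω.HasConstantCoefficients) (p q : EuclideanSpace ℝ (Fin m)) : ω p = ω q := by
  apply ContinuousAlternatingMap.toAlternatingMap_injective
  refine Module.Basis.ext_alternating (EuclideanSpace.basisFun (Fin m) ℝ).toBasis fun v hv => ?_
  have hmono : StrictMono (v ∘ Tuple.sort v) :=
    (Tuple.monotone_sort v).strictMono_of_injective (hv.comp (Tuple.sort v).injective)
  obtain ⟨c, hc⟩ := hω _ hmono
  have hpq : ω.coeff (v ∘ Tuple.sort v) p = ω.coeff (v ∘ Tuple.sort v) q := by rw [hc, hc]
  have hperm : ∀ x, ω.coeff (v ∘ Tuple.sort v) x = Equiv.Perm.sign (Tuple.sort v) •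
      ω x (fun k => EuclideanSpace.basisFun (Fin m) ℝ (v k)) := fun x =>
    (ω x).toAlternatingMap.map_perm (fun k => EuclideanSpace.basisFun (Fin m) ℝ (v k))
      (Tuple.sort v)
  rw [hperm, hperm] at hpq
  have := smul_left_cancel _ hpq
  simpa using this

/-- By multilinearity the operator norm bound reduces to vectors of norm at most 1; zero vectors are
harmless since both sides vanish. -/
theorem DiffForm.comass_eq_norm (ω : DiffForm n m) (p : EuclideanSpace ℝ (Fin m)) :
    ω.comass p = ‖ω p‖ := by
  have hbdd : ∀ t ∈ {t : ℝ | ∃ v : Fin n → EuclideanSpace ℝ (Fin m), (∀ i, ‖v i‖ ≤ 1) ∧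
      t = |ω p v|}, t ≤ ‖ω p‖ := by
    rintro t ⟨v, hv, rfl⟩
    exact (ω p).unit_le_opNorm ((pi_norm_le_iff_of_nonneg zero_le_one).2 hv)
  have hne : {t : ℝ | ∃ v : Fin n → EuclideanSpace ℝ (Fin m), (∀ i, ‖v i‖ ≤ 1) ∧
      t = |ω p v|}.Nonempty := ⟨|ω p 0|, 0, by simp, rfl⟩
  refine le_antisymm (csSup_le hne hbdd) ?_
  have hle : ∀ v : Fin n → EuclideanSpace ℝ (Fin m), (∀ i, ‖v i‖ ≤ 1) → |ω p v| ≤ ω.comass p :=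
    fun v hv => le_csSup ⟨_, hbdd⟩ ⟨v, hv, rfl⟩
  refine (ω p).opNorm_le_bound ((abs_nonneg _).trans (hle 0 (by simp))) fun v => ?_
  have hv : v = fun i => ‖v i‖ • (‖v i‖⁻¹ • v i) := by
    ext1 i
    by_cases h : v i = 0
    · simp [h]
    · rw [smul_inv_smul₀ (norm_ne_zero_iff.2 h)]
  conv_lhs => rw [hv, (ω p).map_smul_univ]
  rw [norm_smul, mul_comm, Real.norm_of_nonneg (Finset.prod_nonneg fun i _ => norm_nonneg _)]
  refine mul_le_mul_of_nonneg_right (hle _ fun i => ?_) (Finset.prod_nonneg fun i _ => norm_nonneg _)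
  rw [norm_smul, norm_inv, norm_norm]
  exact inv_mul_le_one_of_le₀ le_rfl (norm_nonneg _)

end ConstantForms

theorem starPullback_eq_of_eq_const {n m : ℕ} {ω : DiffForm n m}
    (hω : ω.HasConstantCoefficients)
    (f : EuclideanSpace ℝ (Fin n) → EuclideanSpace ℝ (Fin m))
    (Df : EuclideanSpace ℝ (Fin n) → EuclideanSpace ℝ (Fin n) →L[ℝ] EuclideanSpace ℝ (Fin m))
    (x : EuclideanSpace ℝ (Fin n)) :
    starPullback ω f Df x =
      ω 0 (fun i => Df x (EuclideanSpace.basisFun (Fin n) ℝ i)) := by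
  rw [starPullback, hω.eq_const (f x) 0]
  rfl

theorem theorem1p7 (n : ℕ) (hn : 2 ≤ n) :
    ∃ c₃ : ℝ, 0 < c₃ ∧
      ∀ (m : ℕ), n ≤ m →
      ∀ (Ω : Set (EuclideanSpace ℝ (Fin n))), IsOpen Ω → IsConnected Ω →
      ∀ (ω : DiffForm n m), IsVolumeForm ω → ω.HasConstantCoefficients →
      ∀ (f : EuclideanSpace ℝ (Fin n) → EuclideanSpace ℝ (Fin m))
        (Df : EuclideanSpace ℝ (Fin n) →
          EuclideanSpace ℝ (Fin n) →L[ℝ] EuclideanSpace ℝ (Fin m))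
        (K : EuclideanSpace ℝ (Fin n) → ℝ),
        IsFiniteDistortionCurve Ω ω f Df K →
        MemSobolevLoc Ω (n : ℝ≥0∞) f Df →
      ∀ (lam : ℝ), 0 < lam →
        LocallyIntegrableOn (fun x => Real.exp (lam * K x)) Ω volume →
      ∀ (a : ℝ), a < c₃ * lam →
        LocallyIntegrableOn
          (fun x => starPullback ω f Df x *
            Real.log (Real.exp 1 + starPullback ω f Df x) ^ a) Ω volume ∧
        LocallyIntegrableOn
          (fun x => ‖Df x‖ ^ n * Real.log (Real.exp 1 + ‖Df x‖) ^ (a - 1)) Ω volume := by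
  have hn0 : (2 : ℝ) ≤ n := by exact_mod_cast hn
  have hfr : Module.finrank ℝ (EuclideanSpace ℝ (Fin n)) = n := by simp
  have hnt : Nontrivial (EuclideanSpace ℝ (Fin n)) :=
    Module.nontrivial_of_finrank_pos (R := ℝ) (by omega)
  obtain ⟨s, hs⟩ : ∃ s : ℝ, s = 1 - 1 / (n * (2 * n + 1)) := ⟨_, rfl⟩
  have hd0 : 0 < 1 / ((n : ℝ) * (2 * n + 1)) := by positivity
  have hd1 : 1 / ((n : ℝ) * (2 * n + 1)) < 1 := by
    rw [div_lt_one (by positivity)]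
    nlinarith
  -- Both `C` and the constant `c` derived from it are obtained before `m`, `ω` and `f` appear,
  -- which gives the dependence on `n` alone.
  obtain ⟨C, hC⟩ := exists_reverse_holder.{0} (volume : Measure (EuclideanSpace ℝ (Fin n))) hn hfr hs
  obtain ⟨c, hc, hmain⟩ := exists_locallyIntegrableOn_log
    (volume : Measure (EuclideanSpace ℝ (Fin n))) (s := s) (by linarith) (by linarith) C
    (n := n) (by omega)
  refine ⟨c, hc, ?_⟩
  intro m _ Ω hΩ _ ω hvol hconst f Df K hcurve hsob lam hlam hexp a ha
  have hw : 0 < ‖ω 0‖ := norm_pos_iff.2 (hvol.nonvanishing 0)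
  have he : ∀ i, ‖EuclideanSpace.basisFun (Fin n) ℝ i‖ ≤ 1 := fun i =>
    ((EuclideanSpace.basisFun (Fin n) ℝ).orthonormal.1 i).le
  have hae : ∀ᵐ x ∂volume.restrict Ω, 0 ≤ starPullback ω f Df x ∧
      starPullback ω f Df x ≤ ‖ω 0‖ * ‖Df x‖ ^ n ∧
      ‖ω 0‖ * ‖Df x‖ ^ n ≤ K x * starPullback ω f Df x ∧ 1 ≤ K x := by
    filter_upwards [hcurve.one_le_distortion, hcurve.distortion_inequality] with x hK hdist
    rw [ω.comass_eq_norm, hconst.eq_const (f x) 0] at hdist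
    refine ⟨?_, ?_, hdist, hK⟩
    -- The sign of the pullback is not assumed: it follows from the distortion inequality and `K ≥
    -- 1`.
    · have h1 : 0 ≤ K x * starPullback ω f Df x := le_trans (by positivity) hdist
      exact nonneg_of_mul_nonneg_right h1 (by linarith)
    · rw [starPullback_eq_of_eq_const hconst]
      have := norm_alternating_apply_le (ω 0) he (Df x)
      rw [Fintype.card_fin] at this
      exact (le_abs_self _).trans this
  have hweak := hsob.hasWeakFDerivOn
  refine hmain Ω (starPullback ω f Df) (fun x => ‖Df x‖) K ‖ω 0‖ lam a hΩ hw hlam ha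
    hcurve.locallyIntegrable_star hweak.locallyIntegrable_deriv.norm hexp (fun x => norm_nonneg _)
    hae fun x r hr hball => ?_
  have hJeq : starPullback ω f Df = fun x =>
      ω 0 (fun i => Df x (EuclideanSpace.basisFun (Fin n) ℝ i)) :=
    funext (starPullback_eq_of_eq_const hconst f Df)
  rw [hJeq]
  refine hC _ Ω f Df (ω 0) _ hΩ hweak.locallyIntegrable hweak.locallyIntegrable_deriv
    hweak.integral_eq hsob.memLp_deriv he ?_ x r hr hball
  filter_upwards [hae] with y hy
  rw [← starPullback_eq_of_eq_const hconst f Df]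
  exact hy.1
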